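/- Let $\mathbb F$ be an algebraically closed field of characteristic $0$. For $\underline\ell=(\ell_1,\dots,\ell_7)\in\mathbb N^7\setminus\{0\}$ let $I=I_1\sqcup\dots\sqcup I_7$ with $|I_k|=\ell_k$, put $I_{i,j}=I_i\cup\dots\cup I_j$, let $\overline I=\{\bar p: p\in I\}$ be a disjoint copy of $I$, $J=I\sqcup\overline I$ (with $\bar{\bar p}=p$), and for $K\subseteq I$ write $\overline K=\{\bar p:p\in K\}$; put $J_{i}=I_i\cup\overline I_i$ and $J_{i,j}=I_{i,j}\cup\overline I_{i,j}$. Let $\varepsilon_r$ ($r\in J$) be the standard basis of $\mathbb F^J$, and for $p\in I$ put $\sigma_p=\varepsilon_p+\varepsilon_{\bar p}$ if $p\in I_1\cup I_3\cup I_4$, $\sigma_p=\varepsilon_p$ if $p\in I_2$, and $\sigma_p=0$ if $p\in I_5\cup I_6\cup I_7$. For $\alpha\in\mathbb F^J$ and $K\subseteq J$ let $\alpha_K$ be the row vector $(\alpha_r)_{r\in K}$. Call an additive subgroup $\Gamma\subseteq\mathbb F^J$ *admissible* if $\alpha_r=0$ for all $\alpha\in\Gamma$ and $r\in\overline I_{5,6}\cup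 J_7$; $\sigma_p\in\Gamma$ for $p\in I_{1,4}$; $\varepsilon_q\in\Gamma$ for $q\in I_{5,6}$; and $\mathbb F\varepsilon_r\cap\Gamma\neq\{0\}$ for $r\in J_{1,4}$. Let $\mathcal J$ be the set of $\underline i\in\mathbb N^J$ with $i_r=0$ for $r\in J_1\cup\overline I_{2,3}\cup I_5$, and let $\mathcal A=\mathbb F[\Gamma\times\mathcal J]$ be the semigroup algebra with basis $x^{\alpha,\underline i}$, $(\alpha,\underline i)\in\Gamma\times\mathcal J$; write $x^\alpha=x^{\alpha,0}$. For $r\in J$ let $\partial_r$ be the derivation $\partial_r(x^{\alpha,\underline i})=\alpha_r x^{\alpha,\underline i}+i_r x^{\alpha,\underline i-\varepsilon_r}$ (the last term being $0$ if $i_r=0$). The Hamiltonian Lie algebra $\mathcal H(\underline\ell,\Gamma)$ is the vector space $\mathcal A$ with the Lie bracket $$[u,v]=\sum_{p\in I}x^{\sigma_p}\bigl(\partial_p(u)\,\partial_{\bar p}(v)-\partial_{\bar p}(u)\,\partial_p(v)\bigr).$$ For admissible subgroups $\Gamma,\Gamma'$ of the same $\mathbb F^J$, a group isomorphism $\tau:\Gamma\to\Gamma'$,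 $\alpha\mapsto\alpha^*$, is called *preserving* if there are * a permutation $p\mapsto p^*$ of $I_{1,4}$ mapping each of $I_1,I_2,I_3,I_4$ to itself and scalars $a_p,b_p\in\mathbb F$ ($p\in I_{1,4}$) with $b_p\neq0$ such that $(\alpha^*_{p^*},\alpha^*_{\overline{p^*}})=(\alpha_p,\alpha_{\bar p})A_p$ for all $\alpha\in\Gamma$, $p\in I_{1,4}$, where $$A_p=\begin{pmatrix}a_p+b_p&a_p\\1-a_p-b_p&1-a_p\end{pmatrix},\quad\begin{pmatrix}1&0\\a_p&b_p\end{pmatrix},\quad\begin{pmatrix}b_p&0\\1-b_p&1\end{pmatrix}$$ for $p\in I_1\cup I_4$, $p\in I_2$, $p\in I_3$ respectively; * matrices $B_{1,5},B_{2,5},B_{1,6},B_{2,6},B_{3,6},B_{5,6}$ over $\mathbb F$ of sizes $\ell_1\times\ell_5$, $\ell_2\times\ell_5$, $\ell_1\times\ell_6$, $\ell_2\times\ell_6$, $(\ell_3+\ell_4)\times\ell_6$, $\ell_5\times\ell_6$, and $B_{5,5}\in GL_{\ell_5}(\mathbb F)$, $B_{6,6}\in GL_{\ell_6}(\mathbb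 F)$, such that for all $\alpha\in\Gamma$ $$\alpha^*_{I_5}=(\alpha_{I_1}-\alpha_{\overline I_1})B_{1,5}-\alpha_{\overline I_2}B_{2,5}+\alpha_{I_5}B_{5,5},$$ $$\alpha^*_{I_6}=(\alpha_{I_1}-\alpha_{\overline I_1})B_{1,6}-\alpha_{\overline I_2}B_{2,6}+(\alpha_{I_{3,4}}-\alpha_{\overline I_{3,4}})B_{3,6}+\alpha_{I_5}B_{5,6}+\alpha_{I_6}B_{6,6}.$$ **Theorem.** Let $\underline\ell,\underline\ell'\in\mathbb N^7\setminus\{0\}$, and let $\Gamma$, $\Gamma'$ be admissible subgroups for $\underline\ell$, $\underline\ell'$ respectively. Then $\mathcal H(\underline\ell,\Gamma)$ and $\mathcal H(\underline\ell',\Gamma')$ are isomorphic as Lie algebras over $\mathbb F$ if and only if $\underline\ell=\underline\ell'$ and there exists a preserving isomorphism $\tau:\Gamma\to\Gamma'$. -/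

import Mathlib

noncomputable section

namespace HamLie

/-- The index set `I`, the disjoint union of the seven blocks `I_1, …, I_7` with `|I_k| = ℓ_k`.
Blocks are numbered from zero here: the block with number `k : Fin 7` is `I_{k+1}`, of size
`ℓ k`. -/
abbrev Idx (ℓ : Fin 7 → ℕ) : Type := Σ k : Fin 7, Fin (ℓ k)

/-- The index set `J = I ∪ Ī`: the element `p ∈ I` is `Sum.inl p` and its partner `p̄ ∈ Ī` is
`Sum.inr p`. -/
abbrev J (ℓ : Fin 7 → ℕ) : Type := Idx ℓ ⊕ Idx ℓ

/-- The indices `r ∈ J` whose derivation `∂_r` is allowed a grading part (types `g` and `m`),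
i.e. the indices in `I_{1,6} ∪ Ī_{1,4}`. -/
def HasGrading {ℓ : Fin 7 → ℕ} : J ℓ → Prop
  | Sum.inl p => p.1 < 6
  | Sum.inr p => p.1 < 4

/-- The indices `r ∈ J` whose derivation `∂_r` has a down-grading part (types `d` and `m`),
i.e. the indices in `I_{2,4} ∪ I_{6,7} ∪ Ī_{4,7}`. -/
def HasDown {ℓ : Fin 7 → ℕ} : J ℓ → Prop
  | Sum.inl p => p.1 ≠ 0 ∧ p.1 ≠ 4
  | Sum.inr p => 3 ≤ p.1

/-- The vectors `σ_p`, `p ∈ I`: `ε_p + ε_p̄` on `I_1 ∪ I_3 ∪ I_4`, `ε_p` on `I_2`, and `0` on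
`I_5 ∪ I_6 ∪ I_7`. -/
def sigma (F : Type*) [Field F] {ℓ : Fin 7 → ℕ} (p : Idx ℓ) : J ℓ → F :=
  if p.1 = 1 then Pi.single (Sum.inl p) 1
  else if p.1 < 4 then Pi.single (Sum.inl p) 1 + Pi.single (Sum.inr p) 1
  else 0

/-- The additive subgroups `Γ` of `F^J` from which the algebras are built. -/
structure AdmissibleSubgroup (F : Type*) [Field F] (ℓ : Fin 7 → ℕ) extends
    AddSubgroup (J ℓ → F) where
  /-- the coordinates in `Ī_{5,6} ∪ J_7` vanish on `Γ` -/
  apply_eq_zero : ∀ α ∈ carrier, ∀ r : J ℓ, ¬ HasGrading r → α r = 0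
  /-- `σ_p ∈ Γ` for `p ∈ I_{1,4}` -/
  sigma_mem_of_lt : ∀ p : Idx ℓ, p.1 < 4 → sigma F p ∈ carrier
  /-- `ε_q ∈ Γ` for `q ∈ I_{5,6}` -/
  single_mem : ∀ q : Idx ℓ, 4 ≤ q.1 → q.1 < 6 → (Pi.single (Sum.inl q) 1 : J ℓ → F) ∈ carrier
  /-- `F ε_p ∩ Γ ≠ {0}` for `p ∈ I_{1,4}` -/
  exists_single_inl_mem : ∀ p : Idx ℓ, p.1 < 4 →
    ∃ a : F, a ≠ 0 ∧ (Pi.single (Sum.inl p) a : J ℓ → F) ∈ carrier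
  /-- `F ε_p̄ ∩ Γ ≠ {0}` for `p ∈ I_{1,4}` -/
  exists_single_inr_mem : ∀ p : Idx ℓ, p.1 < 4 →
    ∃ a : F, a ≠ 0 ∧ (Pi.single (Sum.inr p) a : J ℓ → F) ∈ carrier

/-- The additive monoid `𝒥 ⊆ ℕ^J` of exponents of the down-graded variables: `i_r = 0` for
`r ∈ J_1 ∪ Ī_{2,3} ∪ I_5`. -/
def Expo (ℓ : Fin 7 → ℕ) : AddSubmonoid (J ℓ → ℕ) where
  carrier := {i | ∀ r, ¬ HasDown r → i r = 0}
  zero_mem' := fun _ _ => rfl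
  add_mem' := by
    intro i j hi hj r hr
    simp [hi r hr, hj r hr]

/-- `i - ε_r`. It is only used with a coefficient that vanishes when `i_r = 0`. -/
def lower {ℓ : Fin 7 → ℕ} (r : J ℓ) (i : Expo ℓ) : Expo ℓ :=
  ⟨(i : J ℓ → ℕ) - Pi.single r 1, by
    intro s hs
    have := i.2 s hs
    simp [this]⟩

section Algebra

variable {F : Type*} [Field F] {ℓ : Fin 7 → ℕ} (Γ : AdmissibleSubgroup F ℓ)

theorem sigma_mem (p : Idx ℓ) : sigma F p ∈ Γ.toAddSubgroup := by
  by_cases h : p.1 < 4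
  · exact Γ.sigma_mem_of_lt p h
  · have h1 : p.1 ≠ 1 := by
      intro h1
      rw [h1] at h
      exact h (by decide)
    have : sigma F p = 0 := by simp [sigma, h, h1]
    rw [this]
    exact Γ.toAddSubgroup.zero_mem

/-- The commutative associative algebra `𝒜 = F[Γ × 𝒥]`, with basis
`x^{α,i} = AddMonoidAlgebra.single (α, i) 1`. -/
abbrev SemigroupAlg : Type _ := AddMonoidAlgebra F (Γ.toAddSubgroup × Expo ℓ)

/-- The grading operator `∂*_r : x^{α,i} ↦ α_r x^{α,i}`. -/
def gradingOp (r : J ℓ) : SemigroupAlg Γ →ₗ[F] SemigroupAlg Γ :=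
  (Finsupp.linearCombination F fun m : Γ.toAddSubgroup × Expo ℓ =>
    (AddMonoidAlgebra.single m ((m.1 : J ℓ → F) r) : SemigroupAlg Γ)) ∘ₗ
    (AddMonoidAlgebra.coeffLinearEquiv F).toLinearMap

/-- The down-grading operator `∂_{t_r} : x^{α,i} ↦ i_r x^{α,i-ε_r}`. -/
def downOp (r : J ℓ) : SemigroupAlg Γ →ₗ[F] SemigroupAlg Γ :=
  (Finsupp.linearCombination F fun m : Γ.toAddSubgroup × Expo ℓ =>
    (AddMonoidAlgebra.single (m.1, lower r m.2) (((m.2 : J ℓ → ℕ) r : ℕ) : F) :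
      SemigroupAlg Γ)) ∘ₗ
    (AddMonoidAlgebra.coeffLinearEquiv F).toLinearMap

/-- The derivation `∂_r = ∂*_r + ∂_{t_r}`. -/
def der (r : J ℓ) : SemigroupAlg Γ →ₗ[F] SemigroupAlg Γ := gradingOp Γ r + downOp Γ r

/-- The element `x^{σ_p}`. -/
def xSigma (p : Idx ℓ) : SemigroupAlg Γ :=
  AddMonoidAlgebra.single (⟨sigma F p, sigma_mem Γ p⟩, 0) 1

/-- The bracket
`[u, v] = ∑_{p ∈ I} x^{σ_p} (∂_p(u) ∂_p̄(v) - ∂_p̄(u) ∂_p(v))`. -/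
def bracket (u v : SemigroupAlg Γ) : SemigroupAlg Γ :=
  ∑ p : Idx ℓ, xSigma Γ p *
    (der Γ (Sum.inl p) u * der Γ (Sum.inr p) v - der Γ (Sum.inr p) u * der Γ (Sum.inl p) v)

theorem gradingOp_single (r : J ℓ) (α : Γ.toAddSubgroup) (i : Expo ℓ) (c : F) :
    gradingOp Γ r (AddMonoidAlgebra.single (α, i) c) =
      AddMonoidAlgebra.single (α, i) (c * (α : J ℓ → F) r) := by
  simp [gradingOp]

theorem downOp_single (r : J ℓ) (α : Γ.toAddSubgroup) (i : Expo ℓ) (c : F) :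
    downOp Γ r (AddMonoidAlgebra.single (α, i) c) =
      AddMonoidAlgebra.single (α, lower r i) (c * (((i : J ℓ → ℕ) r : ℕ) : F)) := by
  simp [downOp]

theorem lower_add {r : J ℓ} {i : Expo ℓ} (j : Expo ℓ) (h : (i : J ℓ → ℕ) r ≠ 0) :
    lower r (i + j) = lower r i + j := by
  ext s
  by_cases hs : s = r
  · subst hs
    simp [lower]
    omega
  · simp [lower, hs]

theorem lower_comm (r s : J ℓ) (i : Expo ℓ) : lower r (lower s i) = lower s (lower r i) := by
  ext t
  simp only [lower, Pi.sub_apply]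
  omega

theorem gradingOp_mul (r : J ℓ) (u v : SemigroupAlg Γ) :
    gradingOp Γ r (u * v) = gradingOp Γ r u * v + u * gradingOp Γ r v := by
  induction u using AddMonoidAlgebra.induction_linear with
  | zero => simp
  | add f g hf hg => simp only [add_mul, map_add, hf, hg]; abel
  | single m c =>
    induction v using AddMonoidAlgebra.induction_linear with
    | zero => simp
    | add f g hf hg => simp only [mul_add, map_add, hf, hg]; abel
    | single n d =>
      obtain ⟨α, i⟩ := m
      obtain ⟨β, j⟩ := n
      simp only [AddMonoidAlgebra.single_mul_single, Prod.mk_add_mk, gradingOp_single,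
        ← AddMonoidAlgebra.single_add]
      congr 1
      simp
      ring

theorem downOp_mul (r : J ℓ) (u v : SemigroupAlg Γ) :
    downOp Γ r (u * v) = downOp Γ r u * v + u * downOp Γ r v := by
  induction u using AddMonoidAlgebra.induction_linear with
  | zero => simp
  | add f g hf hg => simp only [add_mul, map_add, hf, hg]; abel
  | single m c =>
    induction v using AddMonoidAlgebra.induction_linear with
    | zero => simp
    | add f g hf hg => simp only [mul_add, map_add, hf, hg]; abel
    | single n d =>
      obtain ⟨α, i⟩ := m
      obtain ⟨β, j⟩ := n
      simp only [AddMonoidAlgebra.single_mul_single, Prod.mk_add_mk, downOp_single]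
      have h1 : (AddMonoidAlgebra.single (α + β, lower r i + j)
            (c * (((i : J ℓ → ℕ) r : ℕ) : F) * d) : SemigroupAlg Γ) =
          AddMonoidAlgebra.single (α + β, lower r (i + j))
            (c * (((i : J ℓ → ℕ) r : ℕ) : F) * d) := by
        by_cases h : (i : J ℓ → ℕ) r = 0
        · simp [h]
        · rw [lower_add j h]
      have h2 : (AddMonoidAlgebra.single (α + β, i + lower r j)
            (c * (d * (((j : J ℓ → ℕ) r : ℕ) : F))) : SemigroupAlg Γ) =
          AddMonoidAlgebra.single (α + β, lower r (i + j))
            (c * (d * (((j : J ℓ → ℕ) r : ℕ) : F))) := by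
        by_cases h : (j : J ℓ → ℕ) r = 0
        · simp [h]
        · rw [add_comm i j, lower_add i h, add_comm i (lower r j)]
      rw [h1, h2, ← AddMonoidAlgebra.single_add]
      congr 1
      simp
      ring

theorem der_mul (r : J ℓ) (u v : SemigroupAlg Γ) :
    der Γ r (u * v) = der Γ r u * v + u * der Γ r v := by
  simp only [der, LinearMap.add_apply, gradingOp_mul, downOp_mul]
  ring

theorem der_comm (r s : J ℓ) (u : SemigroupAlg Γ) : der Γ r (der Γ s u) = der Γ s (der Γ r u) := by
  induction u using AddMonoidAlgebra.induction_linear with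
  | zero => simp
  | add f g hf hg => simp only [map_add, hf, hg]
  | single m c =>
    obtain ⟨α, i⟩ := m
    by_cases hrs : r = s
    · rw [hrs]
    simp only [der, LinearMap.add_apply, map_add, gradingOp_single, downOp_single]
    rw [lower_comm r s]
    have h1 : ((lower r i : Expo ℓ) : J ℓ → ℕ) s = (i : J ℓ → ℕ) s := by
      simp [lower, Ne.symm hrs]
    have h2 : ((lower s i : Expo ℓ) : J ℓ → ℕ) r = (i : J ℓ → ℕ) r := by
      simp [lower, hrs]
    rw [h1, h2, mul_right_comm c, mul_right_comm c (((i : J ℓ → ℕ) s : ℕ) : F) ((α : J ℓ → F) r),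
      mul_right_comm c (((i : J ℓ → ℕ) s : ℕ) : F) (((i : J ℓ → ℕ) r : ℕ) : F),
      mul_right_comm c ((α : J ℓ → F) s) (((i : J ℓ → ℕ) r : ℕ) : F)]
    abel

theorem der_xSigma (r : J ℓ) (p : Idx ℓ) : der Γ r (xSigma Γ p) = sigma F p r • xSigma Γ p := by
  simp [der, xSigma, gradingOp_single, downOp_single, AddMonoidAlgebra.smul_single]

theorem sigma_inl_of_ne {p q : Idx ℓ} (h : p ≠ q) : sigma F p (Sum.inl q) = 0 := by
  unfold sigma
  split_ifs <;> simp [h.symm]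

theorem sigma_inr_of_ne {p q : Idx ℓ} (h : p ≠ q) : sigma F p (Sum.inr q) = 0 := by
  unfold sigma
  split_ifs <;> simp [h.symm]

/-- The contribution of one index pair to the bracket. -/
def bracketTerm (p : Idx ℓ) (u v : SemigroupAlg Γ) : SemigroupAlg Γ :=
  xSigma Γ p *
    (der Γ (Sum.inl p) u * der Γ (Sum.inr p) v - der Γ (Sum.inr p) u * der Γ (Sum.inl p) v)

theorem bracketTerm_add_left (p : Idx ℓ) (u u' v : SemigroupAlg Γ) :
    bracketTerm Γ p (u + u') v = bracketTerm Γ p u v + bracketTerm Γ p u' v := by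
  simp only [bracketTerm, map_add]
  ring

theorem bracketTerm_add_right (p : Idx ℓ) (u v v' : SemigroupAlg Γ) :
    bracketTerm Γ p u (v + v') = bracketTerm Γ p u v + bracketTerm Γ p u v' := by
  simp only [bracketTerm, map_add]
  ring

theorem bracketTerm_smul_right (p : Idx ℓ) (c : F) (u v : SemigroupAlg Γ) :
    bracketTerm Γ p u (c • v) = c • bracketTerm Γ p u v := by
  simp only [bracketTerm, map_smul, mul_smul_comm, ← smul_sub]

theorem bracketTerm_sum_left {ι : Type*} (p : Idx ℓ) (s : Finset ι) (f : ι → SemigroupAlg Γ)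
    (v : SemigroupAlg Γ) :
    bracketTerm Γ p (∑ a ∈ s, f a) v = ∑ a ∈ s, bracketTerm Γ p (f a) v := by
  simp only [bracketTerm, map_sum, Finset.sum_mul, Finset.mul_sum, ← Finset.sum_sub_distrib]

theorem bracketTerm_sum_right {ι : Type*} (p : Idx ℓ) (s : Finset ι) (f : ι → SemigroupAlg Γ)
    (u : SemigroupAlg Γ) :
    bracketTerm Γ p u (∑ a ∈ s, f a) = ∑ a ∈ s, bracketTerm Γ p u (f a) := by
  simp only [bracketTerm, map_sum, Finset.mul_sum, ← Finset.sum_sub_distrib]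

/-- The Jacobiator of the index pairs `p` (outer) and `q` (inner). -/
def jacTerm (u v w : SemigroupAlg Γ) (p q : Idx ℓ) : SemigroupAlg Γ :=
  bracketTerm Γ p u (bracketTerm Γ q v w) - bracketTerm Γ p (bracketTerm Γ q u v) w -
    bracketTerm Γ p v (bracketTerm Γ q u w)

theorem jacTerm_self (u v w : SemigroupAlg Γ) (p : Idx ℓ) : jacTerm Γ u v w p p = 0 := by
  have hc := fun z => der_comm Γ (Sum.inr p) (Sum.inl p) z
  simp only [jacTerm, bracketTerm, der_mul, map_sub, der_xSigma, hc, Algebra.smul_def]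
  ring

theorem jacTerm_swap (u v w : SemigroupAlg Γ) {p q : Idx ℓ} (h : p ≠ q) :
    jacTerm Γ u v w p q + jacTerm Γ u v w q p = 0 := by
  have h1 := fun z => der_comm Γ (Sum.inl q) (Sum.inl p) z
  have h2 := fun z => der_comm Γ (Sum.inl q) (Sum.inr p) z
  have h3 := fun z => der_comm Γ (Sum.inr q) (Sum.inl p) z
  have h4 := fun z => der_comm Γ (Sum.inr q) (Sum.inr p) z
  simp only [jacTerm, bracketTerm, der_mul, map_sub, der_xSigma, sigma_inl_of_ne h,
    sigma_inr_of_ne h, sigma_inl_of_ne h.symm, sigma_inr_of_ne h.symm, zero_smul, h1, h2, h3, h4]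
  ring

theorem sum_jacTerm (u v w : SemigroupAlg Γ) : ∑ p, ∑ q, jacTerm Γ u v w p q = 0 := by
  rw [← Finset.sum_product']
  refine Finset.sum_involution (fun a _ => (a.2, a.1)) ?_ ?_ ?_ ?_
  · rintro ⟨p, q⟩ -
    by_cases h : p = q
    · subst h
      simp [jacTerm_self]
    · exact jacTerm_swap Γ u v w h
  · rintro ⟨p, q⟩ - hne heq
    simp only [Prod.mk.injEq] at heq
    apply hne
    rw [heq.1]
    exact jacTerm_self Γ u v w p
  · simp
  · simp

theorem bracket_jacobi (u v w : SemigroupAlg Γ) :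
    bracket Γ u (bracket Γ v w) =
      bracket Γ (bracket Γ u v) w + bracket Γ v (bracket Γ u w) := by
  have key := sum_jacTerm Γ u v w
  have hb : ∀ a b, bracket Γ a b = ∑ p, bracketTerm Γ p a b := fun _ _ => rfl
  simp only [hb, bracketTerm_sum_left, bracketTerm_sum_right]
  simp only [jacTerm, Finset.sum_sub_distrib] at key
  rw [sub_sub, sub_eq_zero] at key
  exact key

end Algebra

/-- The Hamiltonian Lie algebra `ℋ(ℓ, Γ)`: the vector space `𝒜 = F[Γ × 𝒥]`, considered only with
its Lie bracket. -/
def HamiltonianLieAlgebra {F : Type*} [Field F] {ℓ : Fin 7 → ℕ} (Γ : AdmissibleSubgroup F ℓ) :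
    Type _ := SemigroupAlg Γ

instance HamiltonianLieAlgebra.instAddCommGroup {F : Type*} [Field F] {ℓ : Fin 7 → ℕ}
    (Γ : AdmissibleSubgroup F ℓ) :
    AddCommGroup (HamiltonianLieAlgebra Γ) :=
  inferInstanceAs (AddCommGroup (SemigroupAlg Γ))

instance HamiltonianLieAlgebra.instModule {F : Type*} [Field F] {ℓ : Fin 7 → ℕ}
    (Γ : AdmissibleSubgroup F ℓ) :
    Module F (HamiltonianLieAlgebra Γ) :=
  inferInstanceAs (Module F (SemigroupAlg Γ))

instance HamiltonianLieAlgebra.instLieRing {F : Type*} [Field F] {ℓ : Fin 7 → ℕ}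
    (Γ : AdmissibleSubgroup F ℓ) :
    LieRing (HamiltonianLieAlgebra Γ) where
  bracket u v := bracket Γ u v
  add_lie u v w := by
    change ∑ p, bracketTerm Γ p (_ + _) _ = ∑ p, bracketTerm Γ p _ _ + ∑ p, bracketTerm Γ p _ _
    rw [← Finset.sum_add_distrib]
    exact Finset.sum_congr rfl fun p _ => bracketTerm_add_left Γ p u v w
  lie_add u v w := by
    change ∑ p, bracketTerm Γ p _ (_ + _) = ∑ p, bracketTerm Γ p _ _ + ∑ p, bracketTerm Γ p _ _
    rw [← Finset.sum_add_distrib]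
    exact Finset.sum_congr rfl fun p _ => bracketTerm_add_right Γ p u v w
  lie_self u := by
    change ∑ p, bracketTerm Γ p _ _ = 0
    refine Finset.sum_eq_zero fun p _ => ?_
    simp only [bracketTerm]
    ring
  leibniz_lie u v w := bracket_jacobi Γ u v w

instance HamiltonianLieAlgebra.instLieAlgebra {F : Type*} [Field F] {ℓ : Fin 7 → ℕ}
    (Γ : AdmissibleSubgroup F ℓ) :
    LieAlgebra F (HamiltonianLieAlgebra Γ) where
  lie_smul c u v := by
    change ∑ p, bracketTerm Γ p _ (c • _) = c • ∑ p, bracketTerm Γ p _ _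
    rw [Finset.smul_sum]
    exact Finset.sum_congr rfl fun p _ => bracketTerm_smul_right Γ p c u v

/-- The matrices `A_p` for `p` in the block with number `k` (that is, `p ∈ I_{k+1}`), `k < 4`.
Their determinant is `b`. -/
def blockMatrix {F : Type*} [Field F] (k : Fin 7) (a b : F) : Matrix (Fin 2) (Fin 2) F :=
  if k = 1 then !![1, 0; a, b]
  else if k = 2 then !![b, 0; 1 - b, 1]
  else !![a + b, a; 1 - a - b, 1 - a]

/-- A group isomorphism `τ : α ↦ α*` from `Γ` to `Γ'` is preserving if it is given by
a permutation `ν` of `I_{1,4}` which maps each of `I_1, I_2, I_3, I_4` to itself, invertible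
`2 × 2` matrices `A_p` of the prescribed shapes, and matrices `B_{i,j}` which act on the
coordinates in `I_5` and `I_6`. -/
def IsPreserving {F : Type*} [Field F] {ℓ : Fin 7 → ℕ} {Γ Γ' : AdmissibleSubgroup F ℓ}
    (τ : Γ.toAddSubgroup ≃+ Γ'.toAddSubgroup) : Prop :=
  (∃ (ν : Equiv.Perm {p : Idx ℓ // p.1 < 4}) (a b : {p : Idx ℓ // p.1 < 4} → F),
    (∀ p, (ν p).1.1 = p.1.1) ∧ (∀ p, b p ≠ 0) ∧
    ∀ (α : Γ.toAddSubgroup) (p : {p : Idx ℓ // p.1 < 4}),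
      ![(τ α).1 (Sum.inl (ν p).1), (τ α).1 (Sum.inr (ν p).1)] =
        Matrix.vecMul ![α.1 (Sum.inl p.1), α.1 (Sum.inr p.1)] (blockMatrix p.1.1 (a p) (b p))) ∧
  (∃ (B15 : Matrix (Fin (ℓ 0)) (Fin (ℓ 4)) F) (B25 : Matrix (Fin (ℓ 1)) (Fin (ℓ 4)) F)
    (B55 : Matrix.GeneralLinearGroup (Fin (ℓ 4)) F),
    ∀ α : Γ.toAddSubgroup,
      (fun q : Fin (ℓ 4) => (τ α).1 (Sum.inl ⟨4, q⟩)) =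
        Matrix.vecMul (fun p => α.1 (Sum.inl ⟨0, p⟩) - α.1 (Sum.inr ⟨0, p⟩)) B15
        - Matrix.vecMul (fun p => α.1 (Sum.inr ⟨1, p⟩)) B25
        + Matrix.vecMul (fun p => α.1 (Sum.inl ⟨4, p⟩)) B55.1) ∧
  (∃ (B16 : Matrix (Fin (ℓ 0)) (Fin (ℓ 5)) F) (B26 : Matrix (Fin (ℓ 1)) (Fin (ℓ 5)) F)
    (B36 : Matrix (Fin (ℓ 2) ⊕ Fin (ℓ 3)) (Fin (ℓ 5)) F)
    (B56 : Matrix (Fin (ℓ 4)) (Fin (ℓ 5)) F)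
    (B66 : Matrix.GeneralLinearGroup (Fin (ℓ 5)) F),
    ∀ α : Γ.toAddSubgroup,
      (fun q : Fin (ℓ 5) => (τ α).1 (Sum.inl ⟨5, q⟩)) =
        Matrix.vecMul (fun p => α.1 (Sum.inl ⟨0, p⟩) - α.1 (Sum.inr ⟨0, p⟩)) B16
        - Matrix.vecMul (fun p => α.1 (Sum.inr ⟨1, p⟩)) B26
        + Matrix.vecMul (Sum.elim
            (fun p => α.1 (Sum.inl ⟨2, p⟩) - α.1 (Sum.inr ⟨2, p⟩))
            (fun p => α.1 (Sum.inl ⟨3, p⟩) - α.1 (Sum.inr ⟨3, p⟩))) B36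
        + Matrix.vecMul (fun p => α.1 (Sum.inl ⟨4, p⟩)) B56
        + Matrix.vecMul (fun p => α.1 (Sum.inl ⟨5, p⟩)) B66.1)

end HamLie

end

noncomputable section

namespace HamLie

/-! ### The generators `x^α` and `t_r` of `𝒜`, its derivations and its bracket. -/

section Basics

variable {F : Type*} [Field F] {ℓ : Fin 7 → ℕ} (Γ : AdmissibleSubgroup F ℓ)

/-! Only if. The centre of the Lie algebra is `F·1`, so a Lie isomorphism `φ` sends `1` to a scalar.
After rescaling, the product of the target pulls back to a second commutative product `m` with unit
`1`, on which every `ad w` acts by derivations. If `[u, v] = 1`, expanding `[u·u, m(u, v)]` in two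
ways gives `m(u, u) = u·u`. If moreover `ad u` is onto, applying adjoint maps to this equation
spreads it to all pairs (`mul_eq_of_surjective`). Such a `u` exists as soon as some block other than
`I_1` is nonempty; then a multiple of `φ` is an algebra isomorphism that scales the bracket
(`exists_isConformal`).

The units of `𝒜` are the `c x^α`, so an algebra isomorphism induces `τ : Γ ≃ Γ'`. Comparing the
brackets of monomials at the coefficient of `x^{τ σ_p}` yields the permutation and the 2×2 matrices
(`exists_isPairMap`). The blocks are told apart by the directions in which the normalised adjoint
map is diagonal on monomials (`IsConformal.map_diagonal`) and by the position of `σ_p`. For `q` in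
`I_5` or `I_6`, the preimage of `t_q̄` has every `x^α` as an eigenvector, which makes the coordinate
`q` of `τ α` a combination of the functionals `lam p` (`IsConformal.exists_lam`); diagonality of
`∂_q` for `q ∈ I_5` removes the coefficients that `B_{·,5}` lacks. Finally `ℓ_7` comes from the
number of variables `t_r` (`card_hasDown_le`).

If both sides consist of `I_1` alone, the two products are only shown to agree on monomials outside
finitely many values of one pair of coordinates (`mul_X_X_eq`). Additivity extends the resulting
generic data to all of `Γ` (`exists_isoData_of_pure`).

If. A character `χ` with `χ(σ_p) = b_p` exists because `Fˣ` is divisible. Send `x^α` to `χ(α) x^{τ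
α}`. A variable `t_r` whose index also has a grading part behaves like a logarithm of monomials and
is transformed linearly by `τ`. For `q` in `I_5` or `I_6` the variable `t_q̄` acts as `-∂_q`, and
its image is chosen to act by the same functional (`lamElt`). The variables of `I_7` are kept. The
bracket need only be checked on generators (`hom_br`), and the map is bijective because its linear
part in the `t_r` is an invertible matrix (`isUnit_row`). -/

instance SemigroupAlg.instSemiring : Semiring (SemigroupAlg Γ) := AddMonoidAlgebra.semiring

instance SemigroupAlg.instCommRing : CommRing (SemigroupAlg Γ) := AddMonoidAlgebra.commRing

instance SemigroupAlg.instAlgebra : Algebra F (SemigroupAlg Γ) := AddMonoidAlgebra.algebra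

/-- The invertible monomial `x^α`. -/
def X (α : Γ.toAddSubgroup) : SemigroupAlg Γ := AddMonoidAlgebra.single (α, 0) 1

/-- The exponent `ε_r`, for `r` with a down-grading part. -/
def unitExpo (r : J ℓ) (h : HasDown r) : Expo ℓ :=
  ⟨Pi.single r 1, fun s hs => by
    rw [Pi.single_eq_of_ne]
    rintro rfl
    exact hs h⟩

open Classical in
/-- The variable `t_r`; it is zero if `r` has no down-grading part. -/
def T (r : J ℓ) : SemigroupAlg Γ :=
  if h : HasDown r then AddMonoidAlgebra.single (0, unitExpo r h) 1 else 0

/-- `σ_p` as an element of `Γ`. -/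
def sg (p : Idx ℓ) : Γ.toAddSubgroup := ⟨sigma F p, sigma_mem Γ p⟩

theorem X_zero : X Γ 0 = 1 := rfl

theorem X_add (α β : Γ.toAddSubgroup) : X Γ (α + β) = X Γ α * X Γ β := by
  simp [X, AddMonoidAlgebra.single_mul_single]

theorem X_mul_X_neg (α : Γ.toAddSubgroup) : X Γ α * X Γ (-α) = 1 := by
  rw [← X_add, add_neg_cancel, X_zero]

theorem X_neg_mul_X (α : Γ.toAddSubgroup) : X Γ (-α) * X Γ α = 1 := by
  rw [← X_add, neg_add_cancel, X_zero]

theorem X_mul_cancel {α : Γ.toAddSubgroup} {u v : SemigroupAlg Γ} (h : X Γ α * u = X Γ α * v) :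
    u = v := by
  have := congrArg (X Γ (-α) * ·) h
  simpa [← mul_assoc, X_neg_mul_X] using this

theorem isUnit_X (α : Γ.toAddSubgroup) : IsUnit (X Γ α) :=
  IsUnit.of_mul_eq_one _ (X_mul_X_neg Γ α)

theorem T_of_hasDown {r : J ℓ} (h : HasDown r) :
    T Γ r = AddMonoidAlgebra.single (0, unitExpo r h) 1 := by
  simp [T, h]

theorem T_of_not_hasDown {r : J ℓ} (h : ¬ HasDown r) : T Γ r = 0 := by
  simp [T, h]

theorem der_single (r : J ℓ) (α : Γ.toAddSubgroup) (i : Expo ℓ) (c : F) :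
    der Γ r (AddMonoidAlgebra.single (α, i) c) =
      AddMonoidAlgebra.single (α, i) (c * (α : J ℓ → F) r) +
      AddMonoidAlgebra.single (α, lower r i) (c * (((i : J ℓ → ℕ) r : ℕ) : F)) := by
  simp [der, gradingOp_single, downOp_single]

theorem der_X (r : J ℓ) (α : Γ.toAddSubgroup) : der Γ r (X Γ α) = α.1 r • X Γ α := by
  simp [X, der_single, AddMonoidAlgebra.smul_single]

theorem der_one (r : J ℓ) : der Γ r 1 = 0 := by
  rw [← X_zero, der_X]; simp

theorem lower_unitExpo {r : J ℓ} (h : HasDown r) : lower r (unitExpo r h) = 0 := by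
  ext s
  simp [lower, unitExpo]

theorem der_T_self {r : J ℓ} (h : HasDown r) : der Γ r (T Γ r) = 1 := by
  rw [T_of_hasDown Γ h, der_single, lower_unitExpo]
  simp [unitExpo, AddMonoidAlgebra.one_def, Prod.zero_eq_mk]

theorem der_T_of_ne {r s : J ℓ} (h : s ≠ r) : der Γ s (T Γ r) = 0 := by
  by_cases hr : HasDown r
  · rw [T_of_hasDown Γ hr, der_single]
    simp [unitExpo, h]
  · rw [T_of_not_hasDown Γ hr, map_zero]

theorem T_pow (r : J ℓ) (i : Expo ℓ) :
    ∃ k : Expo ℓ, T Γ r ^ (i.1 r) = AddMonoidAlgebra.single (0, k) 1 ∧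
      k.1 = Pi.single r (i.1 r) := by
  by_cases hr : HasDown r
  · rw [T_of_hasDown Γ hr, AddMonoidAlgebra.single_pow]
    refine ⟨i.1 r • unitExpo r hr, by simp, ?_⟩
    ext s
    by_cases hs : s = r
    · subst hs; simp [unitExpo]
    · simp [unitExpo, hs]
  · rw [i.2 r hr]
    exact ⟨0, by simp [AddMonoidAlgebra.one_def, Prod.zero_eq_mk], by ext; simp⟩

theorem prod_T_pow (i : Expo ℓ) :
    ∏ r, T Γ r ^ (i.1 r) = AddMonoidAlgebra.single (0, i) 1 := by
  choose k hk hk' using fun r => T_pow Γ r i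
  rw [Finset.prod_congr rfl fun r _ => hk r, AddMonoidAlgebra.prod_single]
  have h1 : ∑ r, ((0 : Γ.toAddSubgroup), k r) = (0, i) := by
    refine Prod.ext (by simp [Prod.fst_sum]) ?_
    ext s
    simp only [Prod.snd_sum, AddSubmonoid.coe_finsetSum, Finset.sum_apply, hk']
    simp [Pi.single_apply]
  rw [h1]; simp

theorem single_eq (α : Γ.toAddSubgroup) (i : Expo ℓ) (c : F) :
    (AddMonoidAlgebra.single (α, i) c : SemigroupAlg Γ) = c • (X Γ α * ∏ r, T Γ r ^ (i.1 r)) := by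
  rw [prod_T_pow, X, AddMonoidAlgebra.single_mul_single]
  simp [AddMonoidAlgebra.smul_single]

theorem adjoin_eq_top :
    Algebra.adjoin F (Set.range (X Γ) ∪ T Γ '' {r : J ℓ | HasDown r}) = ⊤ := by
  rw [eq_top_iff]
  intro u _
  induction u using AddMonoidAlgebra.induction_linear with
  | zero => exact zero_mem _
  | add f g hf hg => exact add_mem (hf trivial) (hg trivial)
  | single m c =>
    rw [← Prod.mk.eta (p := m), single_eq]
    have hX : X Γ m.1 ∈ Algebra.adjoin F (Set.range (X Γ) ∪ T Γ '' {r : J ℓ | HasDown r}) :=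
      Algebra.subset_adjoin (Set.mem_union_left _ ⟨_, rfl⟩)
    refine Subalgebra.smul_mem _ (mul_mem hX (prod_mem fun r _ => ?_)) _
    by_cases hr : HasDown r
    · have hT : T Γ r ∈ Algebra.adjoin F (Set.range (X Γ) ∪ T Γ '' {r : J ℓ | HasDown r}) :=
        Algebra.subset_adjoin (Set.mem_union_right _ (Set.mem_image_of_mem _ hr))
      exact pow_mem hT _
    · rw [m.2.2 r hr, pow_zero]; exact one_mem _

theorem algHom_ext {B : Type*} [Semiring B] [Algebra F B] {f g : SemigroupAlg Γ →ₐ[F] B}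
    (hX : ∀ α, f (X Γ α) = g (X Γ α)) (hT : ∀ r, HasDown r → f (T Γ r) = g (T Γ r)) : f = g := by
  refine AlgHom.ext_of_adjoin_eq_top (adjoin_eq_top Γ) ?_
  rintro _ (⟨α, rfl⟩ | ⟨r, hr, rfl⟩)
  · exact hX α
  · exact hT r hr

/-- The algebra homomorphism with prescribed values on the `x^α` and the `t_r`. -/
def liftHom {B : Type*} [CommRing B] [Algebra F B] (g : Multiplicative Γ.toAddSubgroup →* B)
    (t : J ℓ → B) : SemigroupAlg Γ →ₐ[F] B :=
  AddMonoidAlgebra.lift F B (Γ.toAddSubgroup × Expo ℓ)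
    -- If `r` has no down-grading part, `t r` occurs only with exponent `0`, so its value is
    -- irrelevant.
    { toFun := fun m => g (Multiplicative.ofAdd m.toAdd.1) * ∏ r, t r ^ (m.toAdd.2.1 r)
      map_one' := by
        simp
      map_mul' := by
        intro m n
        have : g (Multiplicative.ofAdd (m.toAdd.1 + n.toAdd.1)) =
          g (Multiplicative.ofAdd m.toAdd.1) * g (Multiplicative.ofAdd n.toAdd.1) := map_mul g _ _
        simp only [toAdd_mul, Prod.fst_add, Prod.snd_add, AddSubmonoid.coe_add, Pi.add_apply,
          pow_add, Finset.prod_mul_distrib, this]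
        ring }

theorem liftHom_X {B : Type*} [CommRing B] [Algebra F B] (g : Multiplicative Γ.toAddSubgroup →* B)
    (t : J ℓ → B) (α : Γ.toAddSubgroup) :
    liftHom Γ g t (X Γ α) = g (Multiplicative.ofAdd α) := by
  simp [liftHom, X, AddMonoidAlgebra.lift_single]

theorem liftHom_T {B : Type*} [CommRing B] [Algebra F B] (g : Multiplicative Γ.toAddSubgroup →* B)
    (t : J ℓ → B) {r : J ℓ} (hr : HasDown r) : liftHom Γ g t (T Γ r) = t r := by
  have : g (Multiplicative.ofAdd 0) = 1 := map_one g
  rw [T_of_hasDown Γ hr]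
  simp only [liftHom, AddMonoidAlgebra.lift_single, MonoidHom.coe_mk, OneHom.coe_mk, toAdd_ofAdd,
    this, one_smul, one_mul]
  rw [Finset.prod_eq_single r]
  · simp [unitExpo]
  · intro s _ hs; simp [unitExpo, hs]
  · simp

/-- The bracket as a bilinear map. -/
def br : SemigroupAlg Γ →ₗ[F] SemigroupAlg Γ →ₗ[F] SemigroupAlg Γ :=
  LinearMap.mk₂ F (bracket Γ)
    (fun u u' v => by
      simp only [bracket, map_add, ← Finset.sum_add_distrib]
      exact Finset.sum_congr rfl fun p _ => by ring)
    (fun c u v => by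
      simp only [bracket, map_smul, Finset.smul_sum, smul_mul_assoc, ← smul_sub, mul_smul_comm])
    (fun u v v' => by
      simp only [bracket, map_add, ← Finset.sum_add_distrib]
      exact Finset.sum_congr rfl fun p _ => by ring)
    (fun c u v => by
      simp only [bracket, map_smul, Finset.smul_sum, ← smul_sub, mul_smul_comm])

theorem br_apply (u v : SemigroupAlg Γ) : br Γ u v = ∑ p : Idx ℓ, X Γ (sg Γ p) *
    (der Γ (Sum.inl p) u * der Γ (Sum.inr p) v - der Γ (Sum.inr p) u * der Γ (Sum.inl p) v) :=
  rfl

theorem br_skew (u v : SemigroupAlg Γ) : br Γ u v = - br Γ v u := by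
  rw [br_apply, br_apply, ← Finset.sum_neg_distrib]
  exact Finset.sum_congr rfl fun p _ => by ring

theorem br_self (u : SemigroupAlg Γ) : br Γ u u = 0 := by
  rw [br_apply]
  exact Finset.sum_eq_zero fun p _ => by ring

theorem br_mul_right (u v w : SemigroupAlg Γ) :
    br Γ u (v * w) = br Γ u v * w + v * br Γ u w := by
  simp only [br_apply, der_mul, Finset.sum_mul, Finset.mul_sum, ← Finset.sum_add_distrib]
  exact Finset.sum_congr rfl fun p _ => by ring

theorem br_mul_left (u v w : SemigroupAlg Γ) :
    br Γ (u * v) w = br Γ u w * v + u * br Γ v w := by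
  rw [br_skew, br_mul_right, br_skew Γ w u, br_skew Γ w v]; ring

theorem br_one_right (u : SemigroupAlg Γ) : br Γ u 1 = 0 := by
  simp [br_apply, der_one]

theorem br_X (α : Γ.toAddSubgroup) (v : SemigroupAlg Γ) :
    br Γ (X Γ α) v = ∑ p : Idx ℓ, X Γ (α + sg Γ p) *
      (α.1 (Sum.inl p) • der Γ (Sum.inr p) v - α.1 (Sum.inr p) • der Γ (Sum.inl p) v) := by
  rw [br_apply]
  refine Finset.sum_congr rfl fun p _ => ?_
  simp only [der_X, X_add, Algebra.smul_def]
  ring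

/-- The alternating form of the `p`-th pair of coordinates. -/
def dt (p : Idx ℓ) (α β : J ℓ → F) : F :=
  α (Sum.inl p) * β (Sum.inr p) - α (Sum.inr p) * β (Sum.inl p)

theorem br_X_X (α β : Γ.toAddSubgroup) :
    br Γ (X Γ α) (X Γ β) = ∑ p : Idx ℓ, dt p α.1 β.1 • X Γ (α + β + sg Γ p) := by
  rw [br_X]
  refine Finset.sum_congr rfl fun p _ => ?_
  simp only [der_X, X_add, Algebra.smul_def, dt, map_sub, map_mul]
  ring

theorem br_T_inl {p : Idx ℓ} (h : HasDown (Sum.inl p)) (v : SemigroupAlg Γ) :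
    br Γ (T Γ (Sum.inl p)) v = X Γ (sg Γ p) * der Γ (Sum.inr p) v := by
  rw [br_apply, Finset.sum_eq_single p]
  · rw [der_T_self Γ h, der_T_of_ne Γ (by simp)]; ring
  · intro q _ hq
    rw [der_T_of_ne Γ (by simpa using hq), der_T_of_ne Γ (by simp)]; ring
  · simp

theorem br_T_inr {p : Idx ℓ} (h : HasDown (Sum.inr p)) (v : SemigroupAlg Γ) :
    br Γ (T Γ (Sum.inr p)) v = - (X Γ (sg Γ p) * der Γ (Sum.inl p) v) := by
  rw [br_apply, Finset.sum_eq_single p]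
  · rw [der_T_self Γ h, der_T_of_ne Γ (by simp)]; ring
  · intro q _ hq
    rw [der_T_of_ne Γ (r := Sum.inr p) (s := Sum.inr q) (by simpa using hq),
      der_T_of_ne Γ (r := Sum.inr p) (s := Sum.inl q) (by simp)]; ring
  · simp

theorem coeff_der_of_not_hasDown {r : J ℓ} (h : ¬ HasDown r) (u : SemigroupAlg Γ)
    (m : Γ.toAddSubgroup × Expo ℓ) :
    (der Γ r u).coeff m = m.1.1 r * u.coeff m := by
  classical
  induction u using AddMonoidAlgebra.induction_linear with
  | zero => simp
  | add f g hf hg => simp [hf, hg, mul_add]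
  | single n c =>
    rw [← Prod.mk.eta (p := n), der_single, n.2.2 r h]
    simp only [Nat.cast_zero, mul_zero, AddMonoidAlgebra.single_zero, add_zero,
      AddMonoidAlgebra.coeff_single, Finsupp.single_apply]
    split_ifs with h1
    · subst h1; ring
    · ring

theorem coeff_der_of_hasDown {r : J ℓ} (h : HasDown r) (u : SemigroupAlg Γ)
    (α : Γ.toAddSubgroup) (i : Expo ℓ) :
    (der Γ r u).coeff (α, i) =
      α.1 r * u.coeff (α, i) + ((i.1 r : F) + 1) * u.coeff (α, i + unitExpo r h) := by
  classical
  induction u using AddMonoidAlgebra.induction_linear with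
  | zero => simp
  | add f g hf hg => simp only [map_add, AddMonoidAlgebra.coeff_add, Finsupp.add_apply, hf, hg]; ring
  | single n c =>
    obtain ⟨β, j⟩ := n
    rw [der_single]
    simp only [AddMonoidAlgebra.coeff_add, Finsupp.add_apply, AddMonoidAlgebra.coeff_single,
      Finsupp.single_apply, Prod.mk.injEq]
    congr 1
    · split_ifs with h1
      · rw [h1.1]; ring
      · ring
    · by_cases hj : j.1 r = 0
      · have : j ≠ i + unitExpo r h := by
          rintro rfl
          simp [unitExpo] at hj
        simp [hj, this]
      · have : lower r j = i ↔ j = i + unitExpo r h := by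
          constructor
          · rintro rfl
            ext s
            by_cases hs : s = r
            · subst hs; simp [lower, unitExpo]; omega
            · simp [lower, unitExpo, hs]
          · rintro rfl
            ext s
            simp [lower, unitExpo]
        simp only [this]
        split_ifs with h1
        · rw [h1.2]; simp [unitExpo]; ring
        · ring

variable [CharZero F]

/-- The coefficients satisfy `α_r u_i + (i_r + 1) u_{i+ε_r} = 0`. If `α_r = 0` this kills every
`u_i` with `i_r ≠ 0`; if `α_r ≠ 0`, one nonzero coefficient would force infinitely many. -/
theorem coeff_eq_zero_of_der_eq_zero {r : J ℓ} {u : SemigroupAlg Γ} (hu : der Γ r u = 0)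
    {α : Γ.toAddSubgroup} {i : Expo ℓ} (h : α.1 r ≠ 0 ∨ i.1 r ≠ 0) : u.coeff (α, i) = 0 := by
  by_cases hr : HasDown r
  · by_cases hα : α.1 r = 0
    · have hi := h.resolve_left (by simpa using hα)
      have key : i = lower r i + unitExpo r hr := by
        ext s
        by_cases hs : s = r
        · subst hs; simp [lower, unitExpo]; omega
        · simp [lower, unitExpo, hs]
      have := coeff_der_of_hasDown Γ hr u α (lower r i)
      rw [hu, hα, ← key] at this
      have h2 : (((lower r i).1 r : ℕ) : F) + 1 ≠ 0 := Nat.cast_add_one_ne_zero _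
      simpa [h2, eq_comm] using this
    · by_contra hne
      have : ∀ k : ℕ, u.coeff (α, i + k • unitExpo r hr) ≠ 0 := by
        intro k
        induction k with
        | zero => simpa using hne
        | succ k ih =>
          intro h0
          have := coeff_der_of_hasDown Γ hr u α (i + k • unitExpo r hr)
          rw [hu, add_assoc, ← succ_nsmul, h0] at this
          simp [hα] at this
          exact ih this
      have hinj : Function.Injective fun k : ℕ => ((α, i + k • unitExpo r hr) :
          Γ.toAddSubgroup × Expo ℓ) := by
        intro k l hkl
        have := congrArg (fun m : Γ.toAddSubgroup × Expo ℓ => m.2.1 r) hkl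
        simpa [unitExpo] using this
      refine Set.infinite_range_of_injective hinj (u.coeff.support.finite_toSet.subset ?_)
      rintro _ ⟨k, rfl⟩
      exact Finsupp.mem_support_iff.2 (this k)
  · have hi : i.1 r = 0 := i.2 r hr
    have := coeff_der_of_not_hasDown Γ hr u (α, i)
    rw [hu] at this
    have hα : α.1 r ≠ 0 := h.resolve_right (by simpa using hi)
    simpa [hα, eq_comm] using this

theorem eq_smul_one_of_der_eq_zero {u : SemigroupAlg Γ} (hu : ∀ r, der Γ r u = 0) :
    ∃ c : F, u = c • 1 := by
  classical
  refine ⟨u.coeff 0, ?_⟩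
  ext ⟨α, i⟩
  rw [AddMonoidAlgebra.one_def]
  by_cases h : α = 0 ∧ i = 0
  · rw [h.1, h.2]; simp [Prod.zero_eq_mk]
  · have : ∃ r, α.1 r ≠ 0 ∨ i.1 r ≠ 0 := by
      by_contra! hcon
      exact h ⟨Subtype.ext (funext fun r => (hcon r).1), Subtype.ext (funext fun r => (hcon r).2)⟩
    obtain ⟨r, hr⟩ := this
    rw [coeff_eq_zero_of_der_eq_zero Γ (hu r) hr]
    have : (0 : Γ.toAddSubgroup × Expo ℓ) ≠ (α, i) := fun h0 => h (by
      rw [Prod.ext_iff] at h0; exact ⟨h0.1.symm, h0.2.symm⟩)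
    simp [AddMonoidAlgebra.smul_single, this]

/-- On monomials with `α_r = 0` one integrates in `t_r`. If `α_r ≠ 0`, the derivation is `α_r` plus
an operator lowering `i_r`, and is inverted by induction on `i_r`. -/
theorem der_surjective {r : J ℓ} (hr : HasDown r) : Function.Surjective (der Γ r) := by
  rw [← LinearMap.range_eq_top, eq_top_iff]
  intro u _
  induction u using AddMonoidAlgebra.induction_linear with
  | zero => exact zero_mem _
  | add f g hf hg => exact add_mem (hf trivial) (hg trivial)
  | single m c =>
    obtain ⟨α, i⟩ := m
    by_cases hα : α.1 r = 0
    · have h2 : (i.1 r : F) + 1 ≠ 0 := Nat.cast_add_one_ne_zero _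
      refine ⟨AddMonoidAlgebra.single (α, i + unitExpo r hr) (c / (i.1 r + 1)), ?_⟩
      rw [der_single, hα]
      have : lower r (i + unitExpo r hr) = i := by ext s; simp [lower, unitExpo]
      rw [this]
      simp [unitExpo]
      field_simp
    · generalize hn : i.1 r = n
      clear * - hα hn
      induction n generalizing i c with
      | zero =>
        refine ⟨AddMonoidAlgebra.single (α, i) (c / α.1 r), ?_⟩
        rw [der_single, hn]
        simp
        field_simp
      | succ n ih =>
        have h1 := ih (c / α.1 r * i.1 r) (lower r i) (by simp [lower, hn])
        have h2 : der Γ r (AddMonoidAlgebra.single (α, i) (c / α.1 r)) ∈ LinearMap.range (der Γ r) :=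
          ⟨_, rfl⟩
        have := sub_mem h2 h1
        rw [der_single, add_sub_assoc, sub_self, add_zero, div_mul_cancel₀ _ hα] at this
        exact this

end Basics

/-! ### Rigidity of the product under a Poisson bracket. -/

/-- A commutative product for which the adjoint maps of a Poisson bracket are derivations and whose
unit is `1` agrees with the given product on squares of elements `u` with `[u, b] = 1`. -/
theorem sq_eq_of_bracket_eq_one {F A : Type*} [Field F] [CharZero F] [CommRing A] [Algebra F A]
    {b m : A →ₗ[F] A →ₗ[F] A} (hm1 : ∀ u, m u 1 = u)
    (hbm : ∀ w u v, b w (m u v) = m (b w u) v + m u (b w v))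
    (hself : ∀ u, b u u = 0)
    (hmul : ∀ u v w, b (u * v) w = b u w * v + u * b v w) {u v : A} (huv : b u v = 1) :
    m u u = u * u := by
  -- The bracket `[u·u, m(u, v)]` is computed twice: here by Leibniz for `m` in the right slot, in
  -- `h2` by Leibniz for the given product in the left slot.
  have h1 : b (u * u) (m u v) = m u u + m u u := by
    rw [hbm, hmul, hmul, hself, huv]
    simp
  have h2 : b (u * u) (m u v) = u * u + u * u := by
    rw [hmul, hbm, hself, huv]
    simp [hm1]
  have h3 : (2 : F) • m u u = (2 : F) • (u * u) := by
    rw [two_smul, two_smul, ← h1, h2]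
  exact smul_right_injective A (two_ne_zero (α := F)) h3

/-- Polarisation: differentiate `m(u, u) = u·u` along `ad w` and divide by two. -/
theorem mul_eq_of_bracket {F A : Type*} [Field F] [CharZero F] [CommRing A] [Algebra F A]
    {b m : A →ₗ[F] A →ₗ[F] A} (hm : ∀ u v, m u v = m v u)
    (hbm : ∀ w u v, b w (m u v) = m (b w u) v + m u (b w v))
    (hmul : ∀ w u v, b w (u * v) = b w u * v + u * b w v) {u : A} (hu : m u u = u * u) (w : A) :
    m (b w u) u = b w u * u := by
  have h := congrArg (b w) hu
  rw [hbm, hmul, hm u, mul_comm u, ← two_smul F, ← two_smul F (b w u * u)] at h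
  exact smul_right_injective A (two_ne_zero (α := F)) h

/-- Every element has the form `[w, u]`. Polarising `m(u, u) = u·u` thus gives `m(z, u) = z·u` for
all `z`, and differentiating this along `ad w` replaces `u` by the arbitrary element `[w, u]`. -/
theorem mul_eq_of_surjective {F A : Type*} [Field F] [CharZero F] [CommRing A] [Algebra F A]
    {b m : A →ₗ[F] A →ₗ[F] A} (hm : ∀ u v, m u v = m v u) (hm1 : ∀ u, m u 1 = u)
    (hbm : ∀ w u v, b w (m u v) = m (b w u) v + m u (b w v))
    (hskew : ∀ u v, b u v = - b v u) (hself : ∀ u, b u u = 0)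
    (hmul : ∀ u v w, b (u * v) w = b u w * v + u * b v w)
    (hmul' : ∀ w u v, b w (u * v) = b w u * v + u * b w v) {u : A}
    (hu : Function.Surjective (b u)) (x y : A) : m x y = x * y := by
  obtain ⟨v, hv⟩ := hu 1
  have hsq := sq_eq_of_bracket_eq_one hm1 hbm hself hmul hv
  have hu' : ∀ z, ∃ w, b w u = z := fun z => by
    obtain ⟨w, hw⟩ := hu (-z)
    exact ⟨w, by rw [hskew, hw, neg_neg]⟩
  have h1 : ∀ z, m z u = z * u := fun z => by
    obtain ⟨w, rfl⟩ := hu' z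
    exact mul_eq_of_bracket hm hbm hmul' hsq w
  obtain ⟨w, rfl⟩ := hu' y
  have := congrArg (b w) (h1 x)
  rw [hbm, hmul', h1] at this
  exact add_left_cancel this

/-! ### The centre, surjective adjoint maps, and unique sums in `Γ × 𝒥`. -/

section Structure

variable {F : Type*} [Field F] {ℓ : Fin 7 → ℕ} (Γ : AdmissibleSubgroup F ℓ)

theorem exists_single_mem {r : J ℓ} (hr : HasGrading r) :
    ∃ a : F, a ≠ 0 ∧ (Pi.single r a : J ℓ → F) ∈ Γ.toAddSubgroup := by
  rcases r with p | p
  · by_cases hp : p.1 < 4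
    · exact Γ.exists_single_inl_mem p hp
    · exact ⟨1, one_ne_zero, Γ.single_mem p (not_lt.1 hp) hr⟩
  · exact Γ.exists_single_inr_mem p hr

theorem hasGrading_inl {p : Idx ℓ} (hp : p.1 < 4) : HasGrading (Sum.inl p : J ℓ) :=
  lt_trans hp (by decide)

theorem hasGrading_inr {p : Idx ℓ} (hp : p.1 < 4) : HasGrading (Sum.inr p : J ℓ) := hp

/-- The scalar of a chosen nonzero multiple of `ε_r` in `Γ`. -/
def cf (r : J ℓ) (hr : HasGrading r) : F := (exists_single_mem Γ hr).choose

theorem cf_ne_zero (r : J ℓ) (hr : HasGrading r) : cf Γ r hr ≠ 0 :=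
  (exists_single_mem Γ hr).choose_spec.1

/-- A chosen nonzero multiple of `ε_r` in `Γ`. -/
def el (r : J ℓ) (hr : HasGrading r) : Γ.toAddSubgroup :=
  ⟨Pi.single r (cf Γ r hr), (exists_single_mem Γ hr).choose_spec.2⟩

theorem el_apply_self (r : J ℓ) (hr : HasGrading r) : (el Γ r hr).1 r = cf Γ r hr := by
  simp [el]

theorem el_apply_of_ne {r : J ℓ} (hr : HasGrading r) {s : J ℓ} (hs : s ≠ r) :
    (el Γ r hr).1 s = 0 := by
  simp [el, hs]

theorem apply_eq_zero (α : Γ.toAddSubgroup) {r : J ℓ} (hr : ¬ HasGrading r) : α.1 r = 0 :=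
  Γ.apply_eq_zero _ α.2 r hr

theorem hasDown_of_not_hasGrading {r : J ℓ} (hr : ¬ HasGrading r) : HasDown r := by
  rcases r with ⟨k, i⟩ | ⟨k, i⟩ <;> simp only [HasGrading, HasDown] at * <;> revert hr <;>
    clear i <;> revert k <;> decide

theorem sigma_inl_self {p : Idx ℓ} (hp : p.1 < 4) : sigma F p (Sum.inl p) = 1 := by
  unfold sigma
  split_ifs <;> simp

theorem sigma_inr_self {p : Idx ℓ} (hp : p.1 < 4) (h1 : p.1 ≠ 1) : sigma F p (Sum.inr p) = 1 := by
  simp [sigma, hp, h1]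

theorem sigma_inr_self' {p : Idx ℓ} (h1 : p.1 = 1) : sigma F p (Sum.inr p) = 0 := by
  simp [sigma, h1]

theorem sg_eq_zero {p : Idx ℓ} (hp : ¬ p.1 < 4) : sg Γ p = 0 := by
  have h1 : p.1 ≠ 1 := by
    rintro h; rw [h] at hp; exact hp (by decide)
  ext1
  simp [sg, sigma, hp, h1]

theorem sg_injective {p q : Idx ℓ} (hp : p.1 < 4) (h : sg Γ p = sg Γ q) : p = q := by
  by_contra hne
  have := congrArg (fun x => x.1 (Sum.inl p)) h
  simp only [sg] at this
  rw [sigma_inl_self hp, sigma_inl_of_ne (Ne.symm hne)] at this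
  exact one_ne_zero this

/-- The bracket with a monomial of `Γ` is a sum over the pairs in `I_{1,6}`. -/
theorem br_el_inr {p : Idx ℓ} (hp : HasGrading (Sum.inr p : J ℓ)) (v : SemigroupAlg Γ) :
    br Γ (X Γ (el Γ (Sum.inr p) hp)) v =
      X Γ (el Γ (Sum.inr p) hp + sg Γ p) * (-(cf Γ (Sum.inr p) hp) • der Γ (Sum.inl p) v) := by
  rw [br_X, Finset.sum_eq_single p]
  · rw [el_apply_self, el_apply_of_ne _ _ (by simp)]
    simp
  · intro q _ hq
    rw [el_apply_of_ne _ _ (by simp), el_apply_of_ne Γ (r := Sum.inr p) hp (s := Sum.inr q)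
      (by simpa using hq)]
    simp
  · simp

theorem br_el_inl {p : Idx ℓ} (hp : HasGrading (Sum.inl p : J ℓ)) (v : SemigroupAlg Γ) :
    br Γ (X Γ (el Γ (Sum.inl p) hp)) v =
      X Γ (el Γ (Sum.inl p) hp + sg Γ p) * (cf Γ (Sum.inl p) hp • der Γ (Sum.inr p) v) := by
  rw [br_X, Finset.sum_eq_single p]
  · rw [el_apply_self, el_apply_of_ne _ _ (by simp)]
    simp
  · intro q _ hq
    rw [el_apply_of_ne _ _ (by simpa using hq), el_apply_of_ne Γ (r := Sum.inl p) hp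
      (s := Sum.inr q) (by simp)]
    simp
  · simp

/-- Each `∂_r u` is, up to a unit, the bracket of `u` with one element attached to the partner
index: a monomial `x^α` with `α` a multiple of a basis vector, or a variable. -/
theorem der_eq_zero_of_central {u : SemigroupAlg Γ} (hu : ∀ v, br Γ v u = 0) (r : J ℓ) :
    der Γ r u = 0 := by
  rcases r with p | p
  · by_cases hp : HasGrading (Sum.inr p : J ℓ)
    · have := hu (X Γ (el Γ (Sum.inr p) hp))
      rw [br_el_inr, ← mul_zero (X Γ (el Γ (Sum.inr p) hp + sg Γ p))] at this
      simpa [cf_ne_zero] using X_mul_cancel Γ this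
    · have := hu (T Γ (Sum.inr p))
      rw [br_T_inr Γ (hasDown_of_not_hasGrading hp), neg_eq_zero, ← mul_zero (X Γ (sg Γ p))] at this
      exact X_mul_cancel Γ this
  · by_cases hp : HasGrading (Sum.inl p : J ℓ)
    · have := hu (X Γ (el Γ (Sum.inl p) hp))
      rw [br_el_inl, ← mul_zero (X Γ (el Γ (Sum.inl p) hp + sg Γ p))] at this
      simpa [cf_ne_zero] using X_mul_cancel Γ this
    · have := hu (T Γ (Sum.inl p))
      rw [br_T_inl Γ (hasDown_of_not_hasGrading hp), ← mul_zero (X Γ (sg Γ p))] at this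
      exact X_mul_cancel Γ this

theorem eq_smul_one_of_central [CharZero F] {u : SemigroupAlg Γ} (hu : ∀ v, br Γ v u = 0) :
    ∃ c : F, u = c • 1 :=
  eq_smul_one_of_der_eq_zero Γ (der_eq_zero_of_central Γ hu)

theorem X_mul_surjective (α : Γ.toAddSubgroup) : Function.Surjective (X Γ α * ·) :=
  fun v => ⟨X Γ (-α) * v, by simp [← mul_assoc, X_mul_X_neg]⟩

/-- Outside `I_1` at least one index of the pair has a down-grading part, so its derivation is onto.
The bracket with the element attached to the partner index is that derivation times a unit. -/
theorem exists_br_surjective [CharZero F] {p : Idx ℓ} (hp : p.1 ≠ 0) :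
    ∃ u, Function.Surjective (br Γ u) := by
  by_cases h4 : HasGrading (Sum.inr p : J ℓ)
  · refine ⟨X Γ (el Γ (Sum.inr p) h4), fun v => ?_⟩
    obtain ⟨w, hw⟩ := X_mul_surjective Γ (el Γ (Sum.inr p) h4 + sg Γ p) v
    have hd : HasDown (Sum.inl p : J ℓ) := ⟨hp, fun h => by
      have h5 : p.1 < 4 := h4
      rw [h] at h5; revert h5; decide⟩
    obtain ⟨x, hx⟩ := der_surjective Γ hd (-(cf Γ (Sum.inr p) h4)⁻¹ • w)
    refine ⟨x, ?_⟩
    rw [br_el_inr, hx, smul_smul, ← hw, neg_mul_neg, mul_inv_cancel₀ (cf_ne_zero Γ _ _), one_smul]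
  · have hd : HasDown (Sum.inr p : J ℓ) := hasDown_of_not_hasGrading (r := Sum.inr p) h4
    by_cases hg : HasGrading (Sum.inl p : J ℓ)
    · refine ⟨X Γ (el Γ (Sum.inl p) hg), fun v => ?_⟩
      obtain ⟨w, hw⟩ := X_mul_surjective Γ (el Γ (Sum.inl p) hg + sg Γ p) v
      obtain ⟨x, hx⟩ := der_surjective Γ hd ((cf Γ (Sum.inl p) hg)⁻¹ • w)
      refine ⟨x, ?_⟩
      rw [br_el_inl, hx, smul_smul, ← hw, mul_inv_cancel₀ (cf_ne_zero Γ _ _), one_smul]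
    · refine ⟨T Γ (Sum.inl p), fun v => ?_⟩
      obtain ⟨w, hw⟩ := X_mul_surjective Γ (sg Γ p) v
      obtain ⟨x, hx⟩ := der_surjective Γ hd w
      exact ⟨x, by rw [br_T_inl Γ (hasDown_of_not_hasGrading hg), hx, ← hw]⟩

/-- In characteristic zero `F^J` is a rational vector space, so `Γ × 𝒥` embeds into a product of
monoids with this property. -/
instance instTwoUniqueSums [CharZero F] : TwoUniqueSums (Γ.toAddSubgroup × Expo ℓ) := by
  let : Module ℚ (J ℓ → F) := Module.compHom _ (algebraMap ℚ F)
  refine TwoUniqueSums.of_injective_addHom (G := (J ℓ → F) × (J ℓ → ℕ))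
    ⟨fun m : Γ.toAddSubgroup × Expo ℓ => (m.1.1, m.2.1), fun _ _ => rfl⟩ ?_ inferInstance
  intro m n h
  obtain ⟨h1, h2⟩ := Prod.ext_iff.1 h
  exact Prod.ext (Subtype.ext h1) (Subtype.ext h2)

theorem smul_X_inj {α β : Γ.toAddSubgroup} {c d : F} (hc : c ≠ 0)
    (h : c • X Γ α = d • X Γ β) : α = β ∧ c = d := by
  simp only [X, AddMonoidAlgebra.smul_single, smul_eq_mul, mul_one] at h
  rcases AddMonoidAlgebra.single_inj.1 h with h | h
  · exact ⟨congrArg Prod.fst h.1, h.2⟩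
  · exact absurd h.1 hc

end Structure

/-- With more than one term in `u`, two different pairs of exponents would have a uniquely
represented sum. Neither coefficient can cancel, so both sums are the exponent `0` of `1`, against
uniqueness. -/
theorem exists_single_of_mul_eq_one {F M : Type*} [Field F] [AddCommMonoid M] [TwoUniqueSums M]
    {u v : AddMonoidAlgebra F M} (h : u * v = 1) :
    ∃ m c, c ≠ 0 ∧ u = AddMonoidAlgebra.single m c := by
  classical
  have hu : u ≠ 0 := by rintro rfl; simp at h
  have hv : v ≠ 0 := by rintro rfl; simp at h
  have hu' : u.coeff.support.Nonempty := Finsupp.support_nonempty_iff.2 (by simpa using hu)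
  have hv' : v.coeff.support.Nonempty := Finsupp.support_nonempty_iff.2 (by simpa using hv)
  by_cases hc : u.coeff.support.card = 1
  · obtain ⟨m, c, hc0, hmc⟩ := Finsupp.card_support_eq_one'.1 hc
    exact ⟨m, c, hc0, AddMonoidAlgebra.coeff_injective (by simpa using hmc)⟩
  · exfalso
    have h1 : 1 < u.coeff.support.card * v.coeff.support.card := by
      have := hu'.card_pos
      have := hv'.card_pos
      nlinarith [show 2 ≤ u.coeff.support.card by omega]
    obtain ⟨p, hp, q, hq, hpq, hpu, hqu⟩ := TwoUniqueSums.uniqueAdd_of_one_lt_card h1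
    rw [Finset.mem_product] at hp hq
    have key : ∀ a : M × M, a.1 ∈ u.coeff.support → a.2 ∈ v.coeff.support →
        UniqueAdd u.coeff.support v.coeff.support a.1 a.2 → a.1 + a.2 = 0 := by
      intro a ha1 ha2 hau
      by_contra hne
      have := AddMonoidAlgebra.coeff_mul_add_of_uniqueAdd hau
      rw [h, AddMonoidAlgebra.one_def, AddMonoidAlgebra.coeff_single,
        Finsupp.single_eq_of_ne hne] at this
      exact mul_ne_zero (Finsupp.mem_support_iff.1 ha1) (Finsupp.mem_support_iff.1 ha2) this.symm
    have h2 := key p hp.1 hp.2 hpu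
    have h3 := key q hq.1 hq.2 hqu
    have := hpu hq.1 hq.2 (h3.trans h2.symm)
    exact hpq (Prod.ext this.1.symm this.2.symm)

/-! ### Units of `𝒜` and homomorphisms into them. -/

section Units

variable {F : Type*} [Field F] [CharZero F] {ℓ : Fin 7 → ℕ} (Γ : AdmissibleSubgroup F ℓ)

/-- A unit and its inverse are monomials whose exponents in `𝒥` add up to zero, hence vanish. -/
theorem exists_eq_smul_X_of_isUnit {u : SemigroupAlg Γ} (hu : IsUnit u) :
    ∃ (α : Γ.toAddSubgroup) (c : F), c ≠ 0 ∧ u = c • X Γ α := by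
  obtain ⟨v, hv⟩ := hu.exists_right_inv
  obtain ⟨⟨α, i⟩, c, hc, hu'⟩ := exists_single_of_mul_eq_one hv
  obtain ⟨⟨β, j⟩, d, hd, hv'⟩ := exists_single_of_mul_eq_one ((mul_comm v u).trans hv)
  refine ⟨α, c, hc, ?_⟩
  rw [hu', hv', AddMonoidAlgebra.single_mul_single, AddMonoidAlgebra.one_def,
    AddMonoidAlgebra.single_inj] at hv
  have hij : i + j = 0 := by
    rcases hv with hv | hv
    · exact congrArg Prod.snd hv.1
    · exact absurd hv.2 one_ne_zero
  have hi : i = 0 := by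
    ext s
    have := congrArg (fun k : Expo ℓ => k.1 s) hij
    simp at this
    simpa using this.1
  rw [hu', hi, X, AddMonoidAlgebra.smul_single, smul_eq_mul, mul_one]

/-- A homomorphism from a group to the units of `𝒜` is given by a homomorphism to `Γ` and a
character. -/
theorem exists_of_monoidHom {G : Type*} [AddCommGroup G] (g : Multiplicative G →* SemigroupAlg Γ) :
    ∃ (τ : G →+ Γ.toAddSubgroup) (χ : G → F), (∀ δ, χ δ ≠ 0) ∧
      (∀ δ γ, χ (δ + γ) = χ δ * χ γ) ∧
      ∀ δ, g (Multiplicative.ofAdd δ) = χ δ • X Γ (τ δ) := by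
  have hu : ∀ δ, IsUnit (g (Multiplicative.ofAdd δ)) := fun δ =>
    (Group.isUnit (Multiplicative.ofAdd δ)).map g
  choose τ χ hχ h using fun δ => exists_eq_smul_X_of_isUnit Γ (hu δ)
  have hadd : ∀ δ γ, τ (δ + γ) = τ δ + τ γ ∧ χ (δ + γ) = χ δ * χ γ := by
    intro δ γ
    refine smul_X_inj Γ (hχ _) ?_
    rw [← h, ofAdd_add, map_mul, h, h, X_add, smul_mul_smul_comm]
  exact ⟨AddMonoidHom.mk' τ fun δ γ => (hadd δ γ).1, χ, hχ, fun δ γ => (hadd δ γ).2, h⟩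

end Units

/-! ### The permutation of `I_{1,4}` and the 2×2 matrices. -/

section PairMaps

variable {F : Type*} [Field F] {ℓ ℓ' : Fin 7 → ℕ} {Γ : AdmissibleSubgroup F ℓ}
  {Γ' : AdmissibleSubgroup F ℓ'}

theorem dt_eq_zero (α β : Γ.toAddSubgroup) {p : Idx ℓ} (hp : ¬ p.1 < 4) :
    dt p α.1 β.1 = 0 := by
  have h : ¬ HasGrading (Sum.inr p : J ℓ) := hp
  simp [dt, apply_eq_zero Γ _ h]

theorem coeff_X (α β : Γ.toAddSubgroup) [Decidable (α = β)] :
    (X Γ α).coeff (β, 0) = if α = β then 1 else 0 := by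
  classical
  simp [X, Finsupp.single_apply]

/-- `τ` maps `σ_p` to `σ_q` and is given on the `p`-th pair of coordinates by an invertible matrix
with values in the `q`-th pair of coordinates. -/
structure IsPairMap (τ : Γ.toAddSubgroup → Γ'.toAddSubgroup) (p : Idx ℓ) (q : Idx ℓ') : Prop where
  map_sg : τ (sg Γ p) = sg Γ' q
  lt_left : p.1 < 4
  lt_right : q.1 < 4
  exists_matrix : ∃ w x y z : F, w * z - x * y ≠ 0 ∧ ∀ δ : Γ.toAddSubgroup,
    (τ δ).1 (Sum.inl q) = δ.1 (Sum.inl p) * w + δ.1 (Sum.inr p) * y ∧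
    (τ δ).1 (Sum.inr q) = δ.1 (Sum.inl p) * x + δ.1 (Sum.inr p) * z

/-- At `x^{τ σ_p}` the left side of `hE` has coefficient `dt p` times a nonzero scalar, because the
`σ`s are distinct and `τ` is injective. Some `σ_q` must therefore equal `τ σ_p`, and `dt q ∘ τ` is
proportional to `dt p`. A nondegenerate alternating form on a plane then forces `τ` to act linearly
on the pair. -/
theorem exists_isPairMap {τ : Γ.toAddSubgroup →+ Γ'.toAddSubgroup} (hτ : Function.Injective τ)
    {χ : Γ.toAddSubgroup → F} (hχ : ∀ δ, χ δ ≠ 0) {k : F}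
    (hE : ∀ δ γ : Γ.toAddSubgroup, ∑ p, (dt p δ.1 γ.1 * χ (sg Γ p)) • X Γ' (τ (sg Γ p)) =
      k • ∑ q, dt q (τ δ).1 (τ γ).1 • X Γ' (sg Γ' q)) {p : Idx ℓ} (hp : p.1 < 4) :
    ∃ q, IsPairMap τ p q := by
  classical
  have hL : ∀ δ γ : Γ.toAddSubgroup, (∑ r, (dt r δ.1 γ.1 * χ (sg Γ r)) •
      X Γ' (τ (sg Γ r))).coeff (τ (sg Γ p), 0) = dt p δ.1 γ.1 * χ (sg Γ p) := by
    intro δ γ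
    rw [AddMonoidAlgebra.coeff_sum, Finsupp.finsetSum_apply, Finset.sum_eq_single p]
    · rw [AddMonoidAlgebra.coeff_smul_apply, coeff_X]; simp
    · intro r _ hr
      by_cases hr4 : r.1 < 4
      · rw [AddMonoidAlgebra.coeff_smul_apply, coeff_X, if_neg, smul_zero]
        exact fun h => hr (sg_injective Γ hr4 (hτ h))
      · rw [dt_eq_zero _ _ hr4]; simp
    · simp
  have ha := cf_ne_zero Γ _ (hasGrading_inl hp)
  have hb := cf_ne_zero Γ _ (hasGrading_inr hp)
  set e := el Γ _ (hasGrading_inl hp) with he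
  set f := el Γ _ (hasGrading_inr hp) with hf
  set a := cf Γ _ (hasGrading_inl hp)
  set b := cf Γ _ (hasGrading_inr hp)
  have he1 : e.1 (Sum.inl p) = a := el_apply_self _ _ _
  have he2 : e.1 (Sum.inr p) = 0 := el_apply_of_ne _ _ (by simp)
  have hf1 : f.1 (Sum.inl p) = 0 := el_apply_of_ne _ _ (by simp)
  have hf2 : f.1 (Sum.inr p) = b := el_apply_self _ _ _
  have hex : ∃ q, q.1 < 4 ∧ sg Γ' q = τ (sg Γ p) := by
    by_contra! hcon
    have h1 := hL e f
    rw [hE, AddMonoidAlgebra.coeff_smul_apply, AddMonoidAlgebra.coeff_sum,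
      Finsupp.finsetSum_apply, Finset.sum_eq_zero, smul_zero] at h1
    · rw [dt, he1, he2, hf2] at h1
      simp [ha, hb, hχ] at h1
    · intro q _
      by_cases hq4 : q.1 < 4
      · rw [AddMonoidAlgebra.coeff_smul_apply, coeff_X, if_neg (hcon q hq4), smul_zero]
      · rw [dt_eq_zero _ _ hq4]; simp
  obtain ⟨q, hq4, hq⟩ := hex
  have key : ∀ δ γ : Γ.toAddSubgroup,
      dt p δ.1 γ.1 * χ (sg Γ p) = k * dt q (τ δ).1 (τ γ).1 := by
    intro δ γ
    rw [← hL, hE, AddMonoidAlgebra.coeff_smul_apply, AddMonoidAlgebra.coeff_sum,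
      Finsupp.finsetSum_apply, Finset.sum_eq_single q]
    · rw [AddMonoidAlgebra.coeff_smul_apply, coeff_X, if_pos hq]; simp
    · intro r _ hr
      by_cases hr4 : r.1 < 4
      · rw [AddMonoidAlgebra.coeff_smul_apply, coeff_X, if_neg, smul_zero]
        exact fun h => hr (sg_injective Γ' hr4 (h.trans hq.symm))
      · rw [dt_eq_zero _ _ hr4]; simp
    · simp
  -- The rows of the matrix are the images of the multiples `e`, `f` of the two basis vectors,
  -- divided by their scalars.
  refine ⟨q, hq.symm, hp, hq4, (τ e).1 (Sum.inl q) / a, (τ e).1 (Sum.inr q) / a,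
    (τ f).1 (Sum.inl q) / b, (τ f).1 (Sum.inr q) / b, ?_, fun δ => ?_⟩
  · have h1 := key e f
    rw [dt, he1, he2, hf2, dt] at h1
    intro h0
    field_simp at h0
    rw [h0] at h1
    simp [ha, hb, hχ] at h1
  · have h1 := key e f
    have h2 := key δ f
    have h3 := key e δ
    simp only [dt, he1, he2, hf1, hf2] at h1 h2 h3
    have hc := hχ (sg Γ p)
    set c := χ (sg Γ p)
    set e1 := (τ e).1 (Sum.inl q)
    set e2 := (τ e).1 (Sum.inr q)
    set f1 := (τ f).1 (Sum.inl q)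
    set f2 := (τ f).1 (Sum.inr q)
    set d1 := (τ δ).1 (Sum.inl q)
    set d2 := (τ δ).1 (Sum.inr q)
    set x := δ.1 (Sum.inl p)
    set y := δ.1 (Sum.inr p)
    constructor
    · field_simp
      apply mul_left_cancel₀ hc
      linear_combination d1 * h1 - e1 * h2 - f1 * h3
    · field_simp
      apply mul_left_cancel₀ hc
      linear_combination d2 * h1 - e2 * h2 - f2 * h3

/-- Pair maps of an isomorphism and of its inverse form a bijection of the index sets. -/
theorem exists_equiv_isPairMap {τ : Γ.toAddSubgroup ≃+ Γ'.toAddSubgroup}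
    (h : ∀ p : Idx ℓ, p.1 < 4 → ∃ q, IsPairMap τ p q)
    (h' : ∀ q : Idx ℓ', q.1 < 4 → ∃ p, IsPairMap τ.symm q p) :
    ∃ ν : {p : Idx ℓ // p.1 < 4} ≃ {q : Idx ℓ' // q.1 < 4},
      (∀ p, IsPairMap τ p.1 (ν p).1) ∧ ∀ p, IsPairMap τ.symm (ν p).1 p.1 := by
  choose f hf using fun p : {p : Idx ℓ // p.1 < 4} => h p.1 p.2
  choose g hg using fun q : {q : Idx ℓ' // q.1 < 4} => h' q.1 q.2
  have hgf : ∀ p, g ⟨f p, (hf p).lt_right⟩ = p := fun p => by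
    refine sg_injective Γ (hg _).lt_right ?_
    rw [← (hg _).map_sg, AddEquiv.symm_apply_eq, (hf p).map_sg]
  have hfg : ∀ q, f ⟨g q, (hg q).lt_right⟩ = q := fun q => by
    refine sg_injective Γ' (hf _).lt_right ?_
    rw [← (hf _).map_sg, ← AddEquiv.eq_symm_apply, (hg q).map_sg]
  refine ⟨⟨fun p => ⟨f p, (hf p).lt_right⟩, fun q => ⟨g q, (hg q).lt_right⟩,
    fun p => Subtype.ext (hgf p), fun q => Subtype.ext (hfg q)⟩, hf, fun p => ?_⟩
  have := hg ⟨f p, (hf p).lt_right⟩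
  rwa [hgf] at this

end PairMaps

/-! ### From a Lie isomorphism to an algebra isomorphism that scales the bracket. -/

section Conformal

variable {F : Type*} [Field F] {ℓ ℓ' : Fin 7 → ℕ} {Γ : AdmissibleSubgroup F ℓ}
  {Γ' : AdmissibleSubgroup F ℓ'}

/-- The pullback of the product along a linear equivalence, scaled by `κ`. -/
def transportMul (φ : SemigroupAlg Γ ≃ₗ[F] SemigroupAlg Γ') (κ : F) :
    SemigroupAlg Γ →ₗ[F] SemigroupAlg Γ →ₗ[F] SemigroupAlg Γ :=
  LinearMap.mk₂ F (fun u v => κ • φ.symm (φ u * φ v))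
    (fun u u' v => by simp [add_mul])
    (fun c u v => by simp [smul_comm κ c])
    (fun u v v' => by simp [mul_add])
    (fun c u v => by simp [smul_comm κ c])

theorem transportMul_apply (φ : SemigroupAlg Γ ≃ₗ[F] SemigroupAlg Γ') (κ : F)
    (u v : SemigroupAlg Γ) : transportMul φ κ u v = κ • φ.symm (φ u * φ v) := rfl

theorem transportMul_comm (φ : SemigroupAlg Γ ≃ₗ[F] SemigroupAlg Γ') (κ : F)
    (u v : SemigroupAlg Γ) : transportMul φ κ u v = transportMul φ κ v u := by
  rw [transportMul_apply, transportMul_apply, mul_comm]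

theorem transportMul_one {φ : SemigroupAlg Γ ≃ₗ[F] SemigroupAlg Γ'} {κ : F}
    (hκ : κ • φ 1 = 1) (u : SemigroupAlg Γ) : transportMul φ κ u 1 = u := by
  rw [transportMul_apply, ← map_smul, ← mul_smul_comm, hκ, mul_one, LinearEquiv.symm_apply_apply]

theorem symm_br {φ : SemigroupAlg Γ ≃ₗ[F] SemigroupAlg Γ'}
    (hφ : ∀ u v, φ (br Γ u v) = br Γ' (φ u) (φ v)) (u v : SemigroupAlg Γ') :
    φ.symm (br Γ' u v) = br Γ (φ.symm u) (φ.symm v) := by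
  rw [LinearEquiv.symm_apply_eq, hφ, LinearEquiv.apply_symm_apply, LinearEquiv.apply_symm_apply]

theorem br_transportMul {φ : SemigroupAlg Γ ≃ₗ[F] SemigroupAlg Γ'}
    (hφ : ∀ u v, φ (br Γ u v) = br Γ' (φ u) (φ v)) (κ : F) (w u v : SemigroupAlg Γ) :
    br Γ w (transportMul φ κ u v) =
      transportMul φ κ (br Γ w u) v + transportMul φ κ u (br Γ w v) := by
  simp only [transportMul_apply, map_smul, hφ]
  rw [← smul_add, ← map_add, ← br_mul_right, symm_br hφ, LinearEquiv.symm_apply_apply]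

/-- The element `φ 1` is central, and central elements are scalars. -/
theorem exists_smul_map_one [CharZero F] {φ : SemigroupAlg Γ ≃ₗ[F] SemigroupAlg Γ'}
    (hφ : ∀ u v, φ (br Γ u v) = br Γ' (φ u) (φ v)) : ∃ κ : F, κ ≠ 0 ∧ κ • φ 1 = 1 := by
  obtain ⟨c, hc⟩ := eq_smul_one_of_central Γ' (u := φ 1) fun v => by
    obtain ⟨w, rfl⟩ := φ.surjective v
    rw [← hφ, br_one_right, map_zero]
  have hc0 : c ≠ 0 := by
    rintro rfl
    rw [zero_smul] at hc
    exact one_ne_zero (φ.map_eq_zero_iff.1 hc)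
  exact ⟨c⁻¹, inv_ne_zero hc0, by rw [hc, smul_smul, inv_mul_cancel₀ hc0, one_smul]⟩

/-- An isomorphism of algebras that multiplies the bracket by the scalar `k`. -/
structure IsConformal (ψ : SemigroupAlg Γ ≃ₐ[F] SemigroupAlg Γ') (k : F) : Prop where
  ne_zero : k ≠ 0
  map_br : ∀ u v, ψ (br Γ u v) = k • br Γ' (ψ u) (ψ v)

theorem IsConformal.symm {ψ : SemigroupAlg Γ ≃ₐ[F] SemigroupAlg Γ'} {k : F}
    (h : IsConformal ψ k) : IsConformal ψ.symm k⁻¹ where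
  ne_zero := inv_ne_zero h.ne_zero
  map_br u v := by
    rw [AlgEquiv.symm_apply_eq, map_smul, h.map_br, smul_smul, inv_mul_cancel₀ h.ne_zero, one_smul,
      AlgEquiv.apply_symm_apply, AlgEquiv.apply_symm_apply]

/-- A surjective adjoint map forces the transported product to be the original one, which says that
`κ • φ` is multiplicative. The bracket is bilinear, so rescaling `φ` by `κ` scales it by `κ⁻¹`. -/
theorem exists_isConformal [CharZero F] {φ : SemigroupAlg Γ ≃ₗ[F] SemigroupAlg Γ'}
    (hφ : ∀ u v, φ (br Γ u v) = br Γ' (φ u) (φ v)) {p : Idx ℓ} (hp : p.1 ≠ 0) :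
    ∃ (ψ : SemigroupAlg Γ ≃ₐ[F] SemigroupAlg Γ') (k : F), IsConformal ψ k := by
  obtain ⟨κ, hκ0, hκ⟩ := exists_smul_map_one hφ
  obtain ⟨u, hu⟩ := exists_br_surjective Γ hp
  have hm := mul_eq_of_surjective (transportMul_comm φ κ) (transportMul_one hκ)
    (br_transportMul hφ κ) (br_skew Γ) (br_self Γ) (br_mul_left Γ) (br_mul_right Γ) hu
  refine ⟨AlgEquiv.ofLinearEquiv (φ.trans (LinearEquiv.smulOfNeZero F _ κ hκ0)) hκ ?_, κ⁻¹,
    inv_ne_zero hκ0, fun u v => ?_⟩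
  · intro x y
    change κ • φ (x * y) = (κ • φ x) * (κ • φ y)
    rw [← hm, transportMul_apply, map_smul, LinearEquiv.apply_symm_apply, smul_mul_smul_comm,
      smul_smul]
  · change κ • φ _ = κ⁻¹ • br Γ' (κ • φ u) (κ • φ v)
    rw [hφ, map_smul, map_smul, LinearMap.smul_apply, smul_smul, smul_smul, inv_mul_cancel₀ hκ0,
      one_mul]

/-- The comparison of brackets of monomials. -/
theorem sum_dt_eq {k : F} {τ : Γ.toAddSubgroup →+ Γ'.toAddSubgroup}
    {χ : Γ.toAddSubgroup → F} (hχ : ∀ δ, χ δ ≠ 0) (hχm : ∀ δ γ, χ (δ + γ) = χ δ * χ γ)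
    {δ γ : Γ.toAddSubgroup} (h : ∑ p, dt p δ.1 γ.1 • χ (δ + γ + sg Γ p) •
      X Γ' (τ (δ + γ + sg Γ p)) = k • br Γ' (χ δ • X Γ' (τ δ)) (χ γ • X Γ' (τ γ))) :
    ∑ p, (dt p δ.1 γ.1 * χ (sg Γ p)) • X Γ' (τ (sg Γ p)) =
      k • ∑ q, dt q (τ δ).1 (τ γ).1 • X Γ' (sg Γ' q) := by
  rw [map_smul, map_smul, LinearMap.smul_apply, br_X_X] at h
  apply X_mul_cancel Γ' (α := τ (δ + γ))
  apply smul_right_injective _ (mul_ne_zero (hχ δ) (hχ γ))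
  simp only [map_add, X_add, Finset.mul_sum, Finset.smul_sum, mul_smul_comm, smul_smul, hχm] at h ⊢
  convert h using 2 with p _ p _
  · congr 1; ring
  · congr 1; ring

/-- A diagonal combination of the derivations of one pair vanishes where its square does. -/
theorem eq_zero_of_pair_sq_eq_zero {p : Idx ℓ} {a b : F} (h1 : HasDown (Sum.inl p : J ℓ) → b = 0)
    (h2 : HasDown (Sum.inr p : J ℓ) → a = 0) {f g : SemigroupAlg Γ}
    (hg : g = a • der Γ (Sum.inr p) f - b • der Γ (Sum.inl p) f)
    (h0 : a • der Γ (Sum.inr p) g - b • der Γ (Sum.inl p) g = 0) : g = 0 := by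
  -- The hypotheses discard every down-grading contribution, so the operator is diagonal on
  -- monomials; a diagonal operator and its square have the same kernel.
  have key : ∀ (f : SemigroupAlg Γ) m, (a • der Γ (Sum.inr p) f - b • der Γ (Sum.inl p) f).coeff m =
      (a * m.1.1 (Sum.inr p) - b * m.1.1 (Sum.inl p)) * f.coeff m := by
    intro f m
    have e1 : b * (der Γ (Sum.inl p) f).coeff m = b * (m.1.1 (Sum.inl p) * f.coeff m) := by
      by_cases h : HasDown (Sum.inl p : J ℓ)
      · rw [h1 h]; ring
      · rw [coeff_der_of_not_hasDown Γ h]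
    have e2 : a * (der Γ (Sum.inr p) f).coeff m = a * (m.1.1 (Sum.inr p) * f.coeff m) := by
      by_cases h : HasDown (Sum.inr p : J ℓ)
      · rw [h2 h]; ring
      · rw [coeff_der_of_not_hasDown Γ h]
    rw [AddMonoidAlgebra.coeff_sub, Finsupp.sub_apply, AddMonoidAlgebra.coeff_smul_apply,
      AddMonoidAlgebra.coeff_smul_apply, smul_eq_mul, smul_eq_mul, e1, e2]
    ring
  ext m
  have hm := congrArg (fun x => x.coeff m) h0
  simp only [key] at hm
  rw [hg, key] at hm ⊢
  rcases mul_eq_zero.1 hm with h | h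
  · simp [h]
  · simpa using h

theorem br_X_of_pair {α : Γ.toAddSubgroup} {p : Idx ℓ}
    (hα : ∀ q, q ≠ p → α.1 (Sum.inl q) = 0 ∧ α.1 (Sum.inr q) = 0) (f : SemigroupAlg Γ) :
    X Γ (-(α + sg Γ p)) * br Γ (X Γ α) f =
      α.1 (Sum.inl p) • der Γ (Sum.inr p) f - α.1 (Sum.inr p) • der Γ (Sum.inl p) f := by
  rw [br_X, Finset.sum_eq_single p, ← mul_assoc, X_neg_mul_X, one_mul]
  · intro q _ hq
    rw [(hα q hq).1, (hα q hq).2]; simp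
  · simp

theorem IsConformal.exists_isPairMap {ψ : SemigroupAlg Γ ≃ₐ[F] SemigroupAlg Γ'} {k : F}
    (h : IsConformal ψ k) {τ : Γ.toAddSubgroup ≃+ Γ'.toAddSubgroup} {χ : Γ.toAddSubgroup → F}
    (hχ : ∀ δ, χ δ ≠ 0) (hχm : ∀ δ γ, χ (δ + γ) = χ δ * χ γ)
    (hg : ∀ δ, ψ (X Γ δ) = χ δ • X Γ' (τ δ)) {p : Idx ℓ} (hp : p.1 < 4) :
    ∃ q, IsPairMap τ p q := by
  refine HamLie.exists_isPairMap (τ := τ.toAddMonoidHom) (χ := χ) (k := k) τ.injective hχ ?_ hp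
  intro δ γ
  refine sum_dt_eq hχ hχm ?_
  have := h.map_br (X Γ δ) (X Γ γ)
  rw [br_X_X, map_sum, hg, hg] at this
  simp only [map_smul, hg] at this ⊢
  exact this

/-- The directions of a pair without down-grading part are preserved. -/
theorem IsConformal.map_diagonal {ψ : SemigroupAlg Γ ≃ₐ[F] SemigroupAlg Γ'} {k : F}
    (h : IsConformal ψ k) {τ : Γ.toAddSubgroup ≃+ Γ'.toAddSubgroup} {χ : Γ.toAddSubgroup → F}
    (hχ : ∀ δ, χ δ ≠ 0) (hg : ∀ δ, ψ (X Γ δ) = χ δ • X Γ' (τ δ)) {p : Idx ℓ} {q : Idx ℓ'}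
    (hpq : IsPairMap τ p q) {α : Γ.toAddSubgroup}
    (hα : ∀ q, q ≠ p → α.1 (Sum.inl q) = 0 ∧ α.1 (Sum.inr q) = 0)
    (h1 : HasDown (Sum.inl p : J ℓ) → α.1 (Sum.inr p) = 0)
    (h2 : HasDown (Sum.inr p : J ℓ) → α.1 (Sum.inl p) = 0) :
    (HasDown (Sum.inl q : J ℓ') → (τ α).1 (Sum.inr q) = 0) ∧
      (HasDown (Sum.inr q : J ℓ') → (τ α).1 (Sum.inl q) = 0) := by
  -- Pulled back along `ψ`, the hypothesis says that the normalised operator `D = x^{-(α+σ_p)} ad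
  -- x^α` sends `ψ⁻¹ t` to a scalar. Since `D 1 = 0`, the square of `D` kills `ψ⁻¹ t`; as `D` is
  -- diagonal, so does `D`, and `c = 0`.
  have main : ∀ (t : SemigroupAlg Γ') (c : F), br Γ' (X Γ' (τ α)) t = c • X Γ' (τ α + sg Γ' q) →
      c = 0 := by
    intro t c ht
    set D := fun f => X Γ (-(α + sg Γ p)) * br Γ (X Γ α) f with hD
    have hDf : D (ψ.symm t) = (χ (-(α + sg Γ p)) * (k * (χ α * c))) • 1 := by
      apply ψ.injective
      simp only [hD]
      rw [map_mul, h.map_br, hg, hg, AlgEquiv.apply_symm_apply, map_smul, LinearMap.smul_apply, ht,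
        map_smul, map_one, map_neg, map_add, hpq.map_sg, smul_smul, smul_smul, smul_mul_smul_comm,
        X_neg_mul_X]
      ring_nf
    have h0 : D (ψ.symm t) = 0 := by
      refine eq_zero_of_pair_sq_eq_zero h1 h2 (br_X_of_pair hα (ψ.symm t)) ?_
      rw [← br_X_of_pair hα]
      rw [hDf, map_smul, br_one_right, smul_zero, mul_zero]
    rw [hDf] at h0
    have := (smul_eq_zero.1 h0).resolve_right one_ne_zero
    simpa [hχ, h.ne_zero] using this
  constructor
  · intro hq
    refine neg_eq_zero.1 (main (T Γ' (Sum.inl q)) _ ?_)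
    rw [br_skew, br_T_inl Γ' hq, der_X, mul_smul_comm, ← X_add, add_comm, neg_smul]
  · intro hq
    refine main (T Γ' (Sum.inr q)) _ ?_
    rw [br_skew, br_T_inr Γ' hq, der_X, mul_smul_comm, ← X_add, add_comm, neg_neg]

variable [CharZero F]

/-- An algebra isomorphism maps units to units, and these are the scalar multiples of the `x^α`. The
maps of exponents for `ψ` and `ψ⁻¹` are mutually inverse. -/
theorem exists_addEquiv_of_algEquiv (ψ : SemigroupAlg Γ ≃ₐ[F] SemigroupAlg Γ') :
    ∃ (τ : Γ.toAddSubgroup ≃+ Γ'.toAddSubgroup),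
      (∃ χ : Γ.toAddSubgroup → F, (∀ δ, χ δ ≠ 0) ∧ (∀ δ γ, χ (δ + γ) = χ δ * χ γ) ∧
      (∀ δ, ψ (X Γ δ) = χ δ • X Γ' (τ δ))) ∧
      ∃ χ' : Γ'.toAddSubgroup → F, (∀ δ, χ' δ ≠ 0) ∧ (∀ δ γ, χ' (δ + γ) = χ' δ * χ' γ) ∧
      (∀ δ, ψ.symm (X Γ' δ) = χ' δ • X Γ (τ.symm δ)) := by
  let g : Multiplicative Γ.toAddSubgroup →* SemigroupAlg Γ' :=
    { toFun := fun δ => ψ (X Γ δ.toAdd)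
      map_one' := by simp [X_zero]
      map_mul' := fun a b => by simp [X_add] }
  let g' : Multiplicative Γ'.toAddSubgroup →* SemigroupAlg Γ :=
    { toFun := fun δ => ψ.symm (X Γ' δ.toAdd)
      map_one' := by simp [X_zero]
      map_mul' := fun a b => by simp [X_add] }
  obtain ⟨τ, χ, hχ, hχm, hg⟩ := exists_of_monoidHom Γ' g
  obtain ⟨τ', χ', hχ', hχm', hg'⟩ := exists_of_monoidHom Γ g'
  replace hg : ∀ δ, ψ (X Γ δ) = χ δ • X Γ' (τ δ) := hg
  replace hg' : ∀ δ, ψ.symm (X Γ' δ) = χ' δ • X Γ (τ' δ) := hg'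
  have h1 : ∀ δ, τ' (τ δ) = δ := fun δ => by
    have := congrArg ψ.symm (hg δ)
    rw [AlgEquiv.symm_apply_apply, map_smul, hg', smul_smul, ← one_smul F (X Γ δ)] at this
    exact (smul_X_inj Γ one_ne_zero this).1.symm
  have h2 : ∀ δ, τ (τ' δ) = δ := fun δ => by
    have := congrArg ψ (hg' δ)
    rw [AlgEquiv.apply_symm_apply, map_smul, hg, smul_smul, ← one_smul F (X Γ' δ)] at this
    exact (smul_X_inj Γ' one_ne_zero this).1.symm
  exact ⟨{ τ with invFun := τ', left_inv := h1, right_inv := h2 }, ⟨χ, hχ, hχm, hg⟩,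
    ⟨χ', hχ', hχm', hg'⟩⟩

end Conformal

/-! ### The blocks `I_1, …, I_4` are preserved, and the shapes of the matrices. -/

section Blocks

variable {F : Type*} [Field F] {ℓ ℓ' : Fin 7 → ℕ} {Γ : AdmissibleSubgroup F ℓ}
  {Γ' : AdmissibleSubgroup F ℓ'}

theorem hasDown_inl_iff {p : Idx ℓ} : HasDown (Sum.inl p : J ℓ) ↔ p.1 ≠ 0 ∧ p.1 ≠ 4 := Iff.rfl

theorem hasDown_inr_iff {p : Idx ℓ} : HasDown (Sum.inr p : J ℓ) ↔ 3 ≤ p.1 := Iff.rfl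

/-- The directions of the `p`-th pair without down-grading part go to such directions of the
`q`-th pair. -/
def PreservesDiagonal (τ : Γ.toAddSubgroup → Γ'.toAddSubgroup) (p : Idx ℓ) (q : Idx ℓ') : Prop :=
  ∀ α : Γ.toAddSubgroup, (∀ q, q ≠ p → α.1 (Sum.inl q) = 0 ∧ α.1 (Sum.inr q) = 0) →
    (HasDown (Sum.inl p : J ℓ) → α.1 (Sum.inr p) = 0) →
    (HasDown (Sum.inr p : J ℓ) → α.1 (Sum.inl p) = 0) →
    (HasDown (Sum.inl q : J ℓ') → (τ α).1 (Sum.inr q) = 0) ∧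
      (HasDown (Sum.inr q : J ℓ') → (τ α).1 (Sum.inl q) = 0)

theorem PreservesDiagonal.of_inl {τ : Γ.toAddSubgroup → Γ'.toAddSubgroup} {p : Idx ℓ} {q : Idx ℓ'}
    (h : PreservesDiagonal τ p q) (hp : p.1 < 4) {w x y z : F}
    (hM : ∀ δ : Γ.toAddSubgroup,
      (τ δ).1 (Sum.inl q) = δ.1 (Sum.inl p) * w + δ.1 (Sum.inr p) * y ∧
      (τ δ).1 (Sum.inr q) = δ.1 (Sum.inl p) * x + δ.1 (Sum.inr p) * z)
    (hd : ¬ HasDown (Sum.inr p : J ℓ)) :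
    (HasDown (Sum.inl q : J ℓ') → x = 0) ∧ (HasDown (Sum.inr q : J ℓ') → w = 0) := by
  have hc := cf_ne_zero Γ _ (hasGrading_inl hp)
  have h1 := el_apply_self Γ _ (hasGrading_inl hp)
  have h2 := el_apply_of_ne Γ (hasGrading_inl hp) (s := Sum.inr p) (by simp)
  have := h (el Γ _ (hasGrading_inl hp))
    (fun r hr => ⟨el_apply_of_ne _ _ (by simpa using hr), el_apply_of_ne _ _ (by simp)⟩)
    (fun _ => h2) (fun h => absurd h hd)
  rw [(hM _).1, (hM _).2, h1, h2] at this
  simpa [hc] using this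

theorem PreservesDiagonal.of_inr {τ : Γ.toAddSubgroup → Γ'.toAddSubgroup} {p : Idx ℓ} {q : Idx ℓ'}
    (h : PreservesDiagonal τ p q) (hp : p.1 < 4) {w x y z : F}
    (hM : ∀ δ : Γ.toAddSubgroup,
      (τ δ).1 (Sum.inl q) = δ.1 (Sum.inl p) * w + δ.1 (Sum.inr p) * y ∧
      (τ δ).1 (Sum.inr q) = δ.1 (Sum.inl p) * x + δ.1 (Sum.inr p) * z)
    (hd : ¬ HasDown (Sum.inl p : J ℓ)) :
    (HasDown (Sum.inl q : J ℓ') → z = 0) ∧ (HasDown (Sum.inr q : J ℓ') → y = 0) := by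
  have hc := cf_ne_zero Γ _ (hasGrading_inr hp)
  have h1 := el_apply_self Γ _ (hasGrading_inr hp)
  have h2 := el_apply_of_ne Γ (hasGrading_inr hp) (s := Sum.inl p) (by simp)
  have := h (el Γ _ (hasGrading_inr hp))
    (fun r hr => ⟨el_apply_of_ne _ _ (by simp), el_apply_of_ne Γ (r := Sum.inr p) _ (s := Sum.inr r)
      (fun h => hr (Sum.inr_injective h))⟩)
    (fun h => absurd h hd) (fun _ => h2)
  rw [(hM _).1, (hM _).2, h1, h2] at this
  simpa [hc] using this

/-- In `I_1` both basis directions are diagonal, so a down-grading part at `q` would annihilate the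
second column of the matrix. In `I_4` no nonzero direction is diagonal, whereas in the first three
blocks `ε_p` is, so its row would vanish. For `I_2` and `I_3` the diagonal line is the same, but it
contains `σ_p` only for `I_2`. -/
theorem PreservesDiagonal.block_of {τ : Γ.toAddSubgroup → Γ'.toAddSubgroup} {p : Idx ℓ}
    {q : Idx ℓ'} (h : PreservesDiagonal τ p q) (hpq : IsPairMap τ p q) :
    (p.1 = 0 → q.1 = 0) ∧ (p.1 ≠ 3 → q.1 ≠ 3) ∧ ¬ (p.1 = 1 ∧ q.1 = 2) := by
  obtain ⟨w, x, y, z, hdet, hM⟩ := hpq.exists_matrix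
  have h1 := h.of_inl hpq.lt_left hM
  have h2 := h.of_inr hpq.lt_left hM
  have h4 := hpq.lt_left
  have h4' := hpq.lt_right
  have hs := hM (sg Γ p)
  rw [hpq.map_sg] at hs
  simp only [hasDown_inl_iff, hasDown_inr_iff] at h1 h2
  simp only [sg] at hs
  rw [sigma_inl_self h4, sigma_inl_self h4'] at hs
  refine ⟨?_, ?_, ?_⟩
  · intro hp
    by_contra hq
    have h5 : (q.1 ≠ 0 ∧ q.1 ≠ 4) := ⟨hq, fun h => by rw [h] at h4'; revert h4'; decide⟩
    have hx := (h1 (by rw [hp]; decide)).1 h5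
    have hz := (h2 (by rw [hp]; decide)).1 h5
    exact hdet (by rw [hx, hz]; ring)
  · intro hp hq
    have h6 : ¬ (3 ≤ p.1) := by
      intro h; apply hp; revert h h4; generalize p.1 = k; revert k; decide
    have hx := (h1 h6).1 (by rw [hq]; decide)
    have hw := (h1 h6).2 (by rw [hq])
    exact hdet (by rw [hx, hw]; ring)
  · rintro ⟨hp, hq⟩
    have hx := (h1 (by rw [hp]; decide)).1 (by rw [hq]; decide)
    rw [sigma_inr_self' hp, sigma_inr_self h4' (by rw [hq]; decide), hx] at hs
    simpa using hs.2

theorem PreservesDiagonal.block_eq {τ : Γ.toAddSubgroup ≃+ Γ'.toAddSubgroup} {p : Idx ℓ}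
    {q : Idx ℓ'} (h : PreservesDiagonal τ p q) (hpq : IsPairMap τ p q)
    (h' : PreservesDiagonal τ.symm q p) (hpq' : IsPairMap τ.symm q p) : q.1 = p.1 := by
  have h1 := h.block_of hpq
  have h2 := h'.block_of hpq'
  -- The constraints for `τ` and for its inverse leave only equal block numbers, a finite check.
  have h3 := hpq.lt_left
  have h4 := hpq.lt_right
  revert h1 h2 h3 h4
  generalize p.1 = k
  generalize q.1 = l
  revert k l
  decide

theorem PreservesDiagonal.apply_inr_eq_zero {τ : Γ.toAddSubgroup → Γ'.toAddSubgroup} {p : Idx ℓ}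
    {q : Idx ℓ'} (h : PreservesDiagonal τ p q) (hpq : IsPairMap τ p q) (hp : p.1 = 2)
    (hq : q.1 = 2) {α : Γ.toAddSubgroup} (hα : α.1 (Sum.inr p) = 0) :
    (τ α).1 (Sum.inr q) = 0 := by
  obtain ⟨w, x, y, z, hdet, hM⟩ := hpq.exists_matrix
  have h1 := (h.of_inl hpq.lt_left hM (by rw [hasDown_inr_iff, hp]; decide)).1
    (by rw [hasDown_inl_iff, hq]; decide)
  rw [(hM α).2, hα, h1]; ring

/-- The functional `α ↦ α_p - α_p̄` (for `p ∈ I_1 ∪ I_3 ∪ I_4`), `-α_p̄` (for `p ∈ I_2`) or `α_p`. -/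
def lam (p : Idx ℓ) (α : J ℓ → F) : F :=
  if p.1 = 1 then - α (Sum.inr p)
  else if p.1 < 4 then α (Sum.inl p) - α (Sum.inr p)
  else α (Sum.inl p)

/-- The matrix of a pair map has the prescribed shape. -/
theorem IsPairMap.exists_blockMatrix {τ : Γ.toAddSubgroup → Γ'.toAddSubgroup} {p : Idx ℓ}
    {q : Idx ℓ'} (hpq : IsPairMap τ p q) (hb : q.1 = p.1)
    (h3 : p.1 = 2 → ∀ α : Γ.toAddSubgroup, α.1 (Sum.inr p) = 0 → (τ α).1 (Sum.inr q) = 0) :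
    ∃ a b : F, b ≠ 0 ∧ ∀ α : Γ.toAddSubgroup,
      ![(τ α).1 (Sum.inl q), (τ α).1 (Sum.inr q)] =
        Matrix.vecMul ![α.1 (Sum.inl p), α.1 (Sum.inr p)] (blockMatrix p.1 a b) := by
  obtain ⟨w, x, y, z, hdet, hM⟩ := hpq.exists_matrix
  have h4 := hpq.lt_left
  have h4' := hpq.lt_right
  have hs := hM (sg Γ p)
  rw [hpq.map_sg] at hs
  simp only [sg] at hs
  rw [sigma_inl_self h4, sigma_inl_self h4'] at hs
  have hM' : ∀ α : Γ.toAddSubgroup, ![(τ α).1 (Sum.inl q), (τ α).1 (Sum.inr q)] =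
        Matrix.vecMul ![α.1 (Sum.inl p), α.1 (Sum.inr p)] !![w, x; y, z] := by
    intro α
    rw [(hM α).1, (hM α).2]
    ext i
    fin_cases i <;> simp
  by_cases h1 : p.1 = 1
  · rw [sigma_inr_self' h1, sigma_inr_self' (hb.trans h1)] at hs
    have hw : w = 1 := by linear_combination -hs.1
    have hx : x = 0 := by linear_combination -hs.2
    subst hw hx
    refine ⟨y, z, fun h => hdet (by rw [h]; ring), fun α => ?_⟩
    rw [hM']; simp only [blockMatrix, if_pos h1]
  · rw [sigma_inr_self h4 h1, sigma_inr_self h4' (by rwa [hb])] at hs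
    have hy : y = 1 - w := by linear_combination -hs.1
    have hz : z = 1 - x := by linear_combination -hs.2
    subst hy hz
    by_cases h2 : p.1 = 2
    · have hx : x = 0 := by
        have := h3 h2 (el Γ _ (hasGrading_inl h4)) (el_apply_of_ne _ _ (by simp))
        rw [(hM _).2, el_apply_self, el_apply_of_ne _ _ (by simp)] at this
        simpa [cf_ne_zero] using this
      subst hx
      -- The matrix for `I_3` does not involve `a`; any value would do.
      refine ⟨0, w, fun h => hdet (by rw [h]; ring), fun α => ?_⟩
      rw [hM']; simp only [blockMatrix, if_neg h1, if_pos h2, sub_zero]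
    · refine ⟨x, w - x, fun h => hdet (by linear_combination h), fun α => ?_⟩
      rw [hM']; simp only [blockMatrix, if_neg h1, if_neg h2]
      congr 3 <;> ring_nf

end Blocks

/-! ### Elements with all `x^α` as eigenvectors, and the coordinates in `I_5` and `I_6`. -/

section Functionals

variable {F : Type*} [Field F] {ℓ ℓ' : Fin 7 → ℕ} {Γ : AdmissibleSubgroup F ℓ}
  {Γ' : AdmissibleSubgroup F ℓ'}

/-- If all `x^α` are eigenvectors of `ad u`, then the eigenvalue is a combination of the
functionals `lam p`, whose coefficients are seen in the action of `u` on the `t_p`. -/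
theorem exists_lam_of_eigen {u : SemigroupAlg Γ}
    (hu : ∀ α : Γ.toAddSubgroup, ∃ c : F, br Γ u (X Γ α) = c • X Γ α) :
    ∃ c : Idx ℓ → F, (∀ α : Γ.toAddSubgroup, br Γ u (X Γ α) = (∑ p, c p * lam p α.1) • X Γ α) ∧
      ∀ p, p.1 = 2 ∨ p.1 = 3 ∨ p.1 = 5 → br Γ u (T Γ (Sum.inl p)) = c p • 1 := by
  -- The bracket of `u` with `x^e`, `e` a multiple of `ε_p`, involves only `∂_p̄ u`; the eigenvector
  -- equation then makes `∂_p̄ u` a multiple of `x^{-σ_p}`.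
  have hr : ∀ p : Idx ℓ, HasGrading (Sum.inl p : J ℓ) →
      ∃ d : F, der Γ (Sum.inr p) u = d • X Γ (-sg Γ p) := by
    intro p hp
    obtain ⟨c, hc⟩ := hu (el Γ _ hp)
    rw [br_skew, br_el_inl, X_add, mul_assoc] at hc
    refine ⟨-(cf Γ _ hp)⁻¹ * c, ?_⟩
    have h2 : X Γ (sg Γ p) * der Γ (Sum.inr p) u = (-(cf Γ _ hp)⁻¹ * c) • 1 := by
      apply X_mul_cancel Γ (α := el Γ _ hp)
      apply smul_right_injective _ (cf_ne_zero Γ _ hp)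
      apply neg_injective
      simp only [mul_smul_comm, mul_one] at hc ⊢
      rw [hc, smul_smul, ← neg_smul]
      congr 1
      have := cf_ne_zero Γ _ hp
      field_simp
    apply X_mul_cancel Γ (α := sg Γ p)
    rw [h2, mul_smul_comm, X_mul_X_neg]
  have hl : ∀ p : Idx ℓ, p.1 < 4 → ∃ d : F, der Γ (Sum.inl p) u = d • X Γ (-sg Γ p) := by
    intro p hp
    obtain ⟨c, hc⟩ := hu (el Γ _ (hasGrading_inr hp))
    rw [br_skew, br_el_inr, X_add, mul_assoc] at hc
    refine ⟨(cf Γ _ (hasGrading_inr hp))⁻¹ * c, ?_⟩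
    have h2 : X Γ (sg Γ p) * der Γ (Sum.inl p) u =
        ((cf Γ _ (hasGrading_inr hp))⁻¹ * c) • 1 := by
      apply X_mul_cancel Γ (α := el Γ _ (hasGrading_inr hp))
      apply smul_right_injective _ (cf_ne_zero Γ _ (hasGrading_inr hp))
      simp only [mul_smul_comm, mul_one, neg_smul, mul_neg, neg_neg] at hc ⊢
      rw [hc, smul_smul]
      congr 1
      have := cf_ne_zero Γ _ (hasGrading_inr hp)
      field_simp
    apply X_mul_cancel Γ (α := sg Γ p)
    rw [h2, mul_smul_comm, X_mul_X_neg]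
  choose! d' hd' using hr
  choose! d hd using hl
  -- The commutation of `∂_p` and `∂_p̄` on `u` relates the two scalars. On `I_2` it kills `d'`,
  -- elsewhere in `I_{1,4}` the two agree, and this is what turns the eigenvalue into `lam p`.
  have hdd : ∀ p : Idx ℓ, p.1 < 4 → d' p = d p * sigma F p (Sum.inr p) := by
    intro p hp
    have h := der_comm Γ (Sum.inl p) (Sum.inr p) u
    rw [hd p hp, hd' p (hasGrading_inl hp), map_smul, map_smul, der_X, der_X, smul_smul,
      smul_smul] at h
    have h2 := congrArg (X Γ (sg Γ p) * ·) h
    simp only [mul_smul_comm, X_mul_X_neg] at h2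
    have h3 := smul_left_injective F (one_ne_zero (α := SemigroupAlg Γ)) h2
    have h4 : (-sg Γ p).1 (Sum.inl p) = -1 := by
      change -sigma F p (Sum.inl p) = -1
      rw [sigma_inl_self hp]
    have h5 : (-sg Γ p).1 (Sum.inr p) = -sigma F p (Sum.inr p) := rfl
    rw [h4, h5] at h3
    linear_combination -h3
  refine ⟨fun p => if p.1 = 1 then - d p else - d' p, fun α => ?_, fun p hp => ?_⟩
  · rw [br_skew, br_X, ← Finset.sum_neg_distrib, Finset.sum_smul]
    refine Finset.sum_congr rfl fun p _ => ?_
    by_cases h4 : p.1 < 4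
    · rw [hd p h4, hd' p (hasGrading_inl h4), smul_smul, smul_smul, ← sub_smul, mul_smul_comm,
        ← X_add, add_neg_cancel_right, ← neg_smul]
      congr 1
      by_cases h1 : p.1 = 1
      · simp only [lam, if_pos h1]
        rw [hdd p h4, sigma_inr_self' h1]
        ring
      · simp only [lam, if_neg h1, if_pos h4]
        rw [hdd p h4, sigma_inr_self h4 h1]
        ring
    · have h1 : p.1 ≠ 1 := by
        rintro h; rw [h] at h4; exact h4 (by decide)
      have h0 : α.1 (Sum.inr p) = 0 := apply_eq_zero Γ α (r := Sum.inr p) h4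
      simp only [lam, if_neg h1, if_neg h4, h0, zero_smul, sub_zero]
      by_cases hg : HasGrading (Sum.inl p : J ℓ)
      · rw [hd' p hg, smul_smul, mul_smul_comm, ← X_add, add_neg_cancel_right, ← neg_smul]
        congr 1
        ring
      · rw [apply_eq_zero Γ α hg]; simp
  · have h1 : p.1 ≠ 1 := by
      rintro h; rw [h] at hp; revert hp; decide
    have hg : HasGrading (Sum.inl p : J ℓ) := by
      change p.1 < 6
      rcases hp with h | h | h <;> rw [h] <;> decide
    have hD : HasDown (Sum.inl p : J ℓ) := by
      rw [hasDown_inl_iff]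
      rcases hp with h | h | h <;> rw [h] <;> decide
    simp only [if_neg h1]
    rw [br_skew, br_T_inl Γ hD, hd' p hg, mul_smul_comm, X_mul_X_neg, neg_smul]

theorem eq_zero_of_der_sq_eq_zero {r : J ℓ} (hr : ¬ HasDown r) {f : SemigroupAlg Γ}
    (h : der Γ r (der Γ r f) = 0) : der Γ r f = 0 := by
  ext m
  have hm := congrArg (fun x => x.coeff m) h
  simp only [coeff_der_of_not_hasDown Γ hr] at hm ⊢
  rcases mul_eq_zero.1 hm with h1 | h1
  · simp [h1]
  · simpa using h1

theorem br_T_inr_of_not_lt {q : Idx ℓ} (hq : ¬ q.1 < 4) (v : SemigroupAlg Γ) :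
    br Γ (T Γ (Sum.inr q)) v = - der Γ (Sum.inl q) v := by
  rw [br_T_inr Γ (hasDown_of_not_hasGrading (r := Sum.inr q) hq), sg_eq_zero Γ hq, X_zero, one_mul]

/-- The coordinates in `I_5` and `I_6` of the image of `α` are combinations of the `lam p`. -/
theorem IsConformal.exists_lam {ψ : SemigroupAlg Γ ≃ₐ[F] SemigroupAlg Γ'} {k : F}
    (h : IsConformal ψ k) {τ : Γ.toAddSubgroup ≃+ Γ'.toAddSubgroup} {χ : Γ.toAddSubgroup → F}
    (hg : ∀ δ, ψ (X Γ δ) = χ δ • X Γ' (τ δ)) {q : Idx ℓ'} (hq : ¬ q.1 < 4) :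
    ∃ c : Idx ℓ → F, (∀ α : Γ.toAddSubgroup, (τ α).1 (Sum.inl q) = ∑ p, c p * lam p α.1) ∧
      (q.1 = 4 → ∀ p, p.1 = 2 ∨ p.1 = 3 ∨ p.1 = 5 → c p = 0) := by
  -- On the target `[t_q̄, ·] = -∂_q`, which has all monomials `x^β` as eigenvectors; hence `ad u`
  -- has all `x^α` as eigenvectors.
  set u := ψ.symm (T Γ' (Sum.inr q)) with hu
  have hψu : ψ u = T Γ' (Sum.inr q) := ψ.apply_symm_apply _
  have h1 : ∀ α : Γ.toAddSubgroup, br Γ u (X Γ α) = (-(k * (τ α).1 (Sum.inl q))) • X Γ α := by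
    intro α
    apply ψ.injective
    rw [h.map_br, hψu, br_T_inr_of_not_lt hq, hg, map_smul, der_X, map_smul, hg]
    module
  obtain ⟨c, hc, hc'⟩ := exists_lam_of_eigen (u := u) fun α => ⟨_, h1 α⟩
  refine ⟨fun p => -(k⁻¹ * c p), fun α => ?_, fun hq4 p hp => ?_⟩
  · have h2 := (smul_left_injective F (isUnit_X Γ α).ne_zero ((h1 α).symm.trans (hc α)))
    simp only [neg_mul, mul_assoc, Finset.sum_neg_distrib, ← Finset.mul_sum]
    rw [← h2]
    have := h.ne_zero
    field_simp
  · have h3 := hc' p hp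
    have h4 : br Γ u (br Γ u (T Γ (Sum.inl p))) = 0 := by
      rw [h3, map_smul, br_one_right, smul_zero]
    have h5 : br Γ u (T Γ (Sum.inl p)) = 0 := by
      have hd : ¬ HasDown (Sum.inl q : J ℓ') := fun hh => hh.2 hq4
      have h6 := congrArg ψ h4
      rw [h.map_br, h.map_br, hψu, br_T_inr_of_not_lt hq, map_zero, map_smul,
        br_T_inr_of_not_lt hq, map_neg] at h6
      simp only [smul_neg, neg_neg, smul_smul] at h6
      have h7 := (smul_eq_zero.1 h6).resolve_left (mul_ne_zero h.ne_zero h.ne_zero)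
      apply ψ.injective
      rw [h.map_br, hψu, br_T_inr_of_not_lt hq, eq_zero_of_der_sq_eq_zero hd h7]
      simp
    rw [h3] at h5
    simp [(smul_eq_zero.1 h5).resolve_right one_ne_zero]

end Functionals

/-! ### The invariants of an isomorphism and the equality `ℓ = ℓ'`. -/

section Data

variable {F : Type*} [Field F] {ℓ ℓ' : Fin 7 → ℕ} {Γ : AdmissibleSubgroup F ℓ}
  {Γ' : AdmissibleSubgroup F ℓ'}

/-- The coordinates of `τ α` in `I_5` and `I_6` are combinations of the functionals `lam p`. -/
def HasCoordinates (τ : Γ.toAddSubgroup → Γ'.toAddSubgroup) : Prop :=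
  ∀ q : Idx ℓ', ¬ q.1 < 4 → ∃ c : Idx ℓ → F,
    (∀ α : Γ.toAddSubgroup, (τ α).1 (Sum.inl q) = ∑ p, c p * lam p α.1) ∧
      (q.1 = 4 → ∀ p, p.1 = 2 ∨ p.1 = 3 ∨ p.1 = 5 → c p = 0)

/-- What an isomorphism of the Lie algebras determines about an isomorphism `τ` of the groups. -/
structure IsoData (τ : Γ.toAddSubgroup ≃+ Γ'.toAddSubgroup)
    (ν : {p : Idx ℓ // p.1 < 4} ≃ {q : Idx ℓ' // q.1 < 4}) : Prop where
  pair : ∀ p, IsPairMap τ p.1 (ν p).1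
  pair_symm : ∀ p, IsPairMap τ.symm (ν p).1 p.1
  block : ∀ p, (ν p).1.1 = p.1.1
  inr_eq_zero : ∀ p, p.1.1 = 2 → ∀ α : Γ.toAddSubgroup, α.1 (Sum.inr p.1) = 0 →
    (τ α).1 (Sum.inr (ν p).1) = 0
  coord : HasCoordinates τ
  coord_symm : HasCoordinates τ.symm

theorem IsConformal.exists_isoData [CharZero F] {ψ : SemigroupAlg Γ ≃ₐ[F] SemigroupAlg Γ'} {k : F}
    (h : IsConformal ψ k) : ∃ (τ : Γ.toAddSubgroup ≃+ Γ'.toAddSubgroup)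
      (ν : {p : Idx ℓ // p.1 < 4} ≃ {q : Idx ℓ' // q.1 < 4}), IsoData τ ν := by
  obtain ⟨τ, ⟨χ, hχ, hχm, hg⟩, ⟨χ', hχ', hχm', hg'⟩⟩ := exists_addEquiv_of_algEquiv ψ
  obtain ⟨ν, hν, hν'⟩ := exists_equiv_isPairMap (fun p hp => h.exists_isPairMap hχ hχm hg hp)
    (fun q hq => h.symm.exists_isPairMap hχ' hχm' hg' hq)
  have hd : ∀ p, PreservesDiagonal τ p.1 (ν p).1 := fun p α hα h1 h2 =>
    h.map_diagonal hχ hg (hν p) hα h1 h2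
  have hd' : ∀ p, PreservesDiagonal τ.symm (ν p).1 p.1 := fun p α hα h1 h2 =>
    h.symm.map_diagonal hχ' hg' (hν' p) hα h1 h2
  have hb : ∀ p, (ν p).1.1 = p.1.1 := fun p => (hd p).block_eq (hν p) (hd' p) (hν' p)
  exact ⟨τ, ν, hν, hν', hb,
    fun p hp α hα => (hd p).apply_inr_eq_zero (hν p) hp ((hb p).trans hp) hα,
    fun q hq => h.exists_lam hg hq, fun q hq => h.symm.exists_lam hg' hq⟩

theorem card_block {k : Fin 7} (hk : k < 4) :
    Fintype.card {p : {p : Idx ℓ // p.1 < 4} // p.1.1 = k} = ℓ k := by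
  rw [← Fintype.card_fin (ℓ k)]
  symm
  refine Fintype.card_of_bijective (f := fun i : Fin (ℓ k) => ⟨⟨⟨k, i⟩, hk⟩, rfl⟩) ⟨?_, ?_⟩
  · intro i j hij
    simpa using hij
  · rintro ⟨⟨⟨k', i⟩, hk'⟩, rfl⟩
    exact ⟨i, rfl⟩

theorem IsoData.eq_of_lt {τ : Γ.toAddSubgroup ≃+ Γ'.toAddSubgroup}
    {ν : {p : Idx ℓ // p.1 < 4} ≃ {q : Idx ℓ' // q.1 < 4}} (h : IsoData τ ν) {k : Fin 7}
    (hk : k < 4) : ℓ k = ℓ' k := by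
  rw [← card_block (ℓ := ℓ) hk, ← card_block (ℓ := ℓ') hk]
  exact Fintype.card_congr (ν.subtypeEquiv fun p => by rw [h.block])

theorem lam_of_not_lt {p : Idx ℓ} (hp : ¬ p.1 < 4) (α : J ℓ → F) : lam p α = α (Sum.inl p) := by
  have h1 : p.1 ≠ 1 := by
    rintro h; rw [h] at hp; exact hp (by decide)
  simp only [lam, if_neg h1, if_neg hp]

theorem lam_eq_zero {p : Idx ℓ} {α : J ℓ → F} (h1 : α (Sum.inl p) = 0) (h2 : α (Sum.inr p) = 0) :
    lam p α = 0 := by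
  simp [lam, h1, h2]

/-- The diagonal blocks of the coefficients of an isomorphism and of its inverse are inverse to
each other. -/
theorem sum_coordinates_eq {τ : Γ.toAddSubgroup ≃+ Γ'.toAddSubgroup}
    (hτ : ∀ q : Idx ℓ', q.1 < 4 → ∃ p, IsPairMap τ p q) {c : Idx ℓ' → Idx ℓ → F}
    {c' : Idx ℓ → Idx ℓ' → F}
    (hc : ∀ q, ¬ q.1 < 4 → (∀ α : Γ.toAddSubgroup,
      (τ α).1 (Sum.inl q) = ∑ p, c q p * lam p α.1) ∧
      (q.1 = 4 → ∀ p, p.1 = 2 ∨ p.1 = 3 ∨ p.1 = 5 → c q p = 0))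
    (hc' : ∀ q, ¬ q.1 < 4 → (∀ α : Γ'.toAddSubgroup,
      (τ.symm α).1 (Sum.inl q) = ∑ p, c' q p * lam p α.1) ∧
      (q.1 = 4 → ∀ p, p.1 = 2 ∨ p.1 = 3 ∨ p.1 = 5 → c' q p = 0))
    {k : Fin 7} (hk : k = 4 ∨ k = 5) (i j : Fin (ℓ k)) :
    ∑ m : Fin (ℓ' k), c ⟨k, m⟩ ⟨k, i⟩ * c' ⟨k, j⟩ ⟨k, m⟩ = if i = j then 1 else 0 := by
  have hk4 : ¬ k < 4 := by rcases hk with rfl | rfl <;> decide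
  -- The basis vector `ε` of the index `⟨k, i⟩` isolates one coefficient column; expanding `τ⁻¹ (τ
  -- e) = e` in the coordinate `⟨k, j⟩` is the matrix identity.
  let e : Γ.toAddSubgroup := ⟨Pi.single (Sum.inl ⟨k, i⟩) 1,
    Γ.single_mem ⟨k, i⟩ (not_lt.1 hk4) (by
      change k < 6
      rcases hk with rfl | rfl <;> decide)⟩
  have he : ∀ r, e.1 r = if r = Sum.inl ⟨k, i⟩ then 1 else 0 := fun r => Pi.single_apply _ _ _
  have hlam : ∀ p : Idx ℓ, lam p e.1 = if p = ⟨k, i⟩ then 1 else 0 := by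
    intro p
    split_ifs with h
    · subst h
      rw [lam_of_not_lt hk4, he, if_pos rfl]
    · exact lam_eq_zero (by rw [he, if_neg (by simpa using h)]) (by rw [he, if_neg (by simp)])
  have h1 : ∀ q : Idx ℓ', ¬ q.1 < 4 → (τ e).1 (Sum.inl q) = c q ⟨k, i⟩ := by
    intro q hq
    rw [(hc q hq).1]
    simp [hlam]
  have h2 : ∀ q : Idx ℓ', q.1 < 4 → lam q (τ e).1 = 0 := by
    intro q hq
    obtain ⟨p, hp⟩ := hτ q hq
    obtain ⟨w, x, y, z, -, hM⟩ := hp.exists_matrix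
    have hpk : p ≠ ⟨k, i⟩ := by
      rintro rfl; exact hk4 hp.lt_left
    have h3 := he (Sum.inl p)
    have h4 := he (Sum.inr p)
    rw [if_neg (by simpa using hpk)] at h3
    rw [if_neg (by simp)] at h4
    exact lam_eq_zero (by rw [(hM e).1, h3, h4]; ring) (by rw [(hM e).2, h3, h4]; ring)
  have h3 := (hc' ⟨k, j⟩ hk4).1 (τ e)
  rw [AddEquiv.symm_apply_apply, he, Fintype.sum_sigma, Finset.sum_eq_single k] at h3
  · have h4 : (Sum.inl ⟨k, j⟩ : J ℓ) = Sum.inl ⟨k, i⟩ ↔ i = j := by simp [eq_comm]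
    simp only [h4] at h3
    rw [h3]
    refine Finset.sum_congr rfl fun m _ => ?_
    rw [lam_of_not_lt hk4, h1 _ hk4, mul_comm]
  · intro l _ hl
    refine Finset.sum_eq_zero fun m _ => ?_
    by_cases hl4 : l < 4
    · rw [h2 _ hl4, mul_zero]
    · rw [lam_of_not_lt hl4]
      by_cases hl6 : l = 6
      · have : ¬ HasGrading (Sum.inl ⟨l, m⟩ : J ℓ') := by
          change ¬ l < 6
          rw [hl6]; decide
        rw [apply_eq_zero Γ' _ this, mul_zero]
      · rw [h1 _ hl4]
        -- The coefficients are block triangular in `I_5` and `I_6`: no coordinate in `I_5` depends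
        -- on `I_6`. For `k = 4` this kills the factor from the inverse, for `k = 5` the factor from
        -- `τ`.
        rcases hk with hk | hk
        · rw [(hc' ⟨k, j⟩ hk4).2 hk _ (Or.inr (Or.inr _)), zero_mul]
          exact (by decide : ∀ l : Fin 7, ¬ l < 4 → ¬ l = 6 → ¬ l = 4 → l = 5) l hl4 hl6
            (fun h => hl (h.trans hk.symm))
        · rw [(hc ⟨l, m⟩ hl4).2 _ ⟨k, i⟩ (Or.inr (Or.inr hk)), mul_zero]
          exact (by decide : ∀ l : Fin 7, ¬ l < 4 → ¬ l = 6 → ¬ l = 5 → l = 4) l hl4 hl6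
            (fun h => hl (h.trans hk.symm))
  · simp

theorem IsoData.exists_matrix {τ : Γ.toAddSubgroup ≃+ Γ'.toAddSubgroup}
    {ν : {p : Idx ℓ // p.1 < 4} ≃ {q : Idx ℓ' // q.1 < 4}} (h : IsoData τ ν) :
    ∃ c : Idx ℓ' → Idx ℓ → F, (∀ q, ¬ q.1 < 4 → (∀ α : Γ.toAddSubgroup,
      (τ α).1 (Sum.inl q) = ∑ p, c q p * lam p α.1) ∧
      (q.1 = 4 → ∀ p, p.1 = 2 ∨ p.1 = 3 ∨ p.1 = 5 → c q p = 0)) ∧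
      ∀ k : Fin 7, k = 4 ∨ k = 5 → ∃ B' : Matrix (Fin (ℓ' k)) (Fin (ℓ k)) F,
        (Matrix.of fun i j => c ⟨k, j⟩ ⟨k, i⟩) * B' = 1 ∧
        B' * (Matrix.of fun i j => c ⟨k, j⟩ ⟨k, i⟩) = 1 := by
  choose! c hc using h.coord
  choose! c' hc' using h.coord_symm
  refine ⟨c, hc, fun k hk => ⟨Matrix.of fun i j => c' ⟨k, j⟩ ⟨k, i⟩, ?_, ?_⟩⟩
  · ext i j
    rw [Matrix.mul_apply, Matrix.one_apply]
    exact sum_coordinates_eq (fun q hq => ⟨(ν.symm ⟨q, hq⟩).1, by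
      simpa using h.pair (ν.symm ⟨q, hq⟩)⟩) hc hc' hk i j
  · ext i j
    rw [Matrix.mul_apply, Matrix.one_apply]
    exact sum_coordinates_eq (τ := τ.symm) (fun q hq => ⟨(ν ⟨q, hq⟩).1, h.pair_symm ⟨q, hq⟩⟩)
      hc' hc hk i j

theorem IsoData.eq_of_eq {τ : Γ.toAddSubgroup ≃+ Γ'.toAddSubgroup}
    {ν : {p : Idx ℓ // p.1 < 4} ≃ {q : Idx ℓ' // q.1 < 4}} (h : IsoData τ ν) {k : Fin 7}
    (hk : k = 4 ∨ k = 5) : ℓ k = ℓ' k := by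
  obtain ⟨c, -, hc⟩ := h.exists_matrix
  obtain ⟨B', h1, h2⟩ := hc k hk
  simpa using Matrix.square_of_invertible _ _ h1 h2

/-- The augmentation `x^α ↦ 1`, `t_r ↦ 0`. -/
def aug (Γ : AdmissibleSubgroup F ℓ) : SemigroupAlg Γ →ₐ[F] F := liftHom Γ 1 0

theorem downOp_X (r : J ℓ) (α : Γ.toAddSubgroup) : downOp Γ r (X Γ α) = 0 := by
  simp [X, downOp_single]

theorem downOp_T {r s : J ℓ} (hr : HasDown r) :
    downOp Γ s (T Γ r) = if s = r then 1 else 0 := by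
  have h : gradingOp Γ s (T Γ r) = 0 := by
    rw [T_of_hasDown Γ hr, gradingOp_single]; simp
  have h2 : downOp Γ s (T Γ r) = der Γ s (T Γ r) := by
    rw [der, LinearMap.add_apply, h, zero_add]
  rw [h2]
  split_ifs with hs
  · rw [hs, der_T_self Γ hr]
  · exact der_T_of_ne Γ hs

/-- `M` is the Jacobian matrix, at the augmentation, of the preimages of the target variables. A
relation `a` between its rows gives a point derivation that kills all preimages of generators, hence
is zero; its value on `t_r` is `a r`. So the rows are independent. -/
theorem card_hasDown_le [CharZero F] (ψ : SemigroupAlg Γ ≃ₐ[F] SemigroupAlg Γ') :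
    Nat.card {r : J ℓ // HasDown r} ≤ Nat.card {r : J ℓ' // HasDown r} := by
  classical
  obtain ⟨τ, -, ⟨χ', -, -, hg'⟩⟩ := exists_addEquiv_of_algEquiv ψ
  let M : {r : J ℓ // HasDown r} → {r : J ℓ' // HasDown r} → F :=
    fun r s => aug Γ (downOp Γ r.1 (ψ.symm (T Γ' s.1)))
  have hM : LinearIndependent F M := by
    rw [Fintype.linearIndependent_iff]
    intro a ha r
    let D : SemigroupAlg Γ →ₗ[F] F := ∑ r, a r • ((aug Γ).toLinearMap ∘ₗ downOp Γ r.1)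
    have hD : ∀ u, D u = ∑ r, a r * aug Γ (downOp Γ r.1 u) := fun u => by simp [D]
    have hDm : ∀ u v, D (u * v) = D u * aug Γ v + aug Γ u * D v := by
      intro u v
      simp only [hD, downOp_mul, map_add, map_mul, Finset.sum_mul, Finset.mul_sum,
        ← Finset.sum_add_distrib]
      exact Finset.sum_congr rfl fun p _ => by ring
    have hD0 : ∀ v, D (ψ.symm v) = 0 := by
      intro v
      have hv : v ∈ Algebra.adjoin F (Set.range (X Γ') ∪ T Γ' '' {r : J ℓ' | HasDown r}) := by
        rw [adjoin_eq_top]; trivial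
      induction hv using Algebra.adjoin_induction with
      | mem x hx =>
        rcases hx with ⟨α, rfl⟩ | ⟨s, hs, rfl⟩
        · rw [hg', map_smul, hD]
          simp [downOp_X]
        · have := congrFun ha ⟨s, hs⟩
          simpa [M, hD] using this
      | algebraMap c =>
        rw [AlgEquiv.commutes, Algebra.algebraMap_eq_smul_one, ← X_zero, map_smul, hD]
        simp [downOp_X]
      | add x y _ _ hx hy => rw [map_add, map_add, hx, hy, add_zero]
      | mul x y _ _ hx hy => rw [map_mul, hDm, hx, hy, zero_mul, mul_zero, add_zero]
    have h1 := hD0 (ψ (T Γ r.1))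
    rw [AlgEquiv.symm_apply_apply, hD] at h1
    simp only [downOp_T r.2, Subtype.coe_inj, apply_ite (aug Γ), map_one, map_zero] at h1
    simpa using h1
  have := hM.fintype_card_le_finrank
  rw [Module.finrank_fintype_fun_eq_card] at this
  rwa [Nat.card_eq_fintype_card, Nat.card_eq_fintype_card]

theorem card_hasDown (ℓ : Fin 7 → ℕ) : Nat.card {r : J ℓ // HasDown r} =
    ℓ 1 + ℓ 2 + 2 * ℓ 3 + ℓ 4 + 2 * ℓ 5 + 2 * ℓ 6 := by
  classical
  rw [Nat.card_eq_fintype_card, Fintype.card_subtype, Finset.card_filter, Fintype.sum_sum_type,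
    Fintype.sum_sigma, Fintype.sum_sigma]
  simp only [hasDown_inl_iff, hasDown_inr_iff, Fin.sum_univ_seven, Finset.sum_const,
    Finset.card_univ, Fintype.card_fin, smul_eq_mul]
  simp +decide only [if_true, if_false]
  ring

/-- The permutation and the invertible matrices determine the sizes of the first six blocks; the
count of variables then determines the last. -/
theorem IsConformal.eq [CharZero F] {ψ : SemigroupAlg Γ ≃ₐ[F] SemigroupAlg Γ'} {k : F}
    (h : IsConformal ψ k) : ℓ = ℓ' := by
  obtain ⟨τ, ν, hd⟩ := h.exists_isoData
  have h1 := le_antisymm (card_hasDown_le ψ) (card_hasDown_le ψ.symm)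
  rw [card_hasDown, card_hasDown] at h1
  have h2 : ∀ k : Fin 7, k ≠ 6 → ℓ k = ℓ' k := by
    intro k hk
    by_cases h4 : k < 4
    · exact hd.eq_of_lt h4
    · refine hd.eq_of_eq ?_
      revert k; decide
  ext k
  by_cases hk : k = 6
  · have e1 := h2 1 (by decide)
    have e2 := h2 2 (by decide)
    have e3 := h2 3 (by decide)
    have e4 := h2 4 (by decide)
    have e5 := h2 5 (by decide)
    subst hk
    omega
  · exact h2 k hk

end Data

/-! ### The data of an isomorphism make `τ` preserving. -/

section Preserving

variable {F : Type*} [Field F] {ℓ : Fin 7 → ℕ} {Γ Γ' : AdmissibleSubgroup F ℓ}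

theorem IsoData.isPreserving {τ : Γ.toAddSubgroup ≃+ Γ'.toAddSubgroup}
    {ν : Equiv.Perm {p : Idx ℓ // p.1 < 4}} (h : IsoData τ ν) : IsPreserving τ := by
  choose a b hb hab using fun p => (h.pair p).exists_blockMatrix (h.block p) (h.inr_eq_zero p)
  obtain ⟨c, hc, hB⟩ := h.exists_matrix
  obtain ⟨B5, h51, h52⟩ := hB 4 (Or.inl rfl)
  obtain ⟨B6, h61, h62⟩ := hB 5 (Or.inr rfl)
  refine ⟨⟨ν, a, b, h.block, hb, fun α p => hab p α⟩,
    ⟨Matrix.of fun i j => c ⟨4, j⟩ ⟨0, i⟩, Matrix.of fun i j => c ⟨4, j⟩ ⟨1, i⟩,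
      ⟨Matrix.of fun i j => c ⟨4, j⟩ ⟨4, i⟩, B5, h51, h52⟩, fun α => ?_⟩,
    ⟨Matrix.of fun i j => c ⟨5, j⟩ ⟨0, i⟩, Matrix.of fun i j => c ⟨5, j⟩ ⟨1, i⟩,
      Matrix.of fun i j => Sum.elim (fun i => c ⟨5, j⟩ ⟨2, i⟩) (fun i => c ⟨5, j⟩ ⟨3, i⟩) i,
      Matrix.of fun i j => c ⟨5, j⟩ ⟨4, i⟩,
      ⟨Matrix.of fun i j => c ⟨5, j⟩ ⟨5, i⟩, B6, h61, h62⟩, fun α => ?_⟩⟩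
  · ext q
    have h6 : ∀ i, α.1 (Sum.inl ⟨6, i⟩) = 0 := fun i => apply_eq_zero Γ α (by
      simp [HasGrading])
    have h0 := (hc ⟨4, q⟩ (by simp)).2 rfl
    rw [(hc ⟨4, q⟩ (by simp)).1, Fintype.sum_sigma, Fin.sum_univ_seven]
    have e2 : ∀ i, c ⟨4, q⟩ ⟨2, i⟩ = 0 := fun i => h0 _ (by simp)
    have e3 : ∀ i, c ⟨4, q⟩ ⟨3, i⟩ = 0 := fun i => h0 _ (by simp)
    have e5 : ∀ i, c ⟨4, q⟩ ⟨5, i⟩ = 0 := fun i => h0 _ (by simp)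
    simp only [e2, e3, e5, zero_mul, Finset.sum_const_zero, lam]
    simp +decide [Matrix.vecMul, dotProduct, h6, mul_comm, sub_eq_add_neg]
  · ext q
    have h6 : ∀ i, α.1 (Sum.inl ⟨6, i⟩) = 0 := fun i => apply_eq_zero Γ α (by
      simp [HasGrading])
    rw [(hc ⟨5, q⟩ (by simp)).1, Fintype.sum_sigma, Fin.sum_univ_seven]
    simp only [lam]
    simp +decide [Matrix.vecMul, dotProduct, h6, mul_comm, sub_eq_add_neg, add_assoc]

end Preserving

/-! ### Homomorphisms and biadditive maps known outside finitely many fibres. -/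

section Generic

variable {G Q : Type*} [AddCommGroup G] [AddCommGroup Q] {π : G →+ Q} {T : Set Q}

theorem exists_generic (hπ : ∀ S : Set Q, S.Finite → ∃ l, π l ∉ S) (hT : T.Finite) (L : List Q) :
    ∃ l, ∀ x ∈ L, x + π l ∉ T := by
  obtain ⟨l, hl⟩ := hπ (⋃ x ∈ {x | x ∈ L}, (fun t => t - x) '' T)
    (L.finite_toSet.biUnion fun x _ => hT.image _)
  refine ⟨l, fun x hx h => hl ?_⟩
  exact Set.mem_biUnion (x := x) hx ⟨_, h, add_sub_cancel_left x _⟩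

/-- A function that is multiplicative outside finitely many fibres of `π` agrees with a
homomorphism there. -/
theorem exists_monoidHom_of_generic {M : Type*} [CommGroup M]
    (hπ : ∀ S : Set Q, S.Finite → ∃ l, π l ∉ S) (hT : T.Finite) {f : G → M}
    (hf : ∀ δ γ, π δ ∉ T → π γ ∉ T → π (δ + γ) ∉ T → f (δ + γ) = f δ * f γ) :
    ∃ g : Multiplicative G →* M, ∀ δ, π δ ∉ T → g (Multiplicative.ofAdd δ) = f δ := by
  have hex : ∀ δ, ∃ l, π l ∉ T ∧ π (δ + l) ∉ T := fun δ => by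
    obtain ⟨l, hl⟩ := exists_generic hπ hT [0, π δ]
    exact ⟨l, by simpa using hl 0 (by simp), by simpa using hl (π δ) (by simp)⟩
  choose s hs1 hs2 using hex
  -- The quotient `f(δ + l) / f(l)` does not depend on the generic shift `l`: two shifts are
  -- compared through a third, `n`, generic for both. This common value is the homomorphism.
  have key : ∀ δ l, π l ∉ T → π (δ + l) ∉ T → f (δ + s δ) / f (s δ) = f (δ + l) / f l := by
    intro δ l hl1 hl2
    obtain ⟨n, hn⟩ := exists_generic hπ hT [0, π δ, π (δ + l), π (δ + s δ)]
    have h1 : π n ∉ T := by simpa using hn 0 (by simp)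
    have h2 : π (δ + n) ∉ T := by simpa using hn (π δ) (by simp)
    have h3 : π (δ + l + n) ∉ T := by simpa [add_assoc] using hn (π (δ + l)) (by simp)
    have h4 : π (δ + s δ + n) ∉ T := by simpa [add_assoc] using hn (π (δ + s δ)) (by simp)
    have aux : ∀ m, π m ∉ T → π (δ + m) ∉ T → π (δ + m + n) ∉ T →
        f (δ + m) / f m = f (δ + n) / f n := by
      intro m hm1 hm2 hm3
      rw [div_eq_div_iff_mul_eq_mul, ← hf _ _ hm2 h1 hm3, ← hf _ _ h2 hm1]
      · congr 1; abel
      · rwa [add_right_comm]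
    rw [aux _ (hs1 δ) (hs2 δ) h4, aux _ hl1 hl2 h3]
  refine ⟨MonoidHom.mk' (fun δ => f (δ.toAdd + s δ.toAdd) / f (s δ.toAdd)) ?_, ?_⟩
  · intro δ γ
    change f (δ.toAdd + γ.toAdd + s (δ.toAdd + γ.toAdd)) / f (s (δ.toAdd + γ.toAdd)) = _
    generalize δ.toAdd = δ
    generalize γ.toAdd = γ
    obtain ⟨m, hm⟩ := exists_generic hπ hT [0, π γ, π (s δ), π (δ + s δ + γ)]
    have h1 : π m ∉ T := by simpa using hm 0 (by simp)
    have h2 : π (γ + m) ∉ T := by simpa using hm (π γ) (by simp)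
    have h3 : π (s δ + m) ∉ T := by simpa using hm (π (s δ)) (by simp)
    have h4 : π (δ + s δ + γ + m) ∉ T := by
      simpa [add_assoc] using hm (π (δ + s δ + γ)) (by simp)
    -- For the sum `δ + γ` the shift is taken to be `s δ + m`, so that it splits into generic shifts
    -- of `δ` and of `γ`.
    have e1 : δ + γ + (s δ + m) = (δ + s δ) + (γ + m) := by abel
    have h5 : π (δ + s δ + (γ + m)) ∉ T := by rwa [← add_assoc]
    rw [key (δ + γ) (s δ + m) h3 (by rwa [e1]), key γ m h1 h2, e1, hf _ _ (hs2 δ) h2 h5,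
      hf _ _ (hs1 δ) h1 h3, mul_div_mul_comm]
  · intro δ hδ
    change f (δ + s δ) / f (s δ) = f δ
    rw [hf _ _ hδ (hs1 δ) (hs2 δ), mul_div_cancel_right]

/-- A biadditive map that vanishes generically is zero. -/
theorem eq_zero_of_generic {V : Type*} [AddCommGroup V]
    (hπ : ∀ S : Set Q, S.Finite → ∃ l, π l ∉ S) (hT : T.Finite) {D : G → G → V}
    (hD1 : ∀ δ δ' γ, D (δ + δ') γ = D δ γ + D δ' γ) (hD2 : ∀ δ γ γ', D δ (γ + γ') = D δ γ + D δ γ')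
    (s : Q) (h : ∀ δ γ, π δ ∉ T → π γ ∉ T → π (δ + γ) ∉ T → π (δ + γ) + s ∉ T → D δ γ = 0)
    (δ γ : G) : D δ γ = 0 := by
  -- By biadditivity `D δ γ` is an alternating sum of the values of `D` at `(l, m)`, `(δ+l, m)`,
  -- `(l, γ+m)` and `(δ+l, γ+m)`. The list below makes all four pairs generic, also after the shift
  -- by `s`.
  obtain ⟨l, hl⟩ := exists_generic hπ hT [0, π δ]
  have h1 : π l ∉ T := by simpa using hl 0 (by simp)
  have h2 : π (δ + l) ∉ T := by simpa using hl (π δ) (by simp)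
  obtain ⟨m, hm⟩ := exists_generic hπ hT [0, π γ, π l, π (δ + l), π (l + γ), π (δ + l + γ),
    π l + s, π (δ + l) + s, π (l + γ) + s, π (δ + l + γ) + s]
  simp only [List.forall_mem_cons, map_add, zero_add] at hm
  obtain ⟨a0, a1, a2, a3, a4, a5, a6, a7, a8, a9, -⟩ := hm
  have e0 : D l m = 0 := h _ _ h1 a0 (by simpa using a2) (by
    rw [map_add, add_right_comm]; exact a6)
  have e1 : D (δ + l) m = 0 := h _ _ h2 a0 (by simpa using a3) (by
    rw [map_add, map_add, add_right_comm]; exact a7)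
  have e2 : D l (γ + m) = 0 := h _ _ h1 (by simpa using a1) (by
    rw [← add_assoc]; simpa using a4) (by
    rw [map_add, map_add, ← add_assoc, add_right_comm]; exact a8)
  have e3 : D (δ + l) (γ + m) = 0 := h _ _ h2 (by simpa using a1) (by
    rw [← add_assoc]; simpa using a5) (by
    rw [map_add, map_add, map_add, ← add_assoc, add_right_comm]; exact a9)
  rw [hD1, e0, add_zero] at e1
  rw [hD1, e2, add_zero, hD2, e1, add_zero] at e3
  exact e3

end Generic

/-! ### Generic agreement of the two products on monomials. -/

section PureGraded

variable {F : Type*} [Field F] {ℓ ℓ' : Fin 7 → ℕ} {Γ : AdmissibleSubgroup F ℓ}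
  {Γ' : AdmissibleSubgroup F ℓ'}

theorem dt_add_left (p : Idx ℓ) (α α' β : J ℓ → F) : dt p (α + α') β = dt p α β + dt p α' β := by
  simp only [dt, Pi.add_apply]; ring

theorem dt_add_right (p : Idx ℓ) (α β β' : J ℓ → F) : dt p α (β + β') = dt p α β + dt p α β' := by
  simp only [dt, Pi.add_apply]; ring

/-- `α` is supported in the `p`-th pair of coordinates. -/
def SuppPair (p : Idx ℓ) (α : Γ.toAddSubgroup) : Prop :=
  ∀ q, q ≠ p → α.1 (Sum.inl q) = 0 ∧ α.1 (Sum.inr q) = 0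

theorem br_X_X_of_suppPair {p : Idx ℓ} {α : Γ.toAddSubgroup} (hα : SuppPair p α)
    (β : Γ.toAddSubgroup) : br Γ (X Γ α) (X Γ β) = dt p α.1 β.1 • X Γ (α + β + sg Γ p) := by
  rw [br_X_X, Finset.sum_eq_single p]
  · intro q _ hq
    simp [dt, hα q hq]
  · simp

variable [CharZero F] {m : SemigroupAlg Γ →ₗ[F] SemigroupAlg Γ →ₗ[F] SemigroupAlg Γ}

/-- For `α` supported in one pair, `ad x^α` sends monomials to multiples of monomials. By `h1` the
exponent `-α - σ_p` gives a partner with bracket `1`, so the squares of `x^α` agree; by `h2` a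
multiple of `x^γ` is a bracket with `x^α`, and polarisation applies. -/
theorem mul_X_eq_of_suppPair (hm1 : ∀ u, m u 1 = u)
    (hbm : ∀ w u v, br Γ w (m u v) = m (br Γ w u) v + m u (br Γ w v)) (hm : ∀ u v, m u v = m v u)
    {p : Idx ℓ} {α γ : Γ.toAddSubgroup} (hα : SuppPair p α)
    (h1 : dt p α.1 (sigma F p) ≠ 0) (h2 : dt p α.1 (γ.1 - sigma F p) ≠ 0) :
    m (X Γ γ) (X Γ α) = X Γ γ * X Γ α := by
  have e1 : dt p α.1 (-α - sg Γ p).1 = - dt p α.1 (sigma F p) := by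
    change dt p α.1 (-α.1 - sigma F p) = _
    simp only [dt, Pi.sub_apply, Pi.neg_apply]; ring
  have hsq : m (X Γ α) (X Γ α) = X Γ α * X Γ α := by
    refine sq_eq_of_bracket_eq_one (b := br Γ) (v := (- dt p α.1 (sigma F p))⁻¹ •
      X Γ (-α - sg Γ p)) hm1 hbm (br_self Γ) (br_mul_left Γ) ?_
    rw [map_smul, br_X_X_of_suppPair hα, e1, smul_smul, inv_mul_cancel₀ (neg_ne_zero.2 h1), one_smul,
      ← X_zero]
    congr 1; abel
  have h3 := mul_eq_of_bracket hm hbm (br_mul_right Γ) hsq (X Γ (γ - α - sg Γ p))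
  have e2 : dt p α.1 (γ - α - sg Γ p).1 = dt p α.1 (γ.1 - sigma F p) := by
    change dt p α.1 (γ.1 - α.1 - sigma F p) = _
    simp only [dt, Pi.sub_apply]; ring
  have e3 : α + (γ - α - sg Γ p) + sg Γ p = γ := by abel
  rw [br_skew, br_X_X_of_suppPair hα, e2, e3, ← neg_smul, map_smul, LinearMap.smul_apply,
    smul_mul_assoc] at h3
  exact smul_right_injective _ (neg_ne_zero.2 h2) h3

/-- Differentiate the agreement at `(x^γ, x^α)` along `x^β`, where `β` is chosen so that `[x^β,
x^α]` is a nonzero multiple of `x^δ`. The other terms, from `[x^β, x^γ]` against `x^α`, are covered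
by the same agreement. -/
theorem mul_X_X_eq_of_dt (hm1 : ∀ u, m u 1 = u)
    (hbm : ∀ w u v, br Γ w (m u v) = m (br Γ w u) v + m u (br Γ w v)) (hm : ∀ u v, m u v = m v u)
    {p : Idx ℓ} {α γ δ : Γ.toAddSubgroup} (hα : SuppPair p α)
    (h1 : dt p α.1 (sigma F p) ≠ 0) (h2 : dt p α.1 (γ.1 - sigma F p) ≠ 0)
    (h3 : dt p α.1 (δ.1 - sigma F p) ≠ 0) (h4 : dt p α.1 (δ.1 + γ.1 - sigma F p) ≠ 0)
    (h5 : dt p α.1 (δ.1 + γ.1 - sigma F p - sigma F p) ≠ 0) :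
    m (X Γ γ) (X Γ δ) = X Γ γ * X Γ δ := by
  set β := δ - α - sg Γ p with hβ
  have key := congrArg (br Γ (X Γ β)) (mul_X_eq_of_suppPair hm1 hbm hm hα h1 h2)
  have e1 : m (br Γ (X Γ β) (X Γ γ)) (X Γ α) = br Γ (X Γ β) (X Γ γ) * X Γ α := by
    rw [br_X_X, map_sum, LinearMap.sum_apply, Finset.sum_mul]
    refine Finset.sum_congr rfl fun q _ => ?_
    rw [map_smul, LinearMap.smul_apply, smul_mul_assoc,
      mul_X_eq_of_suppPair hm1 hbm hm hα h1]
    change dt p α.1 (δ.1 - α.1 - sigma F p + γ.1 + sigma F q - sigma F p) ≠ 0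
    -- The term of index `q` carries a factor `x^{σ_q}`, which shifts the `p`-th pair only if `q =
    -- p`; hence the two conditions `h4` and `h5`.
    by_cases hq : q = p
    · subst hq
      convert h4 using 1
      simp only [dt, Pi.sub_apply, Pi.add_apply]; ring
    · convert h5 using 1
      simp only [dt, Pi.sub_apply, Pi.add_apply, sigma_inl_of_ne hq, sigma_inr_of_ne hq]; ring
  rw [hbm, br_mul_right, e1] at key
  have h6 := add_left_cancel key
  have e2 : dt p α.1 β.1 = dt p α.1 (δ.1 - sigma F p) := by
    change dt p α.1 (δ.1 - α.1 - sigma F p) = _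
    simp only [dt, Pi.sub_apply]; ring
  have e3 : α + β + sg Γ p = δ := by rw [hβ]; abel
  rw [br_skew, br_X_X_of_suppPair hα, e2, e3, ← neg_smul, map_smul, mul_smul_comm] at h6
  exact smul_right_injective _ (neg_ne_zero.2 h3) h6

/-- The `p`-th pair of coordinates. -/
def pr (Γ : AdmissibleSubgroup F ℓ) (p : Idx ℓ) : Γ.toAddSubgroup →+ F × F where
  toFun δ := (δ.1 (Sum.inl p), δ.1 (Sum.inr p))
  map_zero' := rfl
  map_add' _ _ := rfl

/-- Among the vectors `n e + f`, with `e`, `f` fixed multiples of the two basis vectors, each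
nonzero `x` is proportional to at most one; so some `n` avoids the finite set. -/
theorem exists_suppPair {p : Idx ℓ} (hp : p.1 < 4) {S : Set (F × F)} (hS : S.Finite)
    (h0 : (0 : F × F) ∉ S) : ∃ α : Γ.toAddSubgroup, SuppPair p α ∧
      ∀ x ∈ S, α.1 (Sum.inl p) * x.2 - α.1 (Sum.inr p) * x.1 ≠ 0 := by
  have ha := cf_ne_zero Γ _ (hasGrading_inl hp)
  have hb := cf_ne_zero Γ _ (hasGrading_inr hp)
  have hfin : (⋃ x ∈ S, {n : ℕ | (n : F) * cf Γ _ (hasGrading_inl hp) * x.2 -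
      cf Γ _ (hasGrading_inr hp) * x.1 = 0}).Finite := by
    refine hS.biUnion fun x hx => Set.Subsingleton.finite ?_
    intro n hn n' hn'
    have hx2 : x.2 ≠ 0 := by
      intro hx2
      have hn1 : (n : F) * cf Γ _ (hasGrading_inl hp) * x.2 -
        cf Γ _ (hasGrading_inr hp) * x.1 = 0 := hn
      rw [hx2] at hn1
      have hx1 : x.1 = 0 := by simpa [hb] using hn1
      exact h0 ((Prod.ext hx1 hx2 : x = 0) ▸ hx)
    have h1 : ((n : F) - n') * (cf Γ _ (hasGrading_inl hp) * x.2) = 0 := by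
      have hn1 : (n : F) * cf Γ _ (hasGrading_inl hp) * x.2 -
        cf Γ _ (hasGrading_inr hp) * x.1 = 0 := hn
      have hn2 : (n' : F) * cf Γ _ (hasGrading_inl hp) * x.2 -
        cf Γ _ (hasGrading_inr hp) * x.1 = 0 := hn'
      linear_combination hn1 - hn2
    have h2 := (mul_eq_zero.1 h1).resolve_right (mul_ne_zero ha hx2)
    exact_mod_cast sub_eq_zero.1 h2
  obtain ⟨n, hn⟩ := hfin.infinite_compl.nonempty
  refine ⟨n • el Γ _ (hasGrading_inl hp) + el Γ _ (hasGrading_inr hp), fun q hq => ?_,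
    fun x hx h => hn (Set.mem_biUnion hx ?_)⟩
  · change n • (el Γ (Sum.inl p) _).1 _ + (el Γ (Sum.inr p) _).1 _ = 0 ∧
      n • (el Γ (Sum.inl p) _).1 _ + (el Γ (Sum.inr p) _).1 _ = 0
    rw [el_apply_of_ne Γ (r := Sum.inl p) _ (by simpa using hq),
      el_apply_of_ne Γ (r := Sum.inr p) _ (by simp), el_apply_of_ne Γ (r := Sum.inl p) _ (by simp),
      el_apply_of_ne Γ (r := Sum.inr p) _ (fun h => hq (Sum.inr_injective h))]
    simp
  · change (n • (el Γ (Sum.inl p) _).1 (Sum.inl p) + (el Γ (Sum.inr p) _).1 (Sum.inl p)) * x.2 -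
      (n • (el Γ (Sum.inl p) _).1 (Sum.inr p) + (el Γ (Sum.inr p) _).1 (Sum.inr p)) * x.1 = 0 at h
    rw [el_apply_self, el_apply_self, el_apply_of_ne Γ (r := Sum.inr p) _ (by simp),
      el_apply_of_ne Γ (r := Sum.inl p) _ (by simp)] at h
    simpa using h

/-- A vector proportional to no nonzero member of `S` is not such a member itself. Should it be zero
in the pair, adding `(1, 0)` to the set forces a nonzero choice. -/
theorem exists_pr_notMem {p : Idx ℓ} (hp : p.1 < 4) (S : Set (F × F)) (hS : S.Finite) :
    ∃ l, pr Γ p l ∉ S := by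
  obtain ⟨α, -, hα⟩ := exists_suppPair (Γ := Γ) hp (hS.subset (Set.sdiff_subset (t := {0})))
    (by simp)
  by_cases h : pr Γ p α ∈ S \ {0}
  · exact absurd (by simp only [pr, AddMonoidHom.coe_mk, ZeroHom.coe_mk]; ring) (hα _ h)
  · by_cases h0 : pr Γ p α = 0
    · obtain ⟨β, -, hβ⟩ := exists_suppPair (Γ := Γ) hp
        ((hS.subset (Set.sdiff_subset (t := {0}))).insert (1, 0)) (by simp [Prod.ext_iff])
      have h1 := hβ (1, 0) (Set.mem_insert _ _)
      refine ⟨β, fun h2 => hβ (pr Γ p β) (Set.mem_insert_of_mem _ ⟨h2, ?_⟩) ?_⟩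
      · rintro h3
        apply h1
        have : β.1 (Sum.inr p) = 0 := congrArg Prod.snd h3
        rw [this]; ring
      · simp only [pr, AddMonoidHom.coe_mk, ZeroHom.coe_mk]; ring
    · exact ⟨α, fun h2 => h ⟨h2, h0⟩⟩

theorem mul_X_X_eq (hm1 : ∀ u, m u 1 = u)
    (hbm : ∀ w u v, br Γ w (m u v) = m (br Γ w u) v + m u (br Γ w v)) (hm : ∀ u v, m u v = m v u)
    {p : Idx ℓ} (hp : p.1 < 4) {γ δ : Γ.toAddSubgroup}
    (h2 : pr Γ p γ ≠ pr Γ p (sg Γ p)) (h3 : pr Γ p δ ≠ pr Γ p (sg Γ p))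
    (h4 : pr Γ p (δ + γ) ≠ pr Γ p (sg Γ p))
    (h5 : pr Γ p (δ + γ) ≠ pr Γ p (sg Γ p + sg Γ p)) :
    m (X Γ γ) (X Γ δ) = X Γ γ * X Γ δ := by
  have h1 : pr Γ p (sg Γ p) ≠ 0 := fun h => by
    have h6 : sigma F p (Sum.inl p) = 0 := congrArg Prod.fst h
    rw [sigma_inl_self hp] at h6
    exact one_ne_zero h6
  obtain ⟨α, hα, hS⟩ := exists_suppPair (Γ := Γ) hp (S := {pr Γ p (sg Γ p), pr Γ p (γ - sg Γ p),
    pr Γ p (δ - sg Γ p), pr Γ p (δ + γ - sg Γ p), pr Γ p (δ + γ - sg Γ p - sg Γ p)})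
    (by simp) (by
      simp only [Set.mem_insert_iff, Set.mem_singleton_iff, not_or]
      refine ⟨h1.symm, ?_, ?_, ?_, ?_⟩ <;> intro h <;> rw [eq_comm] at h
      · rw [map_sub, sub_eq_zero] at h; exact h2 h
      · rw [map_sub, sub_eq_zero] at h; exact h3 h
      · rw [map_sub, sub_eq_zero] at h; exact h4 h
      · rw [sub_sub, map_sub, sub_eq_zero] at h; exact h5 h)
  simp only [Set.mem_insert_iff, Set.mem_singleton_iff, forall_eq_or_imp, forall_eq] at hS
  obtain ⟨a1, a2, a3, a4, a5⟩ := hS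
  exact mul_X_X_eq_of_dt hm1 hbm hm hα a1 a2 a3 a4 a5

end PureGraded

/-! ### Lie isomorphisms when only `I_1` is present. -/

section PureGradedIso

variable {F : Type*} [Field F] [CharZero F] {ℓ ℓ' : Fin 7 → ℕ} {Γ : AdmissibleSubgroup F ℓ}
  {Γ' : AdmissibleSubgroup F ℓ'}

/-- A Lie isomorphism is monomial outside finitely many fibres of the `p`-th pair of
coordinates. -/
theorem exists_monomial_of_generic {φ : SemigroupAlg Γ ≃ₗ[F] SemigroupAlg Γ'}
    (hφ : ∀ u v, φ (br Γ u v) = br Γ' (φ u) (φ v)) {p : Idx ℓ} (hp : p.1 < 4) :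
    ∃ (τ : Γ.toAddSubgroup →+ Γ'.toAddSubgroup) (χ : Γ.toAddSubgroup → F)
      (T : Set (F × F)),
      (∀ δ, χ δ ≠ 0) ∧ T.Finite ∧ (∀ δ, pr Γ p δ ∉ T → φ (X Γ δ) = χ δ • X Γ' (τ δ)) ∧
      (∀ δ, τ δ = 0 → δ = 0) ∧ ∀ p : Idx ℓ, p.1 < 4 → ∃ q, IsPairMap τ p q := by
  obtain ⟨κ, hκ0, hκ⟩ := exists_smul_map_one hφ
  have hm1 := transportMul_one hκ
  have hbm := br_transportMul hφ κ
  have hm := transportMul_comm φ κ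
  have hmul : ∀ u v, κ • φ (transportMul φ κ u v) = (κ • φ u) * (κ • φ v) := by
    intro u v
    rw [transportMul_apply, map_smul, LinearEquiv.apply_symm_apply, smul_mul_smul_comm, smul_smul]
  set s := pr Γ p (sg Γ p) with hs
  have hs0 : s ≠ 0 := fun h => by
    have h6 : sigma F p (Sum.inl p) = 0 := congrArg Prod.fst h
    rw [sigma_inl_self hp] at h6
    exact one_ne_zero h6
  -- The fibres over `s` and `s + s` are those where the products may differ; `-s` is excluded so
  -- that `x^{-δ}` can serve as an inverse of `x^δ` for both products.
  set T : Set (F × F) := {s, -s, s + s} with hT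
  have hTf : T.Finite := by simp [hT]
  have hagree : ∀ δ γ, pr Γ p δ ∉ T → pr Γ p γ ∉ T → pr Γ p (δ + γ) ∉ T →
      κ • φ (X Γ (δ + γ)) = (κ • φ (X Γ δ)) * (κ • φ (X Γ γ)) := by
    intro δ γ h1 h2 h3
    simp only [hT, Set.mem_insert_iff, Set.mem_singleton_iff, not_or] at h1 h2 h3
    rw [← hmul, X_add, mul_X_X_eq hm1 hbm hm hp h1.1 h2.1]
    · rw [add_comm]; exact h3.1
    · rw [add_comm, map_add (pr Γ p) (sg Γ p)]; exact h3.2.2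
  have hunit : ∀ δ, pr Γ p δ ∉ T → IsUnit (κ • φ (X Γ δ)) := by
    intro δ h1
    simp only [hT, Set.mem_insert_iff, Set.mem_singleton_iff, not_or] at h1
    have h2s : s + s ≠ 0 := by
      rw [← two_smul F s]
      exact smul_ne_zero two_ne_zero hs0
    refine IsUnit.of_mul_eq_one (κ • φ (X Γ (-δ))) ?_
    rw [← hmul, mul_X_X_eq hm1 hbm hm hp h1.1, X_mul_X_neg, hκ]
    · rw [map_neg, Ne, neg_eq_iff_eq_neg]; exact h1.2.1
    · rw [neg_add_cancel, map_zero]; exact hs0.symm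
    · rw [neg_add_cancel, map_zero, map_add]; exact h2s.symm
  classical
  obtain ⟨g, hg⟩ := exists_monoidHom_of_generic (π := pr Γ p) (exists_pr_notMem hp) hTf
    (f := fun δ => if h : pr Γ p δ ∉ T then (hunit δ h).unit else 1) (by
      intro δ γ h1 h2 h3
      rw [dif_pos h1, dif_pos h2, dif_pos h3]
      ext1
      simpa using hagree δ γ h1 h2 h3)
  obtain ⟨τ, χ, hχ, hχm, hτ⟩ := exists_of_monoidHom Γ' ((Units.coeHom _).comp g)
  have hφX : ∀ δ, pr Γ p δ ∉ T → κ • φ (X Γ δ) = χ δ • X Γ' (τ δ) := by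
    intro δ h
    rw [← hτ, MonoidHom.comp_apply, hg δ h, dif_pos h]
    rfl
  -- If `τ δ = 0`, then for generic `l` the images of `x^l` and `x^{δ+l}` are proportional, so `δ =
  -- 0`.
  have hinj : ∀ δ, τ δ = 0 → δ = 0 := by
    intro δ hδ
    obtain ⟨l, hl⟩ := exists_generic (exists_pr_notMem (Γ := Γ) hp) hTf [0, pr Γ p δ]
    have h1 := hφX l (by simpa using hl 0 (by simp))
    have h2 := hφX (δ + l) (by simpa using hl (pr Γ p δ) (by simp))
    rw [map_add, hδ, zero_add] at h2
    have h3 : χ l • (κ • φ (X Γ (δ + l))) = χ (δ + l) • (κ • φ (X Γ l)) := by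
      rw [h1, h2, smul_comm]
    rw [smul_comm, smul_comm (χ (δ + l))] at h3
    have h5 := smul_right_injective _ hκ0 h3
    rw [← map_smul, ← map_smul] at h5
    have h4 := φ.injective h5
    simpa using (smul_X_inj Γ (hχ l) h4).1
  -- Both sides are biadditive, so comparing brackets of generic monomials suffices. The shift by
  -- `s` is needed because the term `x^{δ+γ+σ_p}` must be generic too.
  have hE : ∀ δ γ : Γ.toAddSubgroup, ∑ p, (dt p δ.1 γ.1 * χ (sg Γ p)) • X Γ' (τ (sg Γ p)) =
      κ⁻¹ • ∑ q, dt q (τ δ).1 (τ γ).1 • X Γ' (sg Γ' q) := by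
    intro δ γ
    rw [← sub_eq_zero]
    refine eq_zero_of_generic (π := pr Γ p) (exists_pr_notMem hp) hTf
      (D := fun δ γ : Γ.toAddSubgroup =>
        ∑ p, (dt p δ.1 γ.1 * χ (sg Γ p)) • X Γ' (τ (sg Γ p)) -
        κ⁻¹ • ∑ q, dt q (τ δ).1 (τ γ).1 • X Γ' (sg Γ' q)) ?_ ?_ s ?_ δ γ
    · intro δ δ' γ
      simp only [map_add, AddSubgroup.coe_add, dt_add_left, add_mul, add_smul,
        Finset.sum_add_distrib, smul_add]
      abel
    · intro δ γ γ'
      simp only [map_add, AddSubgroup.coe_add, dt_add_right, add_mul, add_smul,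
        Finset.sum_add_distrib, smul_add]
      abel
    · intro δ γ h1 h2 h3 h4
      rw [sub_eq_zero]
      refine sum_dt_eq hχ hχm ?_
      rw [← hφX δ h1, ← hφX γ h2, map_smul, map_smul, LinearMap.smul_apply, ← hφ, br_X_X, map_sum,
        smul_smul, smul_smul, mul_assoc, inv_mul_cancel_left₀ hκ0, Finset.smul_sum]
      refine Finset.sum_congr rfl fun q _ => ?_
      rw [map_smul, smul_comm κ]
      congr 1
      refine (hφX _ ?_).symm
      by_cases hq : q = p
      · subst hq
        rwa [map_add]
      · have : pr Γ p (sg Γ q) = 0 := Prod.ext (sigma_inl_of_ne hq) (sigma_inr_of_ne hq)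
        rwa [map_add, this, add_zero]
  refine ⟨τ, fun δ => κ⁻¹ * χ δ, T, fun δ => mul_ne_zero (inv_ne_zero hκ0) (hχ δ), hTf,
    fun δ h => ?_, hinj, fun p hp =>
      exists_isPairMap ((injective_iff_map_eq_zero τ).2 hinj) hχ hE hp⟩
  rw [mul_smul, ← hφX δ h, smul_smul, inv_mul_cancel₀ hκ0, one_smul]

/-- The additive maps obtained from `φ` and `φ⁻¹` are mutually inverse on generic elements, hence
everywhere by additivity. The conditions on `I_3`, `I_5` and `I_6` are vacuous. -/
theorem exists_isoData_of_pure {φ : SemigroupAlg Γ ≃ₗ[F] SemigroupAlg Γ'}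
    (hφ : ∀ u v, φ (br Γ u v) = br Γ' (φ u) (φ v)) (h0 : ∀ p : Idx ℓ, p.1 = 0)
    (h0' : ∀ p : Idx ℓ', p.1 = 0) (p : Idx ℓ) :
    ∃ (τ : Γ.toAddSubgroup ≃+ Γ'.toAddSubgroup)
      (ν : {p : Idx ℓ // p.1 < 4} ≃ {q : Idx ℓ' // q.1 < 4}), IsoData τ ν := by
  have hp : p.1 < 4 := by rw [h0 p]; decide
  obtain ⟨τ, χ, T, hχ, hT, hτ, hinj, hpair⟩ := exists_monomial_of_generic hφ hp
  obtain ⟨q, hpq⟩ := hpair p hp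
  obtain ⟨τ', χ', T', hχ', hT', hτ', hinj', hpair'⟩ :=
    exists_monomial_of_generic (φ := φ.symm) (symm_br hφ) hpq.lt_right
  obtain ⟨w, x, y, z, hdet, hM⟩ := hpq.exists_matrix
  -- The injective map `M` pulls the bad fibres of `φ⁻¹` back to finitely many bad fibres over the
  -- `p`-th pair.
  let M : F × F → F × F := fun v => (v.1 * w + v.2 * y, v.1 * x + v.2 * z)
  have hMi : Function.Injective M := by
    intro v v' h
    have h1 : v.1 * w + v.2 * y = v'.1 * w + v'.2 * y := congrArg Prod.fst h
    have h2 : v.1 * x + v.2 * z = v'.1 * x + v'.2 * z := congrArg Prod.snd h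
    refine Prod.ext (mul_right_cancel₀ hdet ?_) (mul_right_cancel₀ hdet ?_)
    · linear_combination z * h1 - y * h2
    · linear_combination w * h2 - x * h1
  have hMτ : ∀ δ, pr Γ' q (τ δ) = M (pr Γ p δ) := fun δ => Prod.ext (hM δ).1 (hM δ).2
  have hgen : ∀ δ, pr Γ p δ ∉ T ∪ M ⁻¹' T' → τ' (τ δ) = δ := by
    intro δ hδ
    rw [Set.mem_union, not_or] at hδ
    have h1 := hτ δ hδ.1
    have h2 := hτ' (τ δ) (by rw [hMτ]; exact hδ.2)
    have h3 := congrArg φ.symm h1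
    rw [LinearEquiv.symm_apply_apply, map_smul, h2, smul_smul, ← one_smul F (X Γ δ)] at h3
    exact (smul_X_inj Γ one_ne_zero h3).1.symm
  have hleft : ∀ δ, τ' (τ δ) = δ := by
    intro δ
    obtain ⟨l, hl⟩ := exists_generic (exists_pr_notMem (Γ := Γ) hp)
      (hT.union (hT'.preimage hMi.injOn)) [0, pr Γ p δ]
    have h1 := hgen l (by simpa using hl 0 (by simp))
    have h2 := hgen (δ + l) (by simpa using hl (pr Γ p δ) (by simp))
    rw [map_add, map_add, h1] at h2
    exact add_right_cancel h2
  have hright : ∀ δ, τ (τ' δ) = δ := fun δ =>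
    (injective_iff_map_eq_zero τ').2 hinj' (hleft (τ' δ))
  let e : Γ.toAddSubgroup ≃+ Γ'.toAddSubgroup :=
    { τ with invFun := τ', left_inv := hleft, right_inv := hright }
  obtain ⟨ν, hν, hν'⟩ := exists_equiv_isPairMap (τ := e) hpair hpair'
  refine ⟨e, ν, hν, hν', fun p => by rw [h0, h0'], fun p hp => ?_, fun q hq => ?_, fun q hq => ?_⟩
  · rw [h0] at hp; exact absurd hp (by decide)
  · rw [h0'] at hq; exact absurd (by decide) hq
  · rw [h0] at hq; exact absurd (by decide) hq

end PureGradedIso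

/-! ### The necessity of the conditions. -/

section OnlyIf

variable {F : Type*} [Field F] [CharZero F] {ℓ ℓ' : Fin 7 → ℕ} {Γ : AdmissibleSubgroup F ℓ}
  {Γ' : AdmissibleSubgroup F ℓ'}

/-- A block other than `I_1` on either side gives an isomorphism of algebras, obtained from `φ` or
from `φ⁻¹`; otherwise the generic argument applies. -/
theorem exists_isoData {φ : SemigroupAlg Γ ≃ₗ[F] SemigroupAlg Γ'}
    (hφ : ∀ u v, φ (br Γ u v) = br Γ' (φ u) (φ v)) (hℓ : ℓ ≠ 0) :
    ℓ = ℓ' ∧ ∃ (τ : Γ.toAddSubgroup ≃+ Γ'.toAddSubgroup)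
      (ν : {p : Idx ℓ // p.1 < 4} ≃ {q : Idx ℓ' // q.1 < 4}), IsoData τ ν := by
  by_cases h0 : ∀ p : Idx ℓ, p.1 = 0
  · by_cases h0' : ∀ p : Idx ℓ', p.1 = 0
    · obtain ⟨k, hk⟩ := Function.ne_iff.1 hℓ
      obtain ⟨τ, ν, h⟩ := exists_isoData_of_pure hφ h0 h0' ⟨k, ⟨0, Nat.pos_of_ne_zero hk⟩⟩
      refine ⟨funext fun j => ?_, τ, ν, h⟩
      by_cases hj : j = 0
      · subst hj; exact h.eq_of_lt (by decide)
      · have h1 : ℓ j = 0 := by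
          by_contra hne
          exact hj (h0 ⟨j, ⟨0, Nat.pos_of_ne_zero hne⟩⟩)
        have h2 : ℓ' j = 0 := by
          by_contra hne
          exact hj (h0' ⟨j, ⟨0, Nat.pos_of_ne_zero hne⟩⟩)
        rw [h1, h2]
    · obtain ⟨p, hp⟩ := not_forall.1 h0'
      obtain ⟨ψ, k, h⟩ := exists_isConformal (φ := φ.symm) (symm_br hφ) hp
      exact ⟨h.symm.eq, h.symm.exists_isoData⟩
  · obtain ⟨p, hp⟩ := not_forall.1 h0
    obtain ⟨ψ, k, h⟩ := exists_isConformal hφ hp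
    exact ⟨h.eq, h.exists_isoData⟩

theorem exists_isPreserving (φ : HamiltonianLieAlgebra Γ ≃ₗ⁅F⁆ HamiltonianLieAlgebra Γ')
    (hℓ : ℓ ≠ 0) : ∃ h : ℓ' = ℓ,
      ∃ τ : Γ.toAddSubgroup ≃+ (h ▸ Γ' : AdmissibleSubgroup F ℓ).toAddSubgroup,
        IsPreserving τ := by
  let e : SemigroupAlg Γ ≃ₗ[F] SemigroupAlg Γ' := φ.toLinearEquiv
  have he : ∀ u v, e (br Γ u v) = br Γ' (e u) (e v) := fun u v => φ.toLieHom.map_lie'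
  obtain ⟨rfl, τ, ν, h⟩ := exists_isoData he hℓ
  exact ⟨rfl, τ, h.isPreserving⟩

end OnlyIf

/-! ### What a preserving isomorphism provides. -/

section Preserving

variable {F : Type*} [Field F] {ℓ : Fin 7 → ℕ} {Γ Γ' : AdmissibleSubgroup F ℓ}

/-- The functional `lam p` as a linear map. -/
def lamLin (p : Idx ℓ) : (J ℓ → F) →ₗ[F] F where
  toFun := lam p
  map_add' x y := by
    simp only [lam, Pi.add_apply]
    split_ifs <;> ring
  map_smul' c x := by
    simp only [lam, Pi.smul_apply, smul_eq_mul, RingHom.id_apply]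
    split_ifs <;> ring

theorem lamLin_apply (p : Idx ℓ) (x : J ℓ → F) : lamLin p x = lam p x := rfl

/-- This invariance under the shifts by `σ_p` is what makes the elements `lamElt` commute. -/
theorem lam_sigma {p q : Idx ℓ} (hp : p.1 < 4) : lam q (sigma F p) = 0 := by
  by_cases hq : q = p
  · subst hq
    simp only [lam]
    split_ifs with h1
    · rw [sigma_inr_self' h1, neg_zero]
    · rw [sigma_inl_self hp, sigma_inr_self hp h1, sub_self]
  · exact lam_eq_zero (sigma_inl_of_ne (Ne.symm hq)) (sigma_inr_of_ne (Ne.symm hq))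

/-- The consequences of `τ` being preserving from which an isomorphism of the Lie algebras is
built. -/
structure PreservingData (τ : Γ.toAddSubgroup ≃+ Γ'.toAddSubgroup) where
  ν : Equiv.Perm {p : Idx ℓ // p.1 < 4}
  b : {p : Idx ℓ // p.1 < 4} → F
  b_ne_zero : ∀ p, b p ≠ 0
  map_sg : ∀ p, τ (sg Γ p.1) = sg Γ' (ν p).1
  dt_map : ∀ p (α β : Γ.toAddSubgroup), dt (ν p).1 (τ α).1 (τ β).1 = b p * dt p.1 α.1 β.1
  lam_map : ∀ p (α : Γ.toAddSubgroup), lam (ν p).1 (τ α).1 = b p * lam p.1 α.1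
  map_down : ∀ (r : J ℓ) (hr : HasGrading r) (s : J ℓ), HasDown r → ¬ HasDown s →
    (τ (el Γ r hr)).1 s = 0
  exists_linear : ∀ r, ∃ n : (J ℓ → F) →ₗ[F] F, ∀ α : Γ.toAddSubgroup, α.1 r = n (τ α).1
  exists_lam : ∀ q : Idx ℓ, q.1 = 4 ∨ q.1 = 5 → ∃ d : Idx ℓ → F,
    ∀ α : Γ.toAddSubgroup, α.1 (Sum.inl q) = ∑ p, d p * lam p (τ α).1

theorem mem_of_sum_mul_mem {n : ℕ} {V : Type*} [AddCommGroup V] [Module F V] {R : Submodule F V}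
    (B : Matrix.GeneralLinearGroup (Fin n) F) {v : Fin n → V}
    (h : ∀ j, ∑ i, B.1 i j • v i ∈ R) (m : Fin n) : v m ∈ R := by
  have h1 : ∑ j, (B⁻¹).1 j m • ∑ i, B.1 i j • v i = v m := by
    simp only [Finset.smul_sum, smul_smul]
    rw [Finset.sum_comm]
    have h2 : ∀ i, ∑ j, ((B⁻¹).1 j m * B.1 i j) • v i = (1 : Matrix (Fin n) (Fin n) F) i m • v i := by
      intro i
      rw [← Finset.sum_smul, ← Units.mul_inv B, Matrix.mul_apply]
      simp only [mul_comm]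
    rw [Finset.sum_congr rfl fun i _ => h2 i]
    simp [Matrix.one_apply]
  rw [← h1]
  exact Submodule.sum_mem _ fun j _ => Submodule.smul_mem _ _ (h j)

theorem IsPreserving.nonempty_data {τ : Γ.toAddSubgroup ≃+ Γ'.toAddSubgroup}
    (h : IsPreserving τ) : Nonempty (PreservingData τ) := by
  obtain ⟨⟨ν, a, b, hν, hb, hA⟩, ⟨B15, B25, B55, h5⟩, ⟨B16, B26, B36, B56, B66, h6⟩⟩ := h
  have c1 : ∀ p, p.1.1 = 1 → ∀ α : Γ.toAddSubgroup,
      (τ α).1 (Sum.inl (ν p).1) = α.1 (Sum.inl p.1) + a p * α.1 (Sum.inr p.1) ∧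
      (τ α).1 (Sum.inr (ν p).1) = b p * α.1 (Sum.inr p.1) := by
    intro p hp α
    have e0 := congrFun (hA α p) 0
    have e1 := congrFun (hA α p) 1
    simp only [blockMatrix, if_pos hp] at e0 e1
    simp at e0 e1
    exact ⟨by rw [e0]; ring, by rw [e1]; ring⟩
  have c2 : ∀ p, p.1.1 = 2 → ∀ α : Γ.toAddSubgroup,
      (τ α).1 (Sum.inl (ν p).1) = b p * α.1 (Sum.inl p.1) + (1 - b p) * α.1 (Sum.inr p.1) ∧
      (τ α).1 (Sum.inr (ν p).1) = α.1 (Sum.inr p.1) := by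
    intro p hp α
    have e0 := congrFun (hA α p) 0
    have e1 := congrFun (hA α p) 1
    have hp1 : p.1.1 ≠ 1 := by rw [hp]; decide
    simp only [blockMatrix, if_neg hp1, if_pos hp] at e0 e1
    simp at e0 e1
    exact ⟨by rw [e0]; ring, by rw [e1]⟩
  have c3 : ∀ p, p.1.1 ≠ 1 → p.1.1 ≠ 2 → ∀ α : Γ.toAddSubgroup,
      (τ α).1 (Sum.inl (ν p).1) =
        (a p + b p) * α.1 (Sum.inl p.1) + (1 - a p - b p) * α.1 (Sum.inr p.1) ∧
      (τ α).1 (Sum.inr (ν p).1) = a p * α.1 (Sum.inl p.1) + (1 - a p) * α.1 (Sum.inr p.1) := by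
    intro p hp1 hp2 α
    have e0 := congrFun (hA α p) 0
    have e1 := congrFun (hA α p) 1
    simp only [blockMatrix, if_neg hp1, if_neg hp2] at e0 e1
    simp at e0 e1
    exact ⟨by rw [e0]; ring, by rw [e1]; ring⟩
  have c0 : ∀ p (α : Γ.toAddSubgroup), α.1 (Sum.inl p.1) = 0 → α.1 (Sum.inr p.1) = 0 →
      (τ α).1 (Sum.inl (ν p).1) = 0 ∧ (τ α).1 (Sum.inr (ν p).1) = 0 := by
    intro p α e1 e2
    by_cases hp1 : p.1.1 = 1
    · rw [(c1 p hp1 α).1, (c1 p hp1 α).2, e1, e2]; simp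
    · by_cases hp2 : p.1.1 = 2
      · rw [(c2 p hp2 α).1, (c2 p hp2 α).2, e1, e2]; simp
      · rw [(c3 p hp1 hp2 α).1, (c3 p hp1 hp2 α).2, e1, e2]; simp
  have f5 : ∀ j (α : Γ.toAddSubgroup), (τ α).1 (Sum.inl ⟨4, j⟩) =
      ∑ i, B15 i j * lam ⟨0, i⟩ α.1 + ∑ i, B25 i j * lam ⟨1, i⟩ α.1 +
      ∑ i, B55.1 i j * α.1 (Sum.inl ⟨4, i⟩) := by
    intro j α
    have e := congrFun (h5 α) j
    simp only [Pi.add_apply, Pi.sub_apply, Matrix.vecMul, dotProduct] at e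
    rw [e]
    simp [lam, mul_comm, sub_eq_add_neg]
  have f6 : ∀ j (α : Γ.toAddSubgroup), (τ α).1 (Sum.inl ⟨5, j⟩) =
      ∑ i, B16 i j * lam ⟨0, i⟩ α.1 + ∑ i, B26 i j * lam ⟨1, i⟩ α.1 +
      (∑ i, B36 (Sum.inl i) j * lam ⟨2, i⟩ α.1 + ∑ i, B36 (Sum.inr i) j * lam ⟨3, i⟩ α.1) +
      ∑ i, B56 i j * α.1 (Sum.inl ⟨4, i⟩) + ∑ i, B66.1 i j * α.1 (Sum.inl ⟨5, i⟩) := by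
    intro j α
    have e := congrFun (h6 α) j
    simp only [Pi.add_apply, Pi.sub_apply, Matrix.vecMul, dotProduct, Fintype.sum_sum_type] at e
    rw [e]
    simp [lam, mul_comm, sub_eq_add_neg, show ¬ ((3 : Fin 7) = 1) by decide,
      show ((3 : Fin 7) < 4) by decide, show ((2 : Fin 7) < 4) by decide,
      show ¬ ((2 : Fin 7) = 1) by decide]
  have hlam : ∀ p (α : Γ.toAddSubgroup), lam (ν p).1 (τ α).1 = b p * lam p.1 α.1 := by
    intro p α
    simp only [lam, hν, if_pos p.2]
    by_cases hp1 : p.1.1 = 1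
    · rw [if_pos hp1, if_pos hp1, (c1 p hp1 α).2]; ring
    · rw [if_neg hp1, if_neg hp1]
      by_cases hp2 : p.1.1 = 2
      · rw [(c2 p hp2 α).1, (c2 p hp2 α).2]; ring
      · rw [(c3 p hp1 hp2 α).1, (c3 p hp1 hp2 α).2]; ring
  have hlamEx : ∀ q : Idx ℓ, q.1 = 4 ∨ q.1 = 5 → ∃ d : Idx ℓ → F,
      ∀ α : Γ.toAddSubgroup, α.1 (Sum.inl q) = ∑ p, d p * lam p (τ α).1 := by
    -- `R` is spanned by the functionals `lam p ∘ τ`. It contains `lam p` for `p ∈ I_{1,4}` since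
    -- the `b p` are invertible, then the coordinates in `I_5` by inverting `B55`, then those in
    -- `I_6` by inverting `B66`.
    set R : Submodule F (Γ.toAddSubgroup → F) :=
      Submodule.span F (Set.range fun (p : Idx ℓ) (α : Γ.toAddSubgroup) => lam p (τ α).1) with hR
    have hmem : ∀ p : Idx ℓ, (fun α : Γ.toAddSubgroup => lam p (τ α).1) ∈ R := fun p =>
      Submodule.subset_span ⟨p, rfl⟩
    have hlt : ∀ p : Idx ℓ, p.1 < 4 → (fun α : Γ.toAddSubgroup => lam p α.1) ∈ R := by
      intro p hp
      have e : (fun α : Γ.toAddSubgroup => lam p α.1) =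
          (b ⟨p, hp⟩)⁻¹ • fun α : Γ.toAddSubgroup => lam (ν ⟨p, hp⟩).1 (τ α).1 := by
        ext α
        rw [Pi.smul_apply, hlam, smul_eq_mul, inv_mul_cancel_left₀ (hb _)]
      rw [e]
      exact Submodule.smul_mem _ _ (hmem _)
    have hsum : ∀ (k : Fin 7) (_ : k < 4) (B : Fin (ℓ k) → F),
        (∑ i, B i • fun α : Γ.toAddSubgroup => lam ⟨k, i⟩ α.1) ∈ R := fun k hk B =>
      Submodule.sum_mem _ fun i _ => Submodule.smul_mem _ _ (hlt _ hk)
    have h4 : ∀ m : Fin (ℓ 4), (fun α : Γ.toAddSubgroup => α.1 (Sum.inl ⟨4, m⟩)) ∈ R := by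
      refine mem_of_sum_mul_mem B55 fun j => ?_
      have e : ∑ i, B55.1 i j • (fun α : Γ.toAddSubgroup => α.1 (Sum.inl ⟨4, i⟩)) =
          (fun α : Γ.toAddSubgroup => lam ⟨4, j⟩ (τ α).1) -
          (∑ i, B15 i j • fun α : Γ.toAddSubgroup => lam ⟨0, i⟩ α.1) -
          (∑ i, B25 i j • fun α : Γ.toAddSubgroup => lam ⟨1, i⟩ α.1) := by
        ext α
        simp only [Finset.sum_apply, Pi.smul_apply, Pi.sub_apply, smul_eq_mul]
        rw [lam_of_not_lt (show ¬ (4 : Fin 7) < 4 by decide), f5]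
        ring
      rw [e]
      exact sub_mem (sub_mem (hmem _) (hsum 0 (by decide) _)) (hsum 1 (by decide) _)
    have h5 : ∀ m : Fin (ℓ 5), (fun α : Γ.toAddSubgroup => α.1 (Sum.inl ⟨5, m⟩)) ∈ R := by
      refine mem_of_sum_mul_mem B66 fun j => ?_
      have e : ∑ i, B66.1 i j • (fun α : Γ.toAddSubgroup => α.1 (Sum.inl ⟨5, i⟩)) =
          (fun α : Γ.toAddSubgroup => lam ⟨5, j⟩ (τ α).1) -
          (∑ i, B16 i j • fun α : Γ.toAddSubgroup => lam ⟨0, i⟩ α.1) -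
          (∑ i, B26 i j • fun α : Γ.toAddSubgroup => lam ⟨1, i⟩ α.1) -
          (∑ i, B36 (Sum.inl i) j • fun α : Γ.toAddSubgroup => lam ⟨2, i⟩ α.1) -
          (∑ i, B36 (Sum.inr i) j • fun α : Γ.toAddSubgroup => lam ⟨3, i⟩ α.1) -
          ∑ i, B56 i j • (fun α : Γ.toAddSubgroup => α.1 (Sum.inl ⟨4, i⟩)) := by
        ext α
        simp only [Finset.sum_apply, Pi.smul_apply, Pi.sub_apply, smul_eq_mul]
        rw [lam_of_not_lt (show ¬ (5 : Fin 7) < 4 by decide), f6]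
        ring
      rw [e]
      exact sub_mem (sub_mem (sub_mem (sub_mem (sub_mem (hmem _) (hsum 0 (by decide) _))
        (hsum 1 (by decide) _)) (hsum 2 (by decide) _)) (hsum 3 (by decide) _))
        (Submodule.sum_mem _ fun i _ => Submodule.smul_mem _ _ (h4 i))
    rintro ⟨k, i⟩ hq
    have h7 : (fun α : Γ.toAddSubgroup => α.1 (Sum.inl ⟨k, i⟩)) ∈ R := by
      obtain rfl | rfl : k = 4 ∨ k = 5 := hq
      · exact h4 i
      · exact h5 i
    rw [hR, Submodule.mem_span_range_iff_exists_fun] at h7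
    obtain ⟨d, hd⟩ := h7
    refine ⟨d, fun α => ?_⟩
    have := congrFun hd α
    simpa [Finset.sum_apply] using this.symm
  refine ⟨⟨ν, b, hb, ?_, ?_, hlam, ?_, ?_, hlamEx⟩⟩
  · intro p
    have hν0 : ∀ q : {p : Idx ℓ // p.1 < 4}, q ≠ p → sigma F p.1 (Sum.inl q.1) = 0 ∧
        sigma F p.1 (Sum.inr q.1) = 0 := fun q hq =>
      ⟨sigma_inl_of_ne fun h => hq (Subtype.ext h.symm),
        sigma_inr_of_ne fun h => hq (Subtype.ext h.symm)⟩
    have hpair : ∀ q, (τ (sg Γ p.1)).1 (Sum.inl (ν q).1) = sigma F (ν p).1 (Sum.inl (ν q).1) ∧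
        (τ (sg Γ p.1)).1 (Sum.inr (ν q).1) = sigma F (ν p).1 (Sum.inr (ν q).1) := by
      intro q
      by_cases hq : q = p
      · subst hq
        have hx : (sg Γ q.1).1 (Sum.inl q.1) = 1 := sigma_inl_self q.2
        rw [sigma_inl_self (ν q).2]
        by_cases hp1 : q.1.1 = 1
        · have hy : (sg Γ q.1).1 (Sum.inr q.1) = 0 := sigma_inr_self' hp1
          rw [(c1 q hp1 _).1, (c1 q hp1 _).2, hx, hy, sigma_inr_self' ((hν q).trans hp1)]
          simp
        · have hy : (sg Γ q.1).1 (Sum.inr q.1) = 1 := sigma_inr_self q.2 hp1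
          rw [sigma_inr_self (ν q).2 (by rwa [hν])]
          by_cases hp2 : q.1.1 = 2
          · rw [(c2 q hp2 _).1, (c2 q hp2 _).2, hx, hy]; simp
          · rw [(c3 q hp1 hp2 _).1, (c3 q hp1 hp2 _).2, hx, hy]; constructor <;> ring
      · have hne : (ν p).1 ≠ (ν q).1 := fun h => hq (ν.injective (Subtype.ext h)).symm
        rw [sigma_inl_of_ne hne, sigma_inr_of_ne hne]
        exact c0 q _ (hν0 q hq).1 (hν0 q hq).2
    have hinl : ∀ q : Idx ℓ, ¬ q.1 < 4 → (sg Γ p.1).1 (Sum.inl q) = 0 := fun q hq =>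
      sigma_inl_of_ne fun h => hq (h ▸ p.2)
    have hl : ∀ q, lam q (sg Γ p.1).1 = 0 := fun q => lam_sigma p.2
    ext r
    change (τ (sg Γ p.1)).1 r = sigma F (ν p).1 r
    by_cases hg : HasGrading r
    · rcases r with q | q
      · by_cases hq : q.1 < 4
        · simpa using (hpair (ν.symm ⟨q, hq⟩)).1
        · have hne : (ν p).1 ≠ q := fun h => hq (h ▸ (ν p).2)
          rw [sigma_inl_of_ne hne]
          obtain ⟨k, j⟩ := q
          obtain rfl | rfl : k = 4 ∨ k = 5 :=
            (by decide : ∀ k : Fin 7, ¬ k < 4 → k < 6 → k = 4 ∨ k = 5) k hq hg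
          · rw [f5]; simp [hl, hinl]
          · rw [f6]; simp [hl, hinl]
      · simpa using (hpair (ν.symm ⟨q, hg⟩)).2
    · rw [apply_eq_zero Γ' _ hg, ← apply_eq_zero Γ' (sg Γ' (ν p).1) hg]; rfl
  · intro p α β
    simp only [dt]
    by_cases hp1 : p.1.1 = 1
    · rw [(c1 p hp1 α).1, (c1 p hp1 α).2, (c1 p hp1 β).1, (c1 p hp1 β).2]; ring
    · by_cases hp2 : p.1.1 = 2
      · rw [(c2 p hp2 α).1, (c2 p hp2 α).2, (c2 p hp2 β).1, (c2 p hp2 β).2]; ring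
      · rw [(c3 p hp1 hp2 α).1, (c3 p hp1 hp2 α).2, (c3 p hp1 hp2 β).1, (c3 p hp1 hp2 β).2]; ring
  -- This guarantees that writing the image of `t_r` as a combination of the `t_s` loses nothing at
  -- indices `s` where `t_s` is zero.
  · intro r hr s hrd hsd
    have hel : ∀ r', ¬ HasDown r' → (el Γ r hr).1 r' = 0 := fun r' hr' =>
      el_apply_of_ne _ _ fun h => hr' (h ▸ hrd)
    have hps : ∀ p, s = Sum.inl (ν p).1 ∨ s = Sum.inr (ν p).1 → (τ (el Γ r hr)).1 s = 0 := by
      intro p hs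
      have hi : ¬ HasDown (Sum.inr p.1 : J ℓ) := by
        rcases hs with rfl | rfl
        · rw [hasDown_inl_iff, hν] at hsd
          rw [hasDown_inr_iff]
          have := p.2
          revert hsd this
          generalize p.1.1 = k
          revert k; decide
        · rwa [hasDown_inr_iff, hν] at hsd
      by_cases hd : HasDown (Sum.inl p.1 : J ℓ)
      · have hs' : s = Sum.inr (ν p).1 := by
          refine hs.resolve_left ?_
          rintro rfl
          rw [hasDown_inl_iff, hν] at hsd
          exact hsd hd
        have hp0 : p.1.1 = 1 ∨ p.1.1 = 2 := by
          rw [hasDown_inl_iff] at hd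
          rw [hasDown_inr_iff] at hi
          revert hd hi
          generalize p.1.1 = k
          revert k; decide
        rw [hs']
        rcases hp0 with h | h
        · rw [(c1 p h _).2, hel _ hi, mul_zero]
        · rw [(c2 p h _).2, hel _ hi]
      · have := c0 p (el Γ r hr) (hel _ hd) (hel _ hi)
        rcases hs with rfl | rfl
        · exact this.1
        · exact this.2
    rcases s with q | q
    · by_cases hq : q.1 < 4
      · exact hps (ν.symm ⟨q, hq⟩) (Or.inl (by simp))
      · obtain ⟨k, j⟩ := q
        rw [hasDown_inl_iff] at hsd
        obtain rfl : k = 4 :=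
          (by decide : ∀ k : Fin 7, ¬ k < 4 → ¬ (k ≠ 0 ∧ k ≠ 4) → k = 4) k hq hsd
        rw [f5]
        have e0 : ∀ i, lam ⟨0, i⟩ (el Γ r hr).1 = 0 := fun i =>
          lam_eq_zero (hel _ (by simp [hasDown_inl_iff])) (hel _ (by simp [hasDown_inr_iff]))
        have e1 : ∀ i, lam ⟨1, i⟩ (el Γ r hr).1 = 0 := fun i => by
          simp only [lam, if_pos]
          rw [hel _ (by rw [hasDown_inr_iff]; exact (by decide : ¬ (3 : Fin 7) ≤ 1)), neg_zero]
        have e4 : ∀ i, (el Γ r hr).1 (Sum.inl ⟨4, i⟩) = 0 := fun i =>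
          hel _ (by simp [hasDown_inl_iff])
        simp [e0, e1, e4]
    · by_cases hq : q.1 < 4
      · exact hps (ν.symm ⟨q, hq⟩) (Or.inr (by simp))
      · exact apply_eq_zero Γ' _ (r := Sum.inr q) hq
  · intro r
    by_cases hg : HasGrading r
    · rcases r with p | p
      · by_cases hp : p.1 < 4
        -- The functional is a column of the inverse of `A_p`, that is, of its adjugate divided by
        -- the determinant `b p`.
        · refine ⟨(b ⟨p, hp⟩)⁻¹ • (if p.1 = 1 then b ⟨p, hp⟩ • LinearMap.proj (Sum.inl (ν ⟨p, hp⟩).1) -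
            a ⟨p, hp⟩ • LinearMap.proj (Sum.inr (ν ⟨p, hp⟩).1) else if p.1 = 2 then
            LinearMap.proj (Sum.inl (ν ⟨p, hp⟩).1) -
            (1 - b ⟨p, hp⟩) • LinearMap.proj (Sum.inr (ν ⟨p, hp⟩).1) else
            (1 - a ⟨p, hp⟩) • LinearMap.proj (Sum.inl (ν ⟨p, hp⟩).1) -
            (1 - a ⟨p, hp⟩ - b ⟨p, hp⟩) • LinearMap.proj (Sum.inr (ν ⟨p, hp⟩).1)), fun α => ?_⟩
          rw [LinearMap.smul_apply, smul_eq_mul, eq_inv_mul_iff_mul_eq₀ (hb _)]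
          split_ifs with h1 h2
          · simp only [LinearMap.sub_apply, LinearMap.smul_apply, LinearMap.proj_apply, smul_eq_mul]
            rw [(c1 ⟨p, hp⟩ h1 α).1, (c1 ⟨p, hp⟩ h1 α).2]; ring
          · simp only [LinearMap.sub_apply, LinearMap.smul_apply, LinearMap.proj_apply, smul_eq_mul]
            rw [(c2 ⟨p, hp⟩ h2 α).1, (c2 ⟨p, hp⟩ h2 α).2]; ring
          · simp only [LinearMap.sub_apply, LinearMap.smul_apply, LinearMap.proj_apply, smul_eq_mul]
            rw [(c3 ⟨p, hp⟩ h1 h2 α).1, (c3 ⟨p, hp⟩ h1 h2 α).2]; ring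
        · obtain ⟨d, hd⟩ := hlamEx p
            ((by decide : ∀ k : Fin 7, ¬ k < 4 → k < 6 → k = 4 ∨ k = 5) p.1 hp hg)
          exact ⟨∑ p, d p • lamLin p, fun α => by rw [hd]; simp [lamLin_apply]⟩
      · have hp : p.1 < 4 := hg
        refine ⟨(b ⟨p, hp⟩)⁻¹ • (if p.1 = 1 then LinearMap.proj (Sum.inr (ν ⟨p, hp⟩).1)
            else if p.1 = 2 then b ⟨p, hp⟩ • LinearMap.proj (Sum.inr (ν ⟨p, hp⟩).1) else
            (a ⟨p, hp⟩ + b ⟨p, hp⟩) • LinearMap.proj (Sum.inr (ν ⟨p, hp⟩).1) -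
            a ⟨p, hp⟩ • LinearMap.proj (Sum.inl (ν ⟨p, hp⟩).1)), fun α => ?_⟩
        rw [LinearMap.smul_apply, smul_eq_mul, eq_inv_mul_iff_mul_eq₀ (hb _)]
        split_ifs with h1 h2
        · rw [LinearMap.proj_apply, (c1 ⟨p, hp⟩ h1 α).2]
        · rw [LinearMap.smul_apply, LinearMap.proj_apply, (c2 ⟨p, hp⟩ h2 α).2, smul_eq_mul]
        · simp only [LinearMap.sub_apply, LinearMap.smul_apply, LinearMap.proj_apply, smul_eq_mul]
          rw [(c3 ⟨p, hp⟩ h1 h2 α).1, (c3 ⟨p, hp⟩ h1 h2 α).2]; ring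
    · exact ⟨0, fun α => by rw [apply_eq_zero Γ α hg]; rfl⟩

end Preserving

/-- Over an algebraically closed field `Fˣ` is divisible, hence injective as an abelian group. The
homomorphism prescribed on the free subgroup spanned by `s` therefore extends. -/
theorem exists_monoidHom_units_eq {F G : Type*} [Field F] [IsAlgClosed F] [CharZero F]
    [AddCommGroup G] {ι : Type*} [Fintype ι] (s : ι → G) (hs : LinearIndependent ℤ s)
    (b : ι → Fˣ) : ∃ χ : Multiplicative G →* Fˣ, ∀ i, χ (Multiplicative.ofAdd (s i)) = b i := by
  classical
  let _ : DivisibleBy (Additive Fˣ) ℕ := divisibleByOfSMulRightSurj _ _ fun {n} hn a => by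
    obtain ⟨z, hz⟩ := IsAlgClosed.exists_pow_nat_eq ((Additive.toMul a : Fˣ) : F)
      (Nat.pos_of_ne_zero hn)
    have hz0 : z ≠ 0 := by
      rintro rfl
      rw [zero_pow hn] at hz
      exact (Additive.toMul a).ne_zero hz.symm
    refine ⟨Additive.ofMul (Units.mk0 z hz0), ?_⟩
    apply Additive.toMul.injective
    ext
    simpa using hz
  let _ : DivisibleBy (Additive Fˣ) ℤ := AddGroup.divisibleByIntOfDivisibleByNat _
  let f : (ι → ℤ) →ₗ[ℤ] G := Fintype.linearCombination ℤ s
  have hf : Function.Injective f.toAddMonoidHom := by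
    exact linearIndependent_iff_injective_fintypeLinearCombination.1 hs
  let g : (ι → ℤ) →ₗ[ℤ] Additive Fˣ :=
    Fintype.linearCombination ℤ fun i => Additive.ofMul (b i)
  obtain ⟨h, hh⟩ := (Module.Baer.of_divisible (Additive Fˣ)).extension_property_addMonoidHom
    f.toAddMonoidHom hf g.toAddMonoidHom
  refine ⟨AddMonoidHom.toMultiplicativeLeft h, fun i => ?_⟩
  have := DFunLike.congr_fun hh (Pi.single i 1)
  simp [f, g, Fintype.linearCombination_apply_single] at this
  change Additive.toMul (h (s i)) = b i
  rw [this]; rfl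

/-! ### Elements acting by the functionals `lam p`, and brackets computed from gradients. -/

section Preserving

variable {F : Type*} [Field F] {ℓ : Fin 7 → ℕ} {Γ Γ' : AdmissibleSubgroup F ℓ}

theorem linearIndependent_sg [CharZero F] (Γ : AdmissibleSubgroup F ℓ) :
    LinearIndependent ℤ fun p : {p : Idx ℓ // p.1 < 4} => sg Γ p.1 := by
  rw [Fintype.linearIndependent_iff]
  intro n hn p
  have h := congrArg (fun α : Γ.toAddSubgroup => α.1 (Sum.inl p.1)) hn
  simp only [AddSubgroup.val_finsetSum, AddSubgroup.coe_zsmul, Finset.sum_apply, Pi.smul_apply]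
    at h
  rw [Finset.sum_eq_single p] at h
  · have e : (sg Γ p.1).1 (Sum.inl p.1) = 1 := sigma_inl_self p.2
    rw [e] at h
    simpa using h
  · intro q _ hq
    have e : (sg Γ q.1).1 (Sum.inl p.1) = 0 := sigma_inl_of_ne fun h => hq (Subtype.ext h)
    rw [e, smul_zero]
  · simp

/-- An element whose bracket operator is the derivation given by the functional `lam p`; it is
zero if there is no such element. -/
def lamElt (Γ : AdmissibleSubgroup F ℓ) (p : Idx ℓ) : SemigroupAlg Γ :=
  if p.1 < 4 then X Γ (-sg Γ p) else if p.1 = 6 then 0 else -T Γ (Sum.inr p)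

theorem br_X_neg_sg {p : Idx ℓ} (hp : p.1 < 4) (v : SemigroupAlg Γ) :
    br Γ (X Γ (-sg Γ p)) v =
      sigma F p (Sum.inr p) • der Γ (Sum.inl p) v - der Γ (Sum.inr p) v := by
  have hn : ∀ s, (-sg Γ p).1 s = - sigma F p s := fun s => rfl
  rw [br_X, Finset.sum_eq_single p]
  · rw [neg_add_cancel, X_zero, one_mul, hn, hn, sigma_inl_self hp]
    simp only [neg_smul, one_smul]
    abel
  · intro q _ hq
    rw [hn, hn, sigma_inl_of_ne (Ne.symm hq), sigma_inr_of_ne (Ne.symm hq)]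
    simp
  · simp

/-- The hypothesis that all derivatives of `v` are `β_s w` covers `x^β` with `w = v`, and also the
variables `t_r` and their images with `w` a scalar. -/
theorem br_lamElt {p : Idx ℓ} {v w : SemigroupAlg Γ} {β : Γ.toAddSubgroup}
    (h : ∀ s, der Γ s v = β.1 s • w) : br Γ (lamElt Γ p) v = lam p β.1 • w := by
  unfold lamElt
  split_ifs with h1 h2
  · rw [br_X_neg_sg h1, h, h, lam]
    split_ifs with h3
    · rw [sigma_inr_self' h3, neg_smul]; simp
    · rw [sigma_inr_self h1 h3, sub_smul, one_smul]
  · rw [lam_of_not_lt h1, apply_eq_zero Γ β (r := Sum.inl p)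
      (show ¬ p.1 < 6 by rw [h2]; decide)]
    simp
  · rw [map_neg, LinearMap.neg_apply, br_T_inr_of_not_lt h1, h, neg_neg, lam_of_not_lt h1]

theorem br_lamElt_eq_zero {p : Idx ℓ} {v : SemigroupAlg Γ}
    (h : p.1 ≠ 6 → der Γ (Sum.inl p) v = 0) (h' : p.1 < 4 → der Γ (Sum.inr p) v = 0) :
    br Γ (lamElt Γ p) v = 0 := by
  unfold lamElt
  split_ifs with h1 h2
  · rw [br_X_neg_sg h1, h, h' h1]
    · simp
    · intro h; rw [h] at h1; exact absurd h1 (by decide)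
  · simp
  · rw [map_neg, LinearMap.neg_apply, br_T_inr_of_not_lt h1, h h2]; simp

/-- Against `x^{-σ_q}` the eigenvalue is `-lam p σ_q = 0`; against `t_q̄` every derivation involved
vanishes. -/
theorem br_lamElt_lamElt (p q : Idx ℓ) : br Γ (lamElt Γ p) (lamElt Γ q) = 0 := by
  by_cases hq : q.1 < 4
  · have e : lamElt Γ q = X Γ (-sg Γ q) := if_pos hq
    have h0 : lam p (-sg Γ q).1 = 0 := by
      have : (-sg Γ q).1 = - sigma F q := rfl
      rw [this, ← lamLin_apply, map_neg, lamLin_apply, lam_sigma hq, neg_zero]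
    rw [e, br_lamElt (β := -sg Γ q) fun s => der_X Γ s _, h0, zero_smul]
  · refine br_lamElt_eq_zero (fun _ => ?_) fun hp => ?_
    all_goals
      unfold lamElt
      rw [if_neg hq]
      split_ifs
      · simp
    · rw [map_neg, der_T_of_ne Γ (by simp), neg_zero]
    · have : p ≠ q := by rintro rfl; exact hq hp
      rw [map_neg, der_T_of_ne Γ (by simpa using this), neg_zero]

theorem br_lamElt_T {q : Idx ℓ} (hq : q.1 = 6) {s : J ℓ} (hs : s = Sum.inl q ∨ s = Sum.inr q)
    (p : Idx ℓ) : br Γ (lamElt Γ p) (T Γ s) = 0 := by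
  by_cases hp6 : p.1 = 6
  · have : lamElt Γ p = 0 := by
      unfold lamElt
      rw [if_neg (by rw [hp6]; decide), if_pos hp6]
    simp [this]
  · have hpq : p ≠ q := by rintro rfl; exact hp6 hq
    refine br_lamElt_eq_zero (fun _ => ?_) fun hp => ?_
    · apply der_T_of_ne
      rcases hs with rfl | rfl <;> simp [hpq]
    · apply der_T_of_ne
      rcases hs with rfl | rfl <;> simp [hpq]

/-- Up to a scalar, `t_r` has the gradient of a logarithm of `x^{el r}`, so it can be treated
together with the monomials. -/
theorem der_T_of_hasGrading {r : J ℓ} (hd : HasDown r) (hr : HasGrading r) (s : J ℓ) :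
    der Γ s (T Γ r) = (el Γ r hr).1 s • (cf Γ r hr)⁻¹ • 1 := by
  by_cases h : s = r
  · subst h
    rw [der_T_self Γ hd, el_apply_self, smul_smul, mul_inv_cancel₀ (cf_ne_zero Γ s hr), one_smul]
  · rw [der_T_of_ne Γ h, el_apply_of_ne Γ hr h, zero_smul]

theorem br_of_der {u v w z : SemigroupAlg Γ} {α β : J ℓ → F} (hu : ∀ s, der Γ s u = α s • w)
    (hv : ∀ s, der Γ s v = β s • z) :
    br Γ u v = (∑ p, dt p α β • X Γ (sg Γ p)) * (w * z) := by
  rw [br_apply, Finset.sum_mul]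
  refine Finset.sum_congr rfl fun p _ => ?_
  rw [hu, hu, hv, hv, dt]
  simp only [Algebra.smul_def, map_sub, map_mul]
  ring

end Preserving

/-! ### The images of the variables `t_r`. -/

namespace PreservingData

section

variable {F : Type*} [Field F] {ℓ : Fin 7 → ℕ} {Γ Γ' : AdmissibleSubgroup F ℓ}
  {τ : Γ.toAddSubgroup ≃+ Γ'.toAddSubgroup} (D : PreservingData τ)

open Classical in
/-- Coefficients which express the coordinate `α_q` by the functionals `lam p (τ α)`. -/
def lamCoeff (q : Idx ℓ) : Idx ℓ → F :=
  if h : q.1 = 4 ∨ q.1 = 5 then (D.exists_lam q h).choose else 0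

theorem sum_lamCoeff {q : Idx ℓ} (h : q.1 = 4 ∨ q.1 = 5) (α : Γ.toAddSubgroup) :
    ∑ p, D.lamCoeff q p * lam p (τ α).1 = α.1 (Sum.inl q) := by
  rw [lamCoeff, dif_pos h]
  exact ((D.exists_lam q h).choose_spec α).symm

open Classical in
/-- The linear part of the image of the variable `t_r`. -/
def row (D : PreservingData τ) (r : J ℓ) : J ℓ → F :=
  if h : HasDown r ∧ HasGrading r then (cf Γ r h.2)⁻¹ • (τ (el Γ r h.2)).1
  else match r with
    | Sum.inl q => Pi.single (Sum.inl q) 1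
    | Sum.inr q => if q.1 = 4 ∨ q.1 = 5 then
        Sum.elim (fun _ => 0) fun p => if p.1 = 4 ∨ p.1 = 5 then D.lamCoeff q p else 0
      else Pi.single (Sum.inr q) 1

/-- The part of the image of the variable `t_r` in the group algebra of `Γ'`. -/
def remainder (D : PreservingData τ) : J ℓ → SemigroupAlg Γ'
  | Sum.inl _ => 0
  | Sum.inr q => if q.1 = 4 ∨ q.1 = 5 then
      - ∑ p : {p : Idx ℓ // p.1 < 4}, D.lamCoeff q p.1 • X Γ' (-sg Γ' p.1) else 0

/-- The image of the variable `t_r`. -/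
def image (r : J ℓ) : SemigroupAlg Γ' := ∑ s, D.row r s • T Γ' s + D.remainder r

theorem row_of_hasGrading {r : J ℓ} (hd : HasDown r) (hr : HasGrading r) :
    D.row r = (cf Γ r hr)⁻¹ • (τ (el Γ r hr)).1 := dif_pos ⟨hd, hr⟩

theorem row_inr {q : Idx ℓ} (h : q.1 = 4 ∨ q.1 = 5) : D.row (Sum.inr q) =
    Sum.elim (fun _ => 0) fun p => if p.1 = 4 ∨ p.1 = 5 then D.lamCoeff q p else 0 := by
  have : ¬ (HasDown (Sum.inr q : J ℓ) ∧ HasGrading (Sum.inr q : J ℓ)) := by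
    rintro ⟨-, h'⟩
    have : q.1 < 4 := h'
    rcases h with h | h <;> rw [h] at this <;> exact absurd this (by decide)
  rw [row, dif_neg this]
  exact if_pos h

theorem row_of_other {r : J ℓ} (h : ¬ (HasDown r ∧ HasGrading r))
    (h' : ∀ q : Idx ℓ, q.1 = 4 ∨ q.1 = 5 → r ≠ Sum.inr q) : D.row r = Pi.single r 1 := by
  rw [row, dif_neg h]
  rcases r with q | q
  · rfl
  · exact if_neg fun hq => h' q hq rfl

theorem remainder_eq_zero {r : J ℓ} (h' : ∀ q : Idx ℓ, q.1 = 4 ∨ q.1 = 5 → r ≠ Sum.inr q) :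
    D.remainder r = 0 := by
  rcases r with q | q
  · rfl
  · exact if_neg fun hq => h' q hq rfl

theorem ne_inr_of_hasGrading {r : J ℓ} (hr : HasGrading r) (q : Idx ℓ) (hq : q.1 = 4 ∨ q.1 = 5) :
    r ≠ Sum.inr q := by
  rintro rfl
  have : q.1 < 4 := hr
  rcases hq with h | h <;> rw [h] at this <;> exact absurd this (by decide)

theorem remainder_mem (r : J ℓ) : D.remainder r ∈ Submodule.span F (Set.range (X Γ')) := by
  unfold remainder
  rcases r with q | q
  · exact zero_mem _
  · change (if q.1 = 4 ∨ q.1 = 5 then _ else (0 : SemigroupAlg Γ')) ∈ _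
    split_ifs
    · exact neg_mem (Submodule.sum_mem _ fun p _ =>
        Submodule.smul_mem _ _ (Submodule.subset_span ⟨_, rfl⟩))
    · exact zero_mem _

/-- The combination of the `lamElt Γ' p` splits by block: `x^{-σ_p}` for `p ∈ I_{1,4}` goes into the
remainder, `-t_p̄` for `p ∈ I_{5,6}` into the linear part, and `I_7` contributes nothing. -/
theorem image_inr {q : Idx ℓ} (h : q.1 = 4 ∨ q.1 = 5) :
    D.image (Sum.inr q) = - ∑ p, D.lamCoeff q p • lamElt Γ' p := by
  have h1 : ∑ p : {p : Idx ℓ // p.1 < 4}, D.lamCoeff q p.1 • X Γ' (-sg Γ' p.1) =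
      ∑ p, if p.1 < 4 then D.lamCoeff q p • X Γ' (-sg Γ' p) else 0 := by
    rw [← Finset.sum_filter]
    exact (Finset.sum_subtype _ (by simp) fun p => D.lamCoeff q p • X Γ' (-sg Γ' p)).symm
  have h2 : D.remainder (Sum.inr q) = _ := if_pos h
  rw [image, D.row_inr h, h2, h1, Fintype.sum_sum_type]
  simp only [Sum.elim_inl, Sum.elim_inr, zero_smul, Finset.sum_const_zero, zero_add]
  rw [← Finset.sum_neg_distrib, ← Finset.sum_neg_distrib, ← Finset.sum_add_distrib]
  refine Finset.sum_congr rfl fun p _ => ?_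
  unfold lamElt
  have : p.1 < 4 ∧ ¬ (p.1 = 4 ∨ p.1 = 5) ∧ p.1 ≠ 6 ∨ ¬ p.1 < 4 ∧ (p.1 = 4 ∨ p.1 = 5) ∧ p.1 ≠ 6 ∨
      ¬ p.1 < 4 ∧ ¬ (p.1 = 4 ∨ p.1 = 5) ∧ p.1 = 6 :=
    (by decide : ∀ k : Fin 7, k < 4 ∧ ¬ (k = 4 ∨ k = 5) ∧ k ≠ 6 ∨
      ¬ k < 4 ∧ (k = 4 ∨ k = 5) ∧ k ≠ 6 ∨ ¬ k < 4 ∧ ¬ (k = 4 ∨ k = 5) ∧ k = 6) p.1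
  obtain ⟨a, b, c⟩ | ⟨a, b, c⟩ | ⟨a, b, c⟩ := this <;> simp only [a, b, c, if_true, if_false] <;> simp

theorem image_of_other {r : J ℓ} (h : ¬ (HasDown r ∧ HasGrading r))
    (h' : ∀ q : Idx ℓ, q.1 = 4 ∨ q.1 = 5 → r ≠ Sum.inr q) : D.image r = T Γ' r := by
  rw [image, D.row_of_other h h', D.remainder_eq_zero h', add_zero, Finset.sum_eq_single r]
  · simp
  · intro s _ hs; simp [hs]
  · simp

/-- The image of the logarithm of `x^{el r}` has the gradient of a logarithm of `x^{τ (el r)}`; at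
indices `s` without `t_s` both sides vanish by `map_down`. -/
theorem der_image {r : J ℓ} (hd : HasDown r) (hr : HasGrading r) (s : J ℓ) :
    der Γ' s (D.image r) = (τ (el Γ r hr)).1 s • (cf Γ r hr)⁻¹ • 1 := by
  rw [image, D.remainder_eq_zero (ne_inr_of_hasGrading hr), D.row_of_hasGrading hd hr, add_zero,
    map_sum, Finset.sum_eq_single s]
  · rw [map_smul]
    by_cases hs : HasDown s
    · rw [der_T_self Γ' hs, Pi.smul_apply, smul_eq_mul, mul_comm, smul_smul]
    · rw [Pi.smul_apply, D.map_down r hr s hd hs]; simp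
  · intro s' _ hs'
    rw [map_smul, der_T_of_ne Γ' (Ne.symm hs'), smul_zero]
  · simp

theorem image_cases (r : J ℓ) (hd : HasDown r) : HasGrading r ∨
    (∃ q : Idx ℓ, (q.1 = 4 ∨ q.1 = 5) ∧ r = Sum.inr q) ∨
    ¬ HasGrading r ∧ ∃ q : Idx ℓ, q.1 = 6 ∧ (r = Sum.inl q ∨ r = Sum.inr q) := by
  by_cases hr : HasGrading r
  · exact Or.inl hr
  refine Or.inr ?_
  rcases r with q | q
  · refine Or.inr ⟨hr, q, ?_, Or.inl rfl⟩
    exact (by decide : ∀ k : Fin 7, ¬ k < 6 → k = 6) q.1 hr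
  · rcases (by decide : ∀ k : Fin 7, ¬ k < 4 → (k = 4 ∨ k = 5) ∨ k = 6) q.1 hr with h | h
    · exact Or.inl ⟨q, h, rfl⟩
    · exact Or.inr ⟨hr, q, h, Or.inr rfl⟩

end

end PreservingData

/-! ### Invertibility of the linear part. -/

namespace PreservingData

variable {F : Type*} [Field F] {ℓ : Fin 7 → ℕ} {Γ Γ' : AdmissibleSubgroup F ℓ}
  {τ : Γ.toAddSubgroup ≃+ Γ'.toAddSubgroup} (D : PreservingData τ)

theorem row_cases (r : J ℓ) : (HasDown r ∧ HasGrading r) ∨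
    (∃ q : Idx ℓ, (q.1 = 4 ∨ q.1 = 5) ∧ r = Sum.inr q) ∨
    ¬ (HasDown r ∧ HasGrading r) ∧ ∀ q : Idx ℓ, q.1 = 4 ∨ q.1 = 5 → r ≠ Sum.inr q := by
  by_cases h : HasDown r ∧ HasGrading r
  · exact Or.inl h
  · by_cases h' : ∃ q : Idx ℓ, (q.1 = 4 ∨ q.1 = 5) ∧ r = Sum.inr q
    · exact Or.inr (Or.inl h')
    · exact Or.inr (Or.inr ⟨h, fun q hq e => h' ⟨q, hq, e⟩⟩)

theorem row_inr_apply_eq_zero {q : Idx ℓ} (h : q.1 = 4 ∨ q.1 = 5) {s : J ℓ}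
    (hs : ∀ q : Idx ℓ, q.1 = 4 ∨ q.1 = 5 → s ≠ Sum.inr q) : D.row (Sum.inr q) s = 0 := by
  rw [D.row_inr h]
  rcases s with p | p
  · rfl
  · exact if_neg fun hp => hs p hp rfl

theorem apply_eq_zero_of_hasGrading (D : PreservingData τ) {r : J ℓ} (hd : HasDown r) (hr : HasGrading r) {s : J ℓ}
    (hs : ¬ (HasDown s ∧ HasGrading s)) : (τ (el Γ r hr)).1 s = 0 := by
  by_cases h : HasDown s
  · exact apply_eq_zero Γ' _ fun h' => hs ⟨h, h'⟩
  · exact D.map_down r hr s hd h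

/-- The rows in question are multiples of the `τ (el r)`, so the relation is an `F`-linear relation
between these vectors. The linear functional that recovers the coordinate `r` of `α` from `τ α`
isolates the coefficient `y r`. -/
theorem eq_zero_of_sum_row_of_hasGrading {y : J ℓ → F} (hy : ∀ s, ∑ r, y r * D.row r s = 0)
    {r : J ℓ} (hd : HasDown r) (hr : HasGrading r) : y r = 0 := by
  classical
  let e : J ℓ → Γ.toAddSubgroup := fun r =>
    if h : HasDown r ∧ HasGrading r then el Γ r h.2 else 0
  let c : J ℓ → F := fun r =>
    if h : HasDown r ∧ HasGrading r then y r * (cf Γ r h.2)⁻¹ else 0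
  have he : ∀ r (h : HasDown r ∧ HasGrading r), e r = el Γ r h.2 := fun r h => dif_pos h
  have hc : ∀ r (h : HasDown r ∧ HasGrading r), c r = y r * (cf Γ r h.2)⁻¹ := fun r h => dif_pos h
  have hc0 : ∀ r, ¬ (HasDown r ∧ HasGrading r) → c r = 0 := fun r h => dif_neg h
  have hz : ∑ r, c r • (τ (e r)).1 = 0 := by
    ext s
    rw [Finset.sum_apply]
    by_cases hs : HasDown s ∧ HasGrading s
    · rw [Pi.zero_apply, ← hy s]
      refine Finset.sum_congr rfl fun r _ => ?_
      by_cases h : HasDown r ∧ HasGrading r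
      · rw [hc r h, he r h, D.row_of_hasGrading h.1 h.2]
        simp only [Pi.smul_apply, smul_eq_mul]; ring
      · have : D.row r s = 0 := by
          rcases row_cases r with h1 | ⟨q, hq, rfl⟩ | ⟨-, h1⟩
          · exact absurd h1 h
          · exact D.row_inr_apply_eq_zero hq (ne_inr_of_hasGrading hs.2)
          · rw [D.row_of_other h h1, Pi.single_eq_of_ne]
            rintro rfl
            exact h hs
        rw [hc0 r h, this]; simp
    · refine Finset.sum_eq_zero fun r _ => ?_
      by_cases h : HasDown r ∧ HasGrading r
      · rw [he r h, Pi.smul_apply, D.apply_eq_zero_of_hasGrading h.1 h.2 hs, smul_zero]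
      · rw [hc0 r h]; simp
  obtain ⟨n, hn⟩ := D.exists_linear r
  have h1 := congrArg n hz
  rw [map_sum, map_zero, Finset.sum_eq_single r] at h1
  · rw [map_smul, ← hn, he r ⟨hd, hr⟩, hc r ⟨hd, hr⟩, el_apply_self, smul_eq_mul, mul_assoc,
      inv_mul_cancel₀ (cf_ne_zero Γ r hr), mul_one] at h1
    exact h1
  · intro r' _ hr'
    by_cases h : HasDown r' ∧ HasGrading r'
    · rw [map_smul, ← hn, he r' h, el_apply_of_ne Γ h.2 (Ne.symm hr'), smul_zero]
    · rw [hc0 r' h, zero_smul, map_zero]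
  · simp

/-- The matrix is block diagonal in three groups of indices: mixed type, `Ī_{5,6}`, and the rest,
where it is the identity. Only the block of the `lamCoeff` on `Ī_{5,6}` remains after the mixed one.
-/
theorem eq_zero_of_sum_row {y : J ℓ → F} (hy : ∀ s, ∑ r, y r * D.row r s = 0) : y = 0 := by
  have hg : ∀ r, HasDown r → HasGrading r → y r = 0 := fun r =>
    D.eq_zero_of_sum_row_of_hasGrading hy
  have ho : ∀ r, ¬ (HasDown r ∧ HasGrading r) →
      (∀ q : Idx ℓ, q.1 = 4 ∨ q.1 = 5 → r ≠ Sum.inr q) → y r = 0 := by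
    intro s hs hs'
    have h1 := hy s
    rw [Finset.sum_eq_single s] at h1
    · rwa [D.row_of_other hs hs', Pi.single_eq_same, mul_one] at h1
    · intro r _ hrs
      rcases row_cases r with h | ⟨q, hq, rfl⟩ | ⟨h, h'⟩
      · rw [hg r h.1 h.2, zero_mul]
      · rw [D.row_inr_apply_eq_zero hq hs', mul_zero]
      · rw [D.row_of_other h h', Pi.single_eq_of_ne (Ne.symm hrs), mul_zero]
    · simp
  have hy0 : ∀ r, (∀ q : Idx ℓ, q.1 = 4 ∨ q.1 = 5 → r ≠ Sum.inr q) → y r = 0 := by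
    intro r hr
    by_cases h : HasDown r ∧ HasGrading r
    · exact hg r h.1 h.2
    · exact ho r h hr
  have hcol : ∀ p : Idx ℓ, p.1 = 4 ∨ p.1 = 5 → ∑ q, y (Sum.inr q) * D.lamCoeff q p = 0 := by
    intro p hp
    have hl : ∑ q, y (Sum.inl q) * D.row (Sum.inl q) (Sum.inr p) = 0 :=
      Finset.sum_eq_zero fun q _ => by rw [hy0 (Sum.inl q) (by simp), zero_mul]
    have hr := hy (Sum.inr p)
    rw [Fintype.sum_sum_type, hl, zero_add] at hr
    rw [← hr]
    refine Finset.sum_congr rfl fun q _ => ?_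
    by_cases hq : q.1 = 4 ∨ q.1 = 5
    · rw [D.row_inr hq, Sum.elim_inr, if_pos hp]
    · rw [hy0 (Sum.inr q) fun q' hq' h => hq (Sum.inr.inj h ▸ hq'), zero_mul, zero_mul]
  ext r
  by_cases h : ∃ q : Idx ℓ, (q.1 = 4 ∨ q.1 = 5) ∧ r = Sum.inr q
  · obtain ⟨q₀, hq₀, rfl⟩ := h
    have hgr : HasGrading (Sum.inl q₀ : J ℓ) :=
      (by decide : ∀ k : Fin 7, k = 4 ∨ k = 5 → k < 6) q₀.1 hq₀
    set α := el Γ (Sum.inl q₀) hgr with hα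
    have h1 : ∑ q, y (Sum.inr q) * α.1 (Sum.inl q) = y (Sum.inr q₀) * cf Γ _ hgr := by
      rw [Finset.sum_eq_single q₀]
      · rw [hα, el_apply_self]
      · intro q _ hq
        rw [hα, el_apply_of_ne Γ hgr (by simpa using hq), mul_zero]
      · simp
    -- Expand `α_q` by the functionals `lam p (τ α)`. Those of `I_{1,4}` vanish because `α` is
    -- supported in `q₀`, those of `I_{5,6}` have coefficient zero by `hcol`, and those of `I_7`
    -- vanish on `Γ'`.
    have h2 : ∑ q, y (Sum.inr q) * α.1 (Sum.inl q) = 0 := by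
      have : ∀ q, y (Sum.inr q) * α.1 (Sum.inl q) =
          ∑ p, y (Sum.inr q) * D.lamCoeff q p * lam p (τ α).1 := by
        intro q
        by_cases hq : q.1 = 4 ∨ q.1 = 5
        · rw [← D.sum_lamCoeff hq, Finset.mul_sum]
          exact Finset.sum_congr rfl fun p _ => by ring
        · rw [hy0 (Sum.inr q) fun q' hq' h => hq (Sum.inr.inj h ▸ hq')]
          simp
      rw [Finset.sum_congr rfl fun q _ => this q, Finset.sum_comm]
      refine Finset.sum_eq_zero fun p _ => ?_
      rw [← Finset.sum_mul]
      rcases (by decide : ∀ k : Fin 7, k < 4 ∨ (k = 4 ∨ k = 5) ∨ k = 6) p.1 with hp | hp | hp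
      · have h3 := D.lam_map (D.ν.symm ⟨p, hp⟩) α
        rw [Equiv.apply_symm_apply] at h3
        have hne : ∀ q : {p : Idx ℓ // p.1 < 4}, q.1 ≠ q₀ := by
          rintro q rfl
          exact absurd hq₀ ((by decide : ∀ k : Fin 7, k < 4 → ¬ (k = 4 ∨ k = 5)) _ q.2)
        rw [h3, lam_eq_zero (el_apply_of_ne Γ hgr (by simpa using hne _))
          (el_apply_of_ne Γ hgr (by simp)), mul_zero, mul_zero]
      · rw [hcol p hp, zero_mul]
      · rw [lam_of_not_lt (by rw [hp]; decide), apply_eq_zero Γ' _ (r := Sum.inl p)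
          (show ¬ p.1 < 6 by rw [hp]; decide), mul_zero]
    rw [h1] at h2
    exact (mul_eq_zero.1 h2).resolve_right (cf_ne_zero Γ _ hgr)
  · exact hy0 r fun q hq e => h ⟨q, hq, e⟩

theorem isUnit_row : IsUnit (Matrix.of D.row) := by
  rw [← Matrix.vecMul_injective_iff_isUnit]
  refine (injective_iff_map_eq_zero (Matrix.vecMulLinear (Matrix.of D.row))).2 fun y hy => ?_
  exact D.eq_zero_of_sum_row fun s => congrFun hy s

end PreservingData

/-! ### Homomorphisms determined on generators. -/

section

variable {F : Type*} [Field F] {ℓ : Fin 7 → ℕ} {Γ Γ' : AdmissibleSubgroup F ℓ}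

/-- The homomorphism `α ↦ χ(α) x^{τ(α)}`. -/
def twistedX (τ : Γ.toAddSubgroup ≃+ Γ'.toAddSubgroup)
    (χ : Multiplicative Γ.toAddSubgroup →* Fˣ) :
    Multiplicative Γ.toAddSubgroup →* SemigroupAlg Γ' where
  toFun α := (χ α : F) • X Γ' (τ α.toAdd)
  map_one' := by simp [X_zero]
  map_mul' α β := by
    rw [map_mul, toAdd_mul, map_add, X_add, Units.val_mul, smul_mul_smul_comm]

theorem liftHom_eq_of_mem_span {B : Type*} [CommRing B] [Algebra F B]
    (g : Multiplicative Γ.toAddSubgroup →* B) (t t' : J ℓ → B) {w : SemigroupAlg Γ}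
    (hw : w ∈ Submodule.span F (Set.range (X Γ))) : liftHom Γ g t w = liftHom Γ g t' w := by
  have : Set.EqOn (liftHom Γ g t).toLinearMap (liftHom Γ g t').toLinearMap
      (Submodule.span F (Set.range (X Γ))) := by
    refine LinearMap.eqOn_span ?_
    rintro _ ⟨α, rfl⟩
    simp [liftHom_X]
  exact this hw

theorem sum_smul_sum_smul {ι κ V : Type*} [Fintype ι] [Fintype κ] [AddCommGroup V] [Module F V]
    (A : ι → F) (B : ι → κ → F) (x : κ → V) :
    ∑ s, A s • ∑ k, B s k • x k = ∑ k, (∑ s, A s * B s k) • x k := by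
  simp only [Finset.smul_sum, Finset.sum_smul, smul_smul]
  exact Finset.sum_comm

/-- For a multiplicative `φ` both sides obey the same Leibniz rule in each argument. -/
theorem map_br_of_generators (φ : SemigroupAlg Γ →ₐ[F] SemigroupAlg Γ') {S : Set (SemigroupAlg Γ)}
    (hS : Algebra.adjoin F S = ⊤)
    (h : ∀ u ∈ S, ∀ v ∈ S, φ (br Γ u v) = br Γ' (φ u) (φ v)) (u v : SemigroupAlg Γ) :
    φ (br Γ u v) = br Γ' (φ u) (φ v) := by
  have step : ∀ u, (∀ v ∈ S, φ (br Γ u v) = br Γ' (φ u) (φ v)) →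
      ∀ v, φ (br Γ u v) = br Γ' (φ u) (φ v) := by
    intro u hu v
    have hv : v ∈ Algebra.adjoin F S := by rw [hS]; trivial
    induction hv using Algebra.adjoin_induction with
    | mem v hv => exact hu v hv
    | algebraMap c =>
      simp only [Algebra.algebraMap_eq_smul_one, map_smul, map_one, br_one_right, smul_zero,
        map_zero]
    | add v w _ _ hv hw => simp only [map_add, hv, hw]
    | mul v w _ _ hv hw => simp only [map_add, map_mul, br_mul_right, hv, hw]
  refine step u (fun w hw => ?_) v
  rw [br_skew, map_neg, step w (h w hw) u, br_skew Γ' (φ u)]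

end

/-! ### The isomorphism attached to a preserving map. -/

namespace PreservingData

variable {F : Type*} [Field F] {ℓ : Fin 7 → ℕ} {Γ Γ' : AdmissibleSubgroup F ℓ}
  {τ : Γ.toAddSubgroup ≃+ Γ'.toAddSubgroup} (D : PreservingData τ)
  {χ : Multiplicative Γ.toAddSubgroup →* Fˣ}

/-- The algebra homomorphism attached to a preserving isomorphism and a character. -/
def hom (χ : Multiplicative Γ.toAddSubgroup →* Fˣ) : SemigroupAlg Γ →ₐ[F] SemigroupAlg Γ' :=
  liftHom Γ (twistedX τ χ) D.image

theorem hom_X (α : Γ.toAddSubgroup) :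
    D.hom χ (X Γ α) = (χ (Multiplicative.ofAdd α) : F) • X Γ' (τ α) := liftHom_X Γ _ _ α

theorem hom_T {r : J ℓ} (hr : HasDown r) : D.hom χ (T Γ r) = D.image r := liftHom_T Γ _ _ hr

theorem hom_T_eq_image (r : J ℓ) : D.hom χ (T Γ r) = D.image r := by
  by_cases hr : HasDown r
  · exact D.hom_T hr
  · rw [T_of_not_hasDown Γ hr, map_zero, D.image_of_other (fun h => hr h.1),
      T_of_not_hasDown Γ' hr]
    rintro q hq rfl
    exact hr ((by decide : ∀ k : Fin 7, k = 4 ∨ k = 5 → 3 ≤ k) q.1 hq)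

theorem row_apply_eq_zero {r s : J ℓ} (hr : HasDown r) (hs : ¬ HasDown s) : D.row r s = 0 := by
  rcases row_cases r with h | ⟨q, hq, rfl⟩ | ⟨h, h'⟩
  · rw [D.row_of_hasGrading h.1 h.2, Pi.smul_apply, D.map_down r h.2 s hr hs, smul_zero]
  · refine D.row_inr_apply_eq_zero hq ?_
    rintro q' hq' rfl
    exact hs ((by decide : ∀ k : Fin 7, k = 4 ∨ k = 5 → 3 ≤ k) q'.1 hq')
  · rw [D.row_of_other h h', Pi.single_eq_of_ne]
    rintro rfl
    exact hs hr

/-- This is where the character is needed: `χ(σ_p) = b_p` supplies the determinant by which `τ`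
scales the form `dt p`. -/
theorem hom_sum_dt (hχ : ∀ p : {p : Idx ℓ // p.1 < 4},
      (χ (Multiplicative.ofAdd (sg Γ p.1)) : F) = D.b p) (α β : Γ.toAddSubgroup) :
    D.hom χ (∑ p, dt p α.1 β.1 • X Γ (sg Γ p)) =
      ∑ p, dt p (τ α).1 (τ β).1 • X Γ' (sg Γ' p) := by
  have h : ∀ (Δ : AdmissibleSubgroup F ℓ) (α β : Δ.toAddSubgroup),
      ∑ p, dt p α.1 β.1 • X Δ (sg Δ p) =
        ∑ p : {p : Idx ℓ // p.1 < 4}, dt p.1 α.1 β.1 • X Δ (sg Δ p.1) := by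
    intro Δ α β
    rw [← Finset.sum_filter_of_ne (p := fun p : Idx ℓ => p.1 < 4)]
    · exact Finset.sum_subtype _ (by simp) fun p : Idx ℓ => dt p α.1 β.1 • X Δ (sg Δ p)
    · intro p _ hp
      by_contra hlt
      exact hp (by rw [dt_eq_zero α β hlt, zero_smul])
  rw [h, h, map_sum, ← Equiv.sum_comp D.ν fun p => dt p.1 (τ α).1 (τ β).1 • X Γ' (sg Γ' p.1)]
  refine Finset.sum_congr rfl fun p _ => ?_
  rw [map_smul, hom_X, hχ, D.map_sg, D.dt_map, smul_smul, mul_comm]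

theorem hom_br_of_der (hχ : ∀ p : {p : Idx ℓ // p.1 < 4},
      (χ (Multiplicative.ofAdd (sg Γ p.1)) : F) = D.b p) {α β : Γ.toAddSubgroup}
    {u v w z : SemigroupAlg Γ} (hu : ∀ s, der Γ s u = α.1 s • w)
    (hu' : ∀ s, der Γ' s (D.hom χ u) = (τ α).1 s • D.hom χ w)
    (hv : ∀ s, der Γ s v = β.1 s • z)
    (hv' : ∀ s, der Γ' s (D.hom χ v) = (τ β).1 s • D.hom χ z) :
    D.hom χ (br Γ u v) = br Γ' (D.hom χ u) (D.hom χ v) := by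
  rw [br_of_der hu hv, br_of_der hu' hv', map_mul, D.hom_sum_dt hχ, map_mul]

theorem br_image_inr {q : Idx ℓ} (h : q.1 = 4 ∨ q.1 = 5) (v : SemigroupAlg Γ') :
    br Γ' (D.image (Sum.inr q)) v = - ∑ p, D.lamCoeff q p • br Γ' (lamElt Γ' p) v := by
  rw [D.image_inr h]
  simp [LinearMap.sum_apply]

/-- The variable `t_q̄` acts on `u` by `-α_q`, and the expansion of `α_q` by the `lam p (τ α)` is
the action of its image. -/
theorem hom_br_inr (χ : Multiplicative Γ.toAddSubgroup →* Fˣ) {q : Idx ℓ}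
    (h : q.1 = 4 ∨ q.1 = 5) {α : Γ.toAddSubgroup}
    {u w : SemigroupAlg Γ} (hu : ∀ s, der Γ s u = α.1 s • w)
    (hu' : ∀ s, der Γ' s (D.hom χ u) = (τ α).1 s • D.hom χ w) :
    D.hom χ (br Γ (T Γ (Sum.inr q)) u) =
      br Γ' (D.hom χ (T Γ (Sum.inr q))) (D.hom χ u) := by
  have hd := (by decide : ∀ k : Fin 7, k = 4 ∨ k = 5 → ¬ k < 4 ∧ 3 ≤ k) q.1 h
  rw [br_T_inr_of_not_lt hd.1, D.hom_T (r := Sum.inr q) hd.2, D.br_image_inr h, hu, map_neg, map_smul,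
    ← D.sum_lamCoeff h, Finset.sum_smul]
  congr 1
  refine Finset.sum_congr rfl fun p _ => ?_
  rw [br_lamElt hu', smul_smul]

/-- The generators of the first algebra, with their images. -/
theorem generator_cases {u : SemigroupAlg Γ}
    (hu : u ∈ Set.range (X Γ) ∪ T Γ '' {r : J ℓ | HasDown r})
    (χ : Multiplicative Γ.toAddSubgroup →* Fˣ) :
    (∃ (α : Γ.toAddSubgroup) (w : SemigroupAlg Γ), (∀ s, der Γ s u = α.1 s • w) ∧
      ∀ s, der Γ' s (D.hom χ u) = (τ α).1 s • D.hom χ w) ∨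
    (∃ q : Idx ℓ, (q.1 = 4 ∨ q.1 = 5) ∧ u = T Γ (Sum.inr q)) ∨
    ∃ (q : Idx ℓ) (r : J ℓ), q.1 = 6 ∧ (r = Sum.inl q ∨ r = Sum.inr q) ∧ u = T Γ r ∧
      D.hom χ u = T Γ' r := by
  rcases hu with ⟨α, rfl⟩ | ⟨r, hr, rfl⟩
  · refine Or.inl ⟨α, X Γ α, fun s => der_X Γ s α, fun s => ?_⟩
    rw [hom_X, map_smul, der_X, smul_comm]
  · have hd : HasDown r := hr
    rcases image_cases r hd with h | ⟨q, hq, rfl⟩ | ⟨hg, q, hq, hrq⟩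
    · refine Or.inl ⟨el Γ r h, (cf Γ r h)⁻¹ • 1, der_T_of_hasGrading hd h, fun s => ?_⟩
      rw [D.hom_T hd, D.der_image hd h, map_smul, map_one]
    · exact Or.inr (Or.inl ⟨q, hq, rfl⟩)
    · refine Or.inr (Or.inr ⟨q, r, hq, hrq, rfl, ?_⟩)
      rw [D.hom_T hd, D.image_of_other fun h => hg h.2]
      rintro q' hq' rfl
      obtain rfl : q' = q := by simpa using hrq
      rw [hq] at hq'
      exact absurd hq' (by decide)

theorem br_T_of_der {Δ : AdmissibleSubgroup F ℓ} {q : Idx ℓ} (hq : q.1 = 6) {r : J ℓ}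
    (hr : r = Sum.inl q ∨ r = Sum.inr q) {v w : SemigroupAlg Δ} {β : Δ.toAddSubgroup}
    (h : ∀ s, der Δ s v = β.1 s • w) : br Δ (T Δ r) v = 0 := by
  have hg : ¬ HasGrading (Sum.inl q : J ℓ) ∧ ¬ HasGrading (Sum.inr q : J ℓ) :=
    (by decide : ∀ k : Fin 7, k = 6 → ¬ k < 6 ∧ ¬ k < 4) q.1 hq
  rcases hr with rfl | rfl
  · rw [br_T_inl Δ (hasDown_of_not_hasGrading hg.1), h, apply_eq_zero Δ β hg.2]; simp
  · rw [br_T_inr Δ (hasDown_of_not_hasGrading hg.2), h, apply_eq_zero Δ β hg.1]; simp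

theorem br_T_T_eq {q : Idx ℓ} (hq : q.1 = 6) {r s : J ℓ}
    (hr : r = Sum.inl q ∨ r = Sum.inr q) : ∃ c : F, ∀ Δ : AdmissibleSubgroup F ℓ,
      br Δ (T Δ r) (T Δ s) = c • 1 := by
  have hg : ¬ HasGrading (Sum.inl q : J ℓ) ∧ ¬ HasGrading (Sum.inr q : J ℓ) :=
    (by decide : ∀ k : Fin 7, k = 6 → ¬ k < 6 ∧ ¬ k < 4) q.1 hq
  have hs : ∀ Δ : AdmissibleSubgroup F ℓ, sg Δ q = 0 := fun Δ =>
    sg_eq_zero Δ (by rw [hq]; decide)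
  rcases hr with rfl | rfl
  · by_cases h : s = Sum.inr q
    · refine ⟨1, fun Δ => ?_⟩
      subst h
      rw [br_T_inl Δ (hasDown_of_not_hasGrading hg.1),
        der_T_self Δ (hasDown_of_not_hasGrading hg.2), hs, X_zero, one_mul, one_smul]
    · refine ⟨0, fun Δ => ?_⟩
      rw [br_T_inl Δ (hasDown_of_not_hasGrading hg.1), der_T_of_ne Δ (Ne.symm h)]; simp
  · by_cases h : s = Sum.inl q
    · refine ⟨-1, fun Δ => ?_⟩
      subst h
      rw [br_T_inr Δ (hasDown_of_not_hasGrading hg.2),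
        der_T_self Δ (hasDown_of_not_hasGrading hg.1), hs, X_zero, one_mul, neg_smul, one_smul]
    · refine ⟨0, fun Δ => ?_⟩
      rw [br_T_inr Δ (hasDown_of_not_hasGrading hg.2), der_T_of_ne Δ (Ne.symm h)]; simp

theorem hom_br (hχ : ∀ p : {p : Idx ℓ // p.1 < 4},
      (χ (Multiplicative.ofAdd (sg Γ p.1)) : F) = D.b p) (u v : SemigroupAlg Γ) :
    D.hom χ (br Γ u v) = br Γ' (D.hom χ u) (D.hom χ v) := by
  refine map_br_of_generators _ (adjoin_eq_top Γ) (fun u hu v hv => ?_) u v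
  have comm : ∀ u v, D.hom χ (br Γ u v) = br Γ' (D.hom χ u) (D.hom χ v) →
      D.hom χ (br Γ v u) = br Γ' (D.hom χ v) (D.hom χ u) := by
    intro u v h
    rw [br_skew, map_neg, h, br_skew Γ' (D.hom χ v)]
  have h56 : ∀ q q' : Idx ℓ, (q.1 = 4 ∨ q.1 = 5) → (q'.1 = 4 ∨ q'.1 = 5) →
      D.hom χ (br Γ (T Γ (Sum.inr q)) (T Γ (Sum.inr q'))) =
        br Γ' (D.hom χ (T Γ (Sum.inr q))) (D.hom χ (T Γ (Sum.inr q'))) := by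
    intro q q' hq hq'
    have hd := (by decide : ∀ k : Fin 7, k = 4 ∨ k = 5 → ¬ k < 4 ∧ 3 ≤ k)
    rw [br_T_inr_of_not_lt (hd _ hq).1, der_T_of_ne Γ (by simp), D.hom_T (r := Sum.inr q) (hd _ hq).2,
      D.hom_T (r := Sum.inr q') (hd _ hq').2, D.br_image_inr hq, D.image_inr hq']
    simp [br_lamElt_lamElt]
  have h67 : ∀ (q q' : Idx ℓ) (r : J ℓ), (q.1 = 4 ∨ q.1 = 5) → q'.1 = 6 →
      (r = Sum.inl q' ∨ r = Sum.inr q') → D.hom χ (T Γ r) = T Γ' r →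
      D.hom χ (br Γ (T Γ (Sum.inr q)) (T Γ r)) =
        br Γ' (D.hom χ (T Γ (Sum.inr q))) (D.hom χ (T Γ r)) := by
    intro q q' r hq hq' hr e
    have hd := (by decide : ∀ k : Fin 7, k = 4 ∨ k = 5 → ¬ k < 4 ∧ 3 ≤ k)
    have hne : Sum.inl q ≠ r := by
      rintro rfl
      obtain rfl : q = q' := by simpa using hr
      rw [hq'] at hq
      exact absurd hq (by decide)
    rw [br_T_inr_of_not_lt (hd _ hq).1, der_T_of_ne Γ hne, D.hom_T (r := Sum.inr q) (hd _ hq).2, e,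
      D.br_image_inr hq]
    simp [br_lamElt_T hq' hr]
  -- Nine cases: each generator is an `x^α` or a logarithm-like variable, a `t_q̄` with `q ∈
  -- I_{5,6}`, or a variable of `I_7`.
  rcases D.generator_cases hu χ with ⟨α, w, h1, h1'⟩ | ⟨q, hq, rfl⟩ | ⟨q, r, hq, hr, rfl, e⟩ <;>
  rcases D.generator_cases hv χ with ⟨β, z, h2, h2'⟩ | ⟨q', hq', rfl⟩ | ⟨q', r', hq', hr', rfl, e'⟩
  · exact D.hom_br_of_der hχ h1 h1' h2 h2'
  · exact comm _ _ (D.hom_br_inr χ hq' h1 h1')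
  · refine comm _ _ ?_
    rw [e', br_T_of_der hq' hr' h1, br_T_of_der hq' hr' h1', map_zero]
  · exact D.hom_br_inr χ hq h2 h2'
  · exact h56 q q' hq hq'
  · exact h67 q q' r' hq hq' hr' e'
  · rw [e, br_T_of_der hq hr h2, br_T_of_der hq hr h2', map_zero]
  · exact comm _ _ (h67 q' q r hq' hq hr e)
  · obtain ⟨c, hc⟩ := br_T_T_eq (F := F) (s := r') hq hr
    rw [e, e', hc, hc, map_smul, map_one]

/-- The inverse is explicit: `τ⁻¹` with the inverse character on monomials, and on the variables the
inverse of an affine substitution with linear part `row` and constant part `remainder`. -/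
theorem hom_bijective (χ : Multiplicative Γ.toAddSubgroup →* Fˣ) :
    Function.Bijective (D.hom χ) := by
  classical
  obtain ⟨P, hMN, hNM⟩ : ∃ P : J ℓ → J ℓ → F,
      (∀ r s, ∑ k, D.row r k * P k s = if r = s then 1 else 0) ∧
      ∀ r s, ∑ k, P r k * D.row k s = if r = s then 1 else 0 := by
    obtain ⟨N, hN⟩ := D.isUnit_row
    refine ⟨N⁻¹.1, fun r s => ?_, fun r s => ?_⟩
    · have := congrFun (congrFun (Units.mul_inv N) r) s
      rwa [hN, Matrix.mul_apply, Matrix.one_apply] at this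
    · have := congrFun (congrFun (Units.inv_mul N) r) s
      rwa [hN, Matrix.mul_apply, Matrix.one_apply] at this
  let χ' : Multiplicative Γ'.toAddSubgroup →* Fˣ :=
    (χ.comp (AddMonoidHom.toMultiplicative τ.symm.toAddMonoidHom))⁻¹
  let g := twistedX τ.symm χ'
  let t : J ℓ → SemigroupAlg Γ := fun s =>
    ∑ r, P s r • (T Γ r - liftHom Γ' g 0 (D.remainder r))
  let ψ := liftHom Γ' g t
  have hψX : ∀ β, ψ (X Γ' β) =
      ((χ (Multiplicative.ofAdd (τ.symm β)))⁻¹ : Fˣ).1 • X Γ (τ.symm β) := fun β =>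
    liftHom_X Γ' _ _ β
  have hφψX : ∀ β, D.hom χ (ψ (X Γ' β)) = X Γ' β := by
    intro β
    rw [hψX, map_smul, hom_X, smul_smul, Units.inv_mul, one_smul, τ.apply_symm_apply]
  have hw : ∀ r, liftHom Γ' g 0 (D.remainder r) = ψ (D.remainder r) := fun r =>
    liftHom_eq_of_mem_span _ _ _ (D.remainder_mem r)
  have hφw : ∀ r, D.hom χ (ψ (D.remainder r)) = D.remainder r := by
    intro r
    have : Set.EqOn ((D.hom χ).comp ψ).toLinearMap (LinearMap.id (R := F))
        (Submodule.span F (Set.range (X Γ'))) := by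
      refine LinearMap.eqOn_span ?_
      rintro _ ⟨α, rfl⟩
      exact hφψX α
    exact this (D.remainder_mem r)
  have h1 : ψ.comp (D.hom χ) = AlgHom.id F _ := by
    refine algHom_ext Γ (fun α => ?_) fun r hr => ?_
    · rw [AlgHom.comp_apply, hom_X, map_smul, hψX, τ.symm_apply_apply, smul_smul, Units.mul_inv,
        one_smul, AlgHom.id_apply]
    -- If `s` has no down-grading part, `ψ (T Γ' s)` is zero and may differ from `t s`, but the
    -- coefficient in the row vanishes.
    · have e : ∀ s, D.row r s • ψ (T Γ' s) = D.row r s •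
          ∑ k, P s k • (T Γ k - liftHom Γ' g 0 (D.remainder k)) := by
        intro s
        by_cases hs : HasDown s
        · rw [show ψ (T Γ' s) = t s from liftHom_T Γ' _ _ hs]
        · rw [D.row_apply_eq_zero hr hs, zero_smul, zero_smul]
      rw [AlgHom.comp_apply, hom_T_eq_image, image, map_add, map_sum,
        Finset.sum_congr rfl fun s _ => (map_smul ψ _ _).trans (e s), sum_smul_sum_smul,
        Finset.sum_congr rfl fun k _ => by rw [hMN r k], AlgHom.id_apply]
      simp [hw]
  have h2 : (D.hom χ).comp ψ = AlgHom.id F _ := by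
    refine algHom_ext Γ' hφψX fun s hs => ?_
    have e : ∀ r, D.hom χ (T Γ r - liftHom Γ' g 0 (D.remainder r)) =
        ∑ k, D.row r k • T Γ' k := by
      intro r
      rw [map_sub, hw, hφw, hom_T_eq_image, image, add_sub_cancel_right]
    rw [AlgHom.comp_apply, show ψ (T Γ' s) = t s from liftHom_T Γ' _ _ hs, map_sum,
      Finset.sum_congr rfl fun r _ => (map_smul (D.hom χ) _ _).trans (by rw [e r]), sum_smul_sum_smul,
      Finset.sum_congr rfl fun k _ => by rw [hNM s k], AlgHom.id_apply]
    simp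
  exact ⟨fun u v h => by
    have := congrArg ψ h
    rwa [← AlgHom.comp_apply, ← AlgHom.comp_apply, h1] at this, fun v =>
    ⟨ψ v, DFunLike.congr_fun h2 v⟩⟩

end PreservingData

/-- Algebraic closedness enters here, through the character with values `b_p` at `σ_p`. -/
theorem IsPreserving.nonempty_lieEquiv {F : Type*} [Field F] [CharZero F] [IsAlgClosed F]
    {ℓ : Fin 7 → ℕ} {Γ Γ' : AdmissibleSubgroup F ℓ} {τ : Γ.toAddSubgroup ≃+ Γ'.toAddSubgroup}
    (h : IsPreserving τ) :
    Nonempty (HamiltonianLieAlgebra Γ ≃ₗ⁅F⁆ HamiltonianLieAlgebra Γ') := by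
  obtain ⟨D⟩ := h.nonempty_data
  obtain ⟨χ, hχ⟩ := exists_monoidHom_units_eq _ (linearIndependent_sg Γ)
    fun p => Units.mk0 (D.b p) (D.b_ne_zero p)
  let e : SemigroupAlg Γ ≃ₗ[F] SemigroupAlg Γ' :=
    LinearEquiv.ofBijective (D.hom χ).toLinearMap (D.hom_bijective χ)
  have he : ∀ u v, e (br Γ u v) = br Γ' (e u) (e v) :=
    D.hom_br fun p => by rw [hχ p]; rfl
  exact ⟨{ toFun := e
           invFun := e.symm
           map_add' := e.map_add
           map_smul' := e.map_smul
           map_lie' := fun {u v} => he u v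
           left_inv := e.left_inv
           right_inv := e.right_inv }⟩

end HamLie

end

theorem theorem3p6 {F : Type*} [Field F] [CharZero F] [IsAlgClosed F]
    (ℓ ℓ' : Fin 7 → ℕ) (hℓ : ℓ ≠ 0) (hℓ' : ℓ' ≠ 0)
    (Γ : HamLie.AdmissibleSubgroup F ℓ) (Γ' : HamLie.AdmissibleSubgroup F ℓ') :
    Nonempty (HamLie.HamiltonianLieAlgebra Γ ≃ₗ⁅F⁆ HamLie.HamiltonianLieAlgebra Γ') ↔
      ∃ h : ℓ' = ℓ,
        ∃ τ : Γ.toAddSubgroup ≃+ (h ▸ Γ' : HamLie.AdmissibleSubgroup F ℓ).toAddSubgroup,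
          HamLie.IsPreserving τ := by
  constructor
  · rintro ⟨φ⟩
    exact HamLie.exists_isPreserving φ hℓ
  · rintro ⟨rfl, τ, h⟩
    exact h.nonempty_lieEquiv
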